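/- **Rate of conditional entropy increase under diffusion.** Consider a bipartite system $AB$ in which $A$ consists of $m$ and $B$ of $n$ bosonic modes, with Hilbert space $L^2(\mathbb{R}^{m+n})$ and mode operators $R=(Q_1,P_1,\dots,Q_{m+n},P_{m+n})$ (those of $A$ first), $[R_k,R_\ell]=iJ_{k,\ell}$, $J=\begin{pmatrix}0&1\\-1&0\end{pmatrix}^{\oplus(m+n)}$. Let $\rho_{AB}$ be a Gaussian state with covariance matrix $M_{AB}$ and displacement vector $d$, that is, a density operator with $\operatorname{tr}(\rho_{AB}\,e^{i\eta\cdot R})=\exp(i\,\eta\cdot d-\tfrac14\eta^TM_{AB}\,\eta)$ for all $\eta\in\mathbb{R}^{2(m+n)}$, $M_{AB}$ symmetric. Let $S_{AB}$ be a real symplectic matrix ($S_{AB}JS_{AB}^T=J$) with $$S_{AB}M_{AB}S_{AB}^T=\operatorname{diag}(\lambda_1,\lambda_1,\dots,\lambda_{m+n},\lambda_{m+n}),$$ so that $\lambda_1,\dots,\lambda_{m+n}\ge 1$ are the symplectic eigenvalues of $M_{AB}$. For $t\ge 0$ let $\rho_{AB}(t)=(e^{t\mathcal{L}_A}\otimes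 I_B)(\rho_{AB})$ be the result of diffusion on $A$ for time $t$, where $\mathcal{L}_A(\rho)=-\tfrac14\sum_{k=1}^{2m}[R_k,[R_k,\rho]]$; equivalently, $\rho_{AB}(t)$ is the average of $W(\xi)\rho_{AB}W(\xi)^\dagger$ over random displacements $\xi$ of the modes of $A$ with independent centred Gaussian coordinates of variance $t/2$, where $W(\xi)^\dagger R_kW(\xi)=R_k+\xi_k$. Let $S(\rho)=-\operatorname{tr}(\rho\log\rho)$ and $S(A|B)_\rho=S(\rho)-S(\operatorname{tr}_A\rho)$. Put $\beta(\lambda)=\log\frac{\lambda+1}{\lambda-1}$, let $I_A\oplus 0_B$ be the projection onto the first $2m$ phase space coordinates, and for a $2(m+n)\times2(m+n)$ matrix $Z$ let $[Z]^{(\ell)}$ be the $2\times2$ submatrix of the rows and columns $2\ell-1,2\ell$. Then for every $t\ge0$ the state $\rho_{AB}(t)$ is Gaussian with covariance matrix $M_{AB}+t(I_A\oplus 0_B)$ and displacement vector $d$, the entropies of $\rho_{AB}(t)$ and of $\operatorname{tr}_A\rho_{AB}(t)$ are finite, and the (right) derivative at $t=0$ of the conditional entropy is $$\frac{d}{dt}\Big|_{t=0}S(A|B)_{\rho_{AB}(t)}=\frac14\sum_{\ell=1}^{m+n}\beta(\lambda_\ell)\,\operatorname{tr}\Big(\big[S_{AB}(I_A\oplus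 0_B)S_{AB}^T\big]^{(\ell)}\Big),$$ with the conventions $\beta(1)=+\infty$ and $0\cdot\infty=0$. That is: if $\operatorname{tr}([S_{AB}(I_A\oplus 0_B)S_{AB}^T]^{(\ell)})=0$ for every $\ell$ with $\lambda_\ell=1$ (in particular if all $\lambda_\ell>1$), then the right derivative exists and is the finite right-hand side, in which the terms with $\lambda_\ell=1$ vanish; otherwise the difference quotient $(S(A|B)_{\rho_{AB}(t)}-S(A|B)_{\rho_{AB}(0)})/t$ tends to $+\infty$ as $t\downarrow0$. -/

import Mathlib

open scoped Matrix Kronecker ENNReal NNReal InnerProductSpace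
open MeasureTheory ProbabilityTheory Filter Topology

namespace BosonicModes

noncomputable section

/-! ### Phase space and symplectic matrices -/

/-- Phase-space coordinates of a set `ι` of modes: the pair `(j, 0)` is the coordinate belonging to
`Q_j`, the pair `(j, 1)` the one belonging to `P_j`. -/
abbrev PhaseIdx (ι : Type) : Type := ι × Fin 2

/-- The symplectic form `J`, the direct sum over the modes of `!![0, 1; -1, 0]`. -/
def sympForm (ι : Type) [DecidableEq ι] : Matrix (PhaseIdx ι) (PhaseIdx ι) ℝ :=
  (1 : Matrix ι ι ℝ) ⊗ₖ !![0, 1; -1, 0]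

/-- A matrix `S` is symplectic if `S J Sᵀ = J`. -/
def IsSymplectic {ι : Type} [Fintype ι] [DecidableEq ι]
    (S : Matrix (PhaseIdx ι) (PhaseIdx ι) ℝ) : Prop :=
  S * sympForm ι * Sᵀ = sympForm ι

/-- `D(λ) = diag(λ₁, λ₁, λ₂, λ₂, …)`. -/
def doubledDiagonal {ι : Type} [DecidableEq ι] (lam : ι → ℝ) :
    Matrix (PhaseIdx ι) (PhaseIdx ι) ℝ :=
  Matrix.diagonal fun p => lam p.1

/-- `I_A ⊕ 0_B` on the phase space of the modes `ι` (system `A`) and `κ` (system `B`). -/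
def projA (ι κ : Type) [DecidableEq ι] [DecidableEq κ] :
    Matrix (PhaseIdx (ι ⊕ κ)) (PhaseIdx (ι ⊕ κ)) ℝ :=
  Matrix.diagonal fun p => Sum.elim (fun _ => 1) (fun _ => 0) p.1

/-- The `2 × 2` submatrix `[Z]^(ℓ)` belonging to the mode `ℓ`. -/
def modeBlock {ι : Type} (Z : Matrix (PhaseIdx ι) (PhaseIdx ι) ℝ) (l : ι) :
    Matrix (Fin 2) (Fin 2) ℝ :=
  Z.submatrix (fun i => (l, i)) (fun i => (l, i))

/-- The inverse temperature `β(λ) = log ((λ + 1) / (λ - 1))`. -/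
def invTemp (x : ℝ) : ℝ := Real.log ((x + 1) / (x - 1))

/-! ### The Hilbert space and the Weyl operators -/

/-- The Hilbert space `L²(ℝ^ι)` of a finite set `ι` of modes. The mode operators are the
multiplication operators `Q_j = x_j` and `P_j = -i ∂/∂x_j`. -/
abbrev ModeSpace (ι : Type) [Fintype ι] : Type := Lp ℂ 2 (volume : Measure (ι → ℝ))

/-- Bounded operators on the Hilbert space of the modes `ι`. -/
abbrev ModeOp (ι : Type) [Fintype ι] : Type := ModeSpace ι →L[ℂ] ModeSpace ι

/-- The function `x ↦ exp (i (u·x + u·v / 2)) f (x + v)`, where `u` and `v` are the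
`Q`- and the `P`-components of `η`. -/
def weylFun {ι : Type} [Fintype ι] (η : PhaseIdx ι → ℝ) (f : (ι → ℝ) → ℂ) : (ι → ℝ) → ℂ :=
  fun x => Complex.exp (Complex.I * ((∑ j, η (j, 0) * (x j + η (j, 1) / 2) : ℝ) : ℂ)) *
    f (x + fun j => η (j, 1))

theorem norm_weylFun {ι : Type} [Fintype ι] (η : PhaseIdx ι → ℝ) (f : (ι → ℝ) → ℂ) (x : ι → ℝ) :
    ‖weylFun η f x‖ = ‖f (x + fun j => η (j, 1))‖ := by
  unfold weylFun
  rw [norm_mul, mul_comm Complex.I, Complex.norm_exp_ofReal_mul_I, one_mul]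

theorem memLp_weylFun {ι : Type} [Fintype ι] (η : PhaseIdx ι → ℝ) {f : (ι → ℝ) → ℂ}
    (hf : MemLp f 2 volume) : MemLp (weylFun η f) 2 volume := by
  have hT : MeasurePreserving (fun x : ι → ℝ => x + fun j => η (j, 1)) volume volume :=
    measurePreserving_add_right volume _
  have h := hf.comp_measurePreserving hT
  refine MemLp.of_le h ?_ (Eventually.of_forall fun x => (norm_weylFun η f x).le)
  refine AEStronglyMeasurable.mul ?_ h.aestronglyMeasurable
  exact Continuous.aestronglyMeasurable (by fun_prop)

/-- The unitary Weyl operator `exp (i η·R) = exp (i ∑_j (u_j Q_j + v_j P_j))`, where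
`u_j = η (j, 0)` and `v_j = η (j, 1)`; explicitly
`(exp (i η·R) f) x = exp (i (u·x + u·v / 2)) f (x + v)`. -/
def expIR {ι : Type} [Fintype ι] (η : PhaseIdx ι → ℝ) : ModeOp ι :=
  LinearIsometry.toContinuousLinearMap
    { toFun := fun f => (memLp_weylFun η (Lp.memLp f)).toLp (weylFun η f)
      map_add' := by
        intro f g
        rw [← MemLp.toLp_add]
        refine MemLp.toLp_congr _ _ ?_
        have hT : MeasurePreserving (fun x : ι → ℝ => x + fun j => η (j, 1)) volume volume :=
          measurePreserving_add_right volume _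
        filter_upwards [hT.quasiMeasurePreserving.ae (Lp.coeFn_add f g)] with x hx
        simp only [weylFun, Pi.add_apply] at hx ⊢
        rw [hx, mul_add]
      map_smul' := by
        intro c f
        rw [RingHom.id_apply, ← MemLp.toLp_const_smul]
        refine MemLp.toLp_congr _ _ ?_
        have hT : MeasurePreserving (fun x : ι → ℝ => x + fun j => η (j, 1)) volume volume :=
          measurePreserving_add_right volume _
        filter_upwards [hT.quasiMeasurePreserving.ae (Lp.coeFn_smul c f)] with x hx
        simp only [weylFun, Pi.smul_apply, smul_eq_mul] at hx ⊢
        rw [hx]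
        ring
      norm_map' := by
        intro f
        have hT : MeasurePreserving (fun x : ι → ℝ => x + fun j => η (j, 1)) volume volume :=
          measurePreserving_add_right volume _
        change ‖(memLp_weylFun η (Lp.memLp f)).toLp (weylFun η f)‖ = ‖f‖
        rw [Lp.norm_toLp, Lp.norm_def]
        congr 1
        rw [← eLpNorm_comp_measurePreserving (Lp.aestronglyMeasurable f) hT]
        exact eLpNorm_congr_norm_ae (Eventually.of_forall fun x => norm_weylFun η f x) }

theorem expIR_coeFn {ι : Type} [Fintype ι] (η : PhaseIdx ι → ℝ) (f : ModeSpace ι) :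
    expIR η f =ᵐ[volume] weylFun η f :=
  MemLp.coeFn_toLp (memLp_weylFun η (Lp.memLp f))

/-- The displacement operator `W(ξ)`, which satisfies `W(ξ)† R_k W(ξ) = R_k + ξ_k`. Since
`[R_k, R_l] = i J_{k,l}`, it is `exp (i (Jξ)·R)`. -/
def displacement {ι : Type} [Fintype ι] [DecidableEq ι] (ξ : PhaseIdx ι → ℝ) : ModeOp ι :=
  expIR (sympForm ι *ᵥ ξ)

/-! ### Trace, states, entropy -/

section States

variable {H : Type} [NormedAddCommGroup H] [InnerProductSpace ℂ H] [CompleteSpace H]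

/-- The index set of a fixed orthonormal basis. -/
def basisSet (H : Type) [NormedAddCommGroup H] [InnerProductSpace ℂ H] [CompleteSpace H] :
    Set H :=
  (exists_hilbertBasis ℂ H).choose

/-- A fixed orthonormal basis of `H`. -/
def onb (H : Type) [NormedAddCommGroup H] [InnerProductSpace ℂ H] [CompleteSpace H] :
    HilbertBasis (basisSet H) ℂ H :=
  (exists_hilbertBasis ℂ H).choose_spec.choose

/-- An operator is trace class if its diagonal is (absolutely) summable in every orthonormal
basis. -/
def IsTraceClass (T : H →L[ℂ] H) : Prop :=
  ∀ (w : Set H) (b : HilbertBasis w ℂ H), Summable fun i => ⟪b i, T (b i)⟫_ℂ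

/-- The trace of a trace class operator (it does not depend on the orthonormal basis). -/
def trace (T : H →L[ℂ] H) : ℂ := ∑' i, ⟪onb H i, T (onb H i)⟫_ℂ

/-- Quantum states: positive trace class operators of trace one. -/
structure IsDensityOperator (ρ : H →L[ℂ] H) : Prop where
  isPositive : ρ.IsPositive
  isTraceClass : IsTraceClass ρ
  trace_eq_one : trace ρ = 1

/-- The von Neumann entropy `S(ρ) = -tr (ρ log ρ) ∈ [0, ∞]` of a quantum state, the trace of the
positive operator `-ρ log ρ`, where `0 log 0 = 0`. The operator is given by the continuous
functional calculus. -/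
def entropy (ρ : H →L[ℂ] H) : ℝ≥0∞ :=
  ∑' i, ENNReal.ofReal
    (RCLike.re ⟪onb H i, cfc (fun x : ℝ => -(x * Real.log x)) ρ (onb H i)⟫_ℂ)

end States

/-- `ρ` is a Gaussian state with covariance matrix `M` and displacement vector `d`: a state whose
characteristic function is `tr (ρ exp (i η·R)) = exp (i η·d - ηᵀ M η / 4)`. The first and second
moments of such a state are `d_k = tr (ρ R_k)` and `M_{j,k} = tr (ρ {R_j - d_j, R_k - d_k})`. -/
structure IsGaussianState {ι : Type} [Fintype ι] (ρ : ModeOp ι)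
    (M : Matrix (PhaseIdx ι) (PhaseIdx ι) ℝ) (d : PhaseIdx ι → ℝ) : Prop where
  isDensityOperator : IsDensityOperator ρ
  isSymm : M.IsSymm
  charFun_eq : ∀ η : PhaseIdx ι → ℝ,
    trace (ρ ∘L expIR η) =
      Complex.exp (Complex.I * ((η ⬝ᵥ d : ℝ) : ℂ) - ((η ⬝ᵥ (M *ᵥ η) : ℝ) : ℂ) / 4)

/-! ### Bipartite systems: partial trace and conditional entropy -/

section Bipartite

variable {ι κ : Type} [Fintype ι] [Fintype κ]

/-- The function `(x, y) ↦ e x * f y`. -/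
def tensorFun (e : (ι → ℝ) → ℂ) (f : (κ → ℝ) → ℂ) : (ι ⊕ κ → ℝ) → ℂ :=
  fun z => e (fun i => z (Sum.inl i)) * f (fun j => z (Sum.inr j))

theorem measurePreserving_split :
    MeasurePreserving
      (fun z : ι ⊕ κ → ℝ => ((fun i => z (Sum.inl i), fun j => z (Sum.inr j)) :
        (ι → ℝ) × (κ → ℝ))) volume volume :=
  volume_measurePreserving_sumPiEquivProdPi (fun _ : ι ⊕ κ => ℝ)

theorem ae_right_of_ae {p : (κ → ℝ) → Prop} (h : ∀ᵐ y : κ → ℝ, p y) :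
    ∀ᵐ z : ι ⊕ κ → ℝ, p (fun j => z (Sum.inr j)) :=
  (Measure.quasiMeasurePreserving_snd.comp
    (measurePreserving_split (ι := ι) (κ := κ)).quasiMeasurePreserving).ae h

theorem aestronglyMeasurable_mul_split {e : (ι → ℝ) → ℂ} {f : (κ → ℝ) → ℂ}
    (he : AEStronglyMeasurable e volume) (hf : AEStronglyMeasurable f volume) :
    AEStronglyMeasurable (fun p : (ι → ℝ) × (κ → ℝ) => e p.1 * f p.2) volume :=
  (he.comp_quasiMeasurePreserving Measure.quasiMeasurePreserving_fst).mul
    (hf.comp_quasiMeasurePreserving Measure.quasiMeasurePreserving_snd)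

theorem eLpNorm_tensorFun {e : (ι → ℝ) → ℂ} {f : (κ → ℝ) → ℂ}
    (he : AEStronglyMeasurable e volume) (hf : AEStronglyMeasurable f volume) :
    eLpNorm (tensorFun e f) 2 volume = eLpNorm e 2 volume * eLpNorm f 2 volume := by
  have h1 : eLpNorm (tensorFun e f) 2 volume =
      eLpNorm (fun p : (ι → ℝ) × (κ → ℝ) => e p.1 * f p.2) 2 volume := by
    have h0 := aestronglyMeasurable_mul_split he hf
    have h2 := measurePreserving_split (ι := ι) (κ := κ)
    rw [← eLpNorm_comp_measurePreserving h0 h2]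
    rfl
  rw [h1, eLpNorm_eq_lintegral_rpow_enorm_toReal two_ne_zero ENNReal.ofNat_ne_top,
    eLpNorm_eq_lintegral_rpow_enorm_toReal two_ne_zero ENNReal.ofNat_ne_top,
    eLpNorm_eq_lintegral_rpow_enorm_toReal two_ne_zero ENNReal.ofNat_ne_top,
    ← ENNReal.mul_rpow_of_nonneg _ _ (by positivity)]
  congr 1
  simp only [enorm_mul]
  simp_rw [ENNReal.mul_rpow_of_nonneg _ _ (ENNReal.toReal_nonneg (a := 2))]
  exact lintegral_prod_mul (μ := (volume : Measure (ι → ℝ))) (ν := (volume : Measure (κ → ℝ)))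
    (he.enorm.pow_const _) (hf.enorm.pow_const _)

theorem memLp_tensorFun {e : (ι → ℝ) → ℂ} {f : (κ → ℝ) → ℂ}
    (he : MemLp e 2 volume) (hf : MemLp f 2 volume) : MemLp (tensorFun e f) 2 volume := by
  refine ⟨?_, ?_⟩
  · exact (aestronglyMeasurable_mul_split he.1 hf.1).comp_measurePreserving
      measurePreserving_split
  · rw [eLpNorm_tensorFun he.1 hf.1]
    exact ENNReal.mul_lt_top he.2 hf.2

/-- The operator `f ↦ e ⊗ f` from the Hilbert space of the modes `κ` to that of the modes `ι ⊕ κ`,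
where `(e ⊗ f)(x, y) = e x * f y`. -/
def tensorLeft (e : ModeSpace ι) : ModeSpace κ →L[ℂ] ModeSpace (ι ⊕ κ) :=
  LinearMap.mkContinuous
    { toFun := fun f => (memLp_tensorFun (Lp.memLp e) (Lp.memLp f)).toLp (tensorFun e f)
      map_add' := by
        intro f g
        rw [← MemLp.toLp_add]
        refine MemLp.toLp_congr _ _ ?_
        filter_upwards [ae_right_of_ae (ι := ι) (Lp.coeFn_add f g)] with z hz
        simp only [tensorFun, Pi.add_apply] at hz ⊢
        rw [hz, mul_add]
      map_smul' := by
        intro c f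
        rw [RingHom.id_apply, ← MemLp.toLp_const_smul]
        refine MemLp.toLp_congr _ _ ?_
        filter_upwards [ae_right_of_ae (ι := ι) (Lp.coeFn_smul c f)] with z hz
        simp only [tensorFun, Pi.smul_apply, smul_eq_mul] at hz ⊢
        rw [hz]
        ring }
    ‖e‖
    (by
      intro f
      change ‖(memLp_tensorFun (Lp.memLp e) (Lp.memLp f)).toLp (tensorFun e f)‖ ≤ ‖e‖ * ‖f‖
      rw [Lp.norm_toLp, eLpNorm_tensorFun (Lp.aestronglyMeasurable e) (Lp.aestronglyMeasurable f),
        ENNReal.toReal_mul, Lp.norm_def, Lp.norm_def])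

theorem tensorLeft_coeFn (e : ModeSpace ι) (f : ModeSpace κ) :
    tensorLeft e f =ᵐ[volume] tensorFun e f :=
  MemLp.coeFn_toLp (memLp_tensorFun (Lp.memLp e) (Lp.memLp f))

/-- The reduced state `tr_A ρ = ∑_k (⟨e_k| ⊗ I) ρ (|e_k⟩ ⊗ I)` on the modes `κ` (system `B`) of a
state `ρ` on the modes `ι ⊕ κ`, where `(e_k)` is an orthonormal basis of the Hilbert space of the
modes `ι` (system `A`). For a state `ρ` the series converges absolutely in operator norm. -/
def partialTraceA (ρ : ModeOp (ι ⊕ κ)) : ModeOp κ :=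
  ∑' k, ContinuousLinearMap.adjoint (tensorLeft (κ := κ) (onb (ModeSpace ι) k)) ∘L ρ ∘L
    tensorLeft (κ := κ) (onb (ModeSpace ι) k)

/-- The conditional entropy `S(A|B) = S(AB) - S(B)` of a state `ρ` of the system `AB` in which `A`
consists of the modes `ι` and `B` of the modes `κ`. -/
def condEntropy (ρ : ModeOp (ι ⊕ κ)) : ℝ :=
  (entropy ρ).toReal - (entropy (partialTraceA ρ)).toReal

variable [DecidableEq ι] [DecidableEq κ]

/-- The Gaussian law of the random displacement that implements diffusion for time `t` on the modes
`ι` (system `A`): independent coordinates, of variance `t / 2` on `A` and equal to `0` on the modes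
`κ` (system `B`). -/
def diffusionLaw (ι κ : Type) [Fintype ι] [Fintype κ] (t : ℝ) :
    Measure (PhaseIdx (ι ⊕ κ) → ℝ) :=
  Measure.pi fun p =>
    gaussianReal 0 (Sum.elim (fun _ => (t / 2).toNNReal) (fun _ => 0) p.1)

/-- The diffusion `(exp (t 𝓛_A) ⊗ I_B) ρ = ∫ W(ξ) ρ W(ξ)† dγ_t(ξ)` for time `t ≥ 0`, the mixture of
displacements of the `A`-modes with respect to the centred Gaussian law `γ_t` of variance `t / 2`
in each direction. It is the semigroup generated by
`𝓛_A ρ = -(1/4) ∑_k [R_k, [R_k, ρ]]`, the sum being over the mode operators of `A`. (For a state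
`ρ` the integrand is bounded and continuous in operator norm, because `ρ` is compact.) -/
def diffusionA (t : ℝ) (ρ : ModeOp (ι ⊕ κ)) : ModeOp (ι ⊕ κ) :=
  ∫ ξ, displacement ξ ∘L ρ ∘L ContinuousLinearMap.adjoint (displacement ξ)
    ∂(diffusionLaw ι κ t)

end Bipartite

end

end BosonicModes

open BosonicModes

/-!
The entropy of a Gaussian state is a function of the symplectic eigenvalues `λ_l` of its covariance
matrix, and the reduced state on `B` is not affected by diffusion on `A`. So the theorem is about the
entropy along the ray `M + t P` of covariance matrices, where `P = I_A ⊕ 0_B`.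

*The ray.* Diffusion is an average over displacements, which multiplies the characteristic function
by the Gaussian characteristic function of the random displacement (`IsGaussianState.diffusionA`);
the partial trace restricts the characteristic function to the phase space of `B`
(`IsGaussianState.partialTraceA`). In both cases the state is written as a mixture of vector states,
and expectations are computed as averages (`mixture_isDensityOperator`).

*The entropy.* A symplectic matrix that diagonalizes the covariance matrix yields transformed Weyl
operators for which the state is thermal. The Gaussian average of these operators is the projection
onto a vacuum vector (`IsWeylSystem.exists_vacuum`), the Gram kernel of the coherent vectors yields
the number basis, and a Gaussian integral shows that the state is diagonal in this basis, with a
product of geometric distributions as eigenvalues (`IsWeylSystem.gaussian_spectrum`). Positivity of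
the eigenvalues implies `λ_l ≥ 1`, and the entropy is `∑ g(λ_l)`, where `g` is `modeEntropy`
(`IsGaussianState.entropy_eq`). For the matrices `M + t P` and for the covariance matrix of `B` the
diagonalizing symplectic matrix is supplied by Williamson's theorem
(`exists_symplectic_diagonalization`), which follows from the normal form of skew-symmetric
operators.

*The rate.* Perturbation theory of the symplectic eigenvalues, which would be delicate at `λ_l = 1`,
is avoided by the formula

  `∑ g(λ_l) = (1/2) ∫₀¹ log det (M + i s J) ds + const`,

where `det (M + i s J) = ∏ (λ_l² - s²)` is a symplectic invariant (`sum_modeEntropy_eq_integral`).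
For `0 ≤ s < 1` the Hermitian matrix `M + i s J` is positive definite by the uncertainty relation, so
that `det (M + t P + i s J) = det (M + i s J) ∏ (1 + t κ_j)` with `κ_j ≥ 0` (`exists_det_add_smul`).
Hence the difference quotients of `log det (M + t P + i s J)` lie between zero and their limit

  `∑ κ_j = tr ((M + i s J)⁻¹ P) = ∑ λ_l x_l / (λ_l² - s²)`,  `x_l = tr ([S P Sᵀ]^(l))`.

The integral of `λ / (λ² - s²)` over `0 ≤ s ≤ 1` is half of the inverse temperature of `λ`, and it
diverges for `λ = 1`. If `x_l = 0` whenever `λ_l = 1`, dominated convergence gives the derivative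
(`tendsto_entropy_quotient`); otherwise, dominated convergence on `0 ≤ s ≤ a` for `a` close to `1`
shows that the difference quotients exceed every bound (`tendsto_entropy_quotient_atTop`).
-/

namespace BosonicModes

/-! ### Fourier uniqueness -/

open scoped FourierTransform SchwartzMap in
/-- An integrable function with vanishing Fourier transform vanishes almost everywhere: test it
against Schwartz functions, which are themselves Fourier transforms. -/
theorem ae_eq_zero_of_fourier_eq_zero {V : Type*} [NormedAddCommGroup V] [InnerProductSpace ℝ V]
    [FiniteDimensional ℝ V] [MeasurableSpace V] [BorelSpace V] {F : V → ℂ} (hF : Integrable F)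
    (h : ∀ w, 𝓕 F w = 0) : ∀ᵐ x, F x = 0 := by
  refine ae_eq_zero_of_integral_contDiff_smul_eq_zero hF.locallyIntegrable fun g hg hgc => ?_
  have hgc' : HasCompactSupport (fun x => (g x : ℂ)) :=
    hgc.comp_left (g := fun r : ℝ => (r : ℂ)) (by simp)
  have hg' : ContDiff ℝ (⊤ : ℕ∞) (fun x => (g x : ℂ)) := Complex.ofRealCLM.contDiff.comp hg
  set φ : 𝓢(V, ℂ) := hgc'.toSchwartzMap hg' with hφ
  have hφx : ∀ x, φ x = (g x : ℂ) := fun x => rfl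
  set ψ : 𝓢(V, ℂ) := 𝓕⁻ φ with hψ
  have hψφ : 𝓕 ψ = φ := FourierTransform.fourier_fourierInv_eq φ
  have h1 := VectorFourier.integral_fourierIntegral_smul_eq_flip (μ := (volume : Measure V))
    (ν := (volume : Measure V)) (L := innerₗ V) (f := F) (g := ψ) Real.continuous_fourierChar
    (by simpa using continuous_inner) hF ψ.integrable
  have h2 : ∀ x, VectorFourier.fourierIntegral Real.fourierChar volume (innerₗ V) F x = 0 := h
  have h3 : ∀ x, VectorFourier.fourierIntegral Real.fourierChar volume (innerₗ V).flip ψ x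
      = φ x := by
    intro x
    rw [flip_innerₗ, ← hψφ, SchwartzMap.fourier_coe]
    rfl
  simp only [h2, h3, hφx, zero_smul, integral_zero] at h1
  rw [h1]
  refine integral_congr_ae (Eventually.of_forall fun x => ?_)
  simp [mul_comm]

/-- Fourier uniqueness in coordinates, without the factor `2π` in the exponent. -/
theorem ae_eq_zero_of_forall_integral_exp_mul_eq_zero {ι : Type*} [Fintype ι]
    {F : (ι → ℝ) → ℂ} (hF : Integrable F)
    (h : ∀ u : ι → ℝ, ∫ x, Complex.exp (Complex.I * ((∑ j, u j * x j : ℝ) : ℂ)) * F x = 0) :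
    ∀ᵐ x, F x = 0 := by
  have hmp := PiLp.volume_preserving_ofLp ι
  have hemb : MeasurableEmbedding (WithLp.ofLp : EuclideanSpace ℝ ι → ι → ℝ) :=
    (MeasurableEquiv.toLp 2 (ι → ℝ)).symm.measurableEmbedding
  have hF' : Integrable (fun x : EuclideanSpace ℝ ι => F x.ofLp) :=
    (hmp.integrable_comp_emb hemb).2 hF
  have h0 : ∀ᵐ x : EuclideanSpace ℝ ι, F x.ofLp = 0 := by
    refine ae_eq_zero_of_fourier_eq_zero hF' fun w => ?_
    rw [Real.fourier_eq']
    rw [← h (fun j => -2 * Real.pi * w j), ← hmp.integral_comp hemb]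
    refine integral_congr_ae (Eventually.of_forall fun x => ?_)
    simp only [smul_eq_mul]
    congr 2
    rw [mul_comm Complex.I]
    congr 2
    simp only [PiLp.inner_apply, RCLike.inner_apply, conj_trivial, Finset.mul_sum]
    exact Finset.sum_congr rfl fun j _ => by ring
  have := (PiLp.volume_preserving_toLp ι).quasiMeasurePreserving.ae h0
  simpa using this

end BosonicModes

namespace BosonicModes

/-! ### The Weyl operators: commutation relations, continuity, irreducibility -/

section Symplectic

variable {ι : Type} [Fintype ι]

/-- The symplectic form `σ(η, ζ) = ηᵀ J ζ` on phase space. -/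
def sympl (η ζ : PhaseIdx ι → ℝ) : ℝ := ∑ j, (η (j, 0) * ζ (j, 1) - η (j, 1) * ζ (j, 0))

theorem sympl_add_left (η η' ζ : PhaseIdx ι → ℝ) :
    sympl (η + η') ζ = sympl η ζ + sympl η' ζ := by
  simp only [sympl, ← Finset.sum_add_distrib, Pi.add_apply]
  exact Finset.sum_congr rfl fun j _ => by ring

theorem sympl_add_right (η ζ ζ' : PhaseIdx ι → ℝ) :
    sympl η (ζ + ζ') = sympl η ζ + sympl η ζ' := by
  simp only [sympl, ← Finset.sum_add_distrib, Pi.add_apply]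
  exact Finset.sum_congr rfl fun j _ => by ring

theorem sympl_neg_left (η ζ : PhaseIdx ι → ℝ) : sympl (-η) ζ = -sympl η ζ := by
  simp only [sympl, ← Finset.sum_neg_distrib, Pi.neg_apply]
  exact Finset.sum_congr rfl fun j _ => by ring

theorem sympl_neg_right (η ζ : PhaseIdx ι → ℝ) : sympl η (-ζ) = -sympl η ζ := by
  simp only [sympl, ← Finset.sum_neg_distrib, Pi.neg_apply]
  exact Finset.sum_congr rfl fun j _ => by ring

theorem sympl_self (η : PhaseIdx ι → ℝ) : sympl η η = 0 := by
  simp [sympl, mul_comm]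

theorem sympl_swap (η ζ : PhaseIdx ι → ℝ) : sympl η ζ = -sympl ζ η := by
  simp only [sympl, ← Finset.sum_neg_distrib]
  exact Finset.sum_congr rfl fun j _ => by ring

theorem sympl_sub_right (η ζ ζ' : PhaseIdx ι → ℝ) :
    sympl η (ζ - ζ') = sympl η ζ - sympl η ζ' := by
  rw [sub_eq_add_neg, sympl_add_right, sympl_neg_right, sub_eq_add_neg]

theorem sympl_zero_right (η : PhaseIdx ι → ℝ) : sympl η 0 = 0 := by
  simp [sympl]

@[fun_prop]
theorem Continuous.sympl {X : Type*} [TopologicalSpace X] {f g : X → PhaseIdx ι → ℝ}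
    (hf : Continuous f) (hg : Continuous g) : Continuous fun x => sympl (f x) (g x) := by
  unfold BosonicModes.sympl
  fun_prop

variable [DecidableEq ι]

theorem sympForm_mulVec (ζ : PhaseIdx ι → ℝ) (j : ι) :
    (sympForm ι *ᵥ ζ) (j, 0) = ζ (j, 1) ∧ (sympForm ι *ᵥ ζ) (j, 1) = -ζ (j, 0) := by
  constructor <;>
  simp [sympForm, Matrix.mulVec, dotProduct, Fintype.sum_prod_type, Matrix.kroneckerMap_apply,
    Matrix.one_apply]

theorem sympl_eq_dotProduct (η ζ : PhaseIdx ι → ℝ) :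
    sympl η ζ = η ⬝ᵥ (sympForm ι *ᵥ ζ) := by
  simp only [sympl, dotProduct, Fintype.sum_prod_type, Fin.sum_univ_two, sympForm_mulVec]
  exact Finset.sum_congr rfl fun j _ => by ring

end Symplectic

section Weyl

variable {ι : Type} [Fintype ι]

/-- The canonical commutation relations in Weyl form. -/
theorem expIR_expIR (η ζ : PhaseIdx ι → ℝ) (f : ModeSpace ι) :
    expIR η (expIR ζ f) =
      Complex.exp (-(Complex.I / 2) * (sympl η ζ : ℝ)) • expIR (η + ζ) f := by
  refine Lp.ext ?_
  have hT : MeasurePreserving (fun x : ι → ℝ => x + fun j => η (j, 1)) volume volume :=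
    measurePreserving_add_right volume _
  filter_upwards [expIR_coeFn η (expIR ζ f), hT.quasiMeasurePreserving.ae (expIR_coeFn ζ f),
    Lp.coeFn_smul (Complex.exp (-(Complex.I / 2) * (sympl η ζ : ℝ))) (expIR (η + ζ) f),
    expIR_coeFn (η + ζ) f] with x h1 h2 h3 h4
  rw [h1, h3, Pi.smul_apply, h4, smul_eq_mul]
  simp only [weylFun] at h2 ⊢
  rw [h2]
  have hx : (x + (fun j => η (j, 1)) + fun j => ζ (j, 1)) = x + fun j => (η + ζ) (j, 1) := by
    ext j; simp [add_assoc]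
  rw [hx, ← mul_assoc, ← mul_assoc, ← Complex.exp_add, ← Complex.exp_add]
  congr 2
  have key : (∑ j, η (j, 0) * (x j + η (j, 1) / 2)) +
      (∑ j, ζ (j, 0) * ((x + fun j => η (j, 1)) j + ζ (j, 1) / 2)) =
      -(1 / 2) * sympl η ζ + ∑ j, (η + ζ) (j, 0) * (x j + (η + ζ) (j, 1) / 2) := by
    simp only [sympl, Finset.mul_sum, ← Finset.sum_add_distrib, Pi.add_apply]
    exact Finset.sum_congr rfl fun j _ => by ring
  rw [← mul_add, ← Complex.ofReal_add, key]
  push_cast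
  ring

theorem expIR_zero (f : ModeSpace ι) : expIR 0 f = f := by
  refine Lp.ext ?_
  filter_upwards [expIR_coeFn 0 f] with x hx
  rw [hx]
  have : (x + fun j : ι => (0 : PhaseIdx ι → ℝ) (j, 1)) = x := by ext j; simp
  simp only [weylFun, this]
  simp

theorem norm_expIR (η : PhaseIdx ι → ℝ) (f : ModeSpace ι) : ‖expIR η f‖ = ‖f‖ := by
  unfold expIR
  rw [LinearIsometry.coe_toContinuousLinearMap]
  exact LinearIsometry.norm_map _ f

theorem inner_expIR_expIR (η : PhaseIdx ι → ℝ) (f g : ModeSpace ι) :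
    ⟪expIR η f, expIR η g⟫_ℂ = ⟪f, g⟫_ℂ := by
  unfold expIR
  rw [LinearIsometry.coe_toContinuousLinearMap]
  exact LinearIsometry.inner_map_map _ f g

theorem expIR_neg_expIR (η : PhaseIdx ι → ℝ) (f : ModeSpace ι) : expIR (-η) (expIR η f) = f := by
  rw [expIR_expIR, sympl_neg_left, sympl_self]
  simp [expIR_zero]

theorem adjoint_expIR (η : PhaseIdx ι → ℝ) :
    ContinuousLinearMap.adjoint (expIR η) = expIR (-η) := by
  refine (ContinuousLinearMap.eq_adjoint_iff _ _).2 (fun f g => ?_) |>.symm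
  rw [← inner_expIR_expIR η, ← expIR_neg_expIR (-η) f, neg_neg, expIR_neg_expIR]

theorem tendsto_expIR_zero (f : ModeSpace ι) :
    Tendsto (fun η : PhaseIdx ι → ℝ => expIR η f) (𝓝 0) (𝓝 f) := by
  -- `W(η)` is isometric, so `‖W(η) f - f‖² = 2 ‖f‖² - 2 Re ⟪f, W(η) f⟫`
  suffices h : Tendsto (fun η : PhaseIdx ι → ℝ => ⟪f, expIR η f⟫_ℂ) (𝓝 0) (𝓝 ⟪f, f⟫_ℂ) by
    rw [tendsto_iff_norm_sub_tendsto_zero]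
    have h1 : ∀ η : PhaseIdx ι → ℝ, ‖expIR η f - f‖ =
        √(2 * (RCLike.re ⟪f, f⟫_ℂ - RCLike.re ⟪f, expIR η f⟫_ℂ)) := by
      intro η
      rw [← Real.sqrt_sq (norm_nonneg (expIR η f - f)), @norm_sub_sq ℂ, norm_expIR,
        inner_re_symm, inner_self_eq_norm_sq]
      congr 1; ring
    simp_rw [h1]
    have h2 : Tendsto (fun η : PhaseIdx ι → ℝ =>
        √(2 * (RCLike.re ⟪f, f⟫_ℂ - RCLike.re ⟪f, expIR η f⟫_ℂ))) (𝓝 0)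
        (𝓝 (√(2 * (RCLike.re ⟪f, f⟫_ℂ - RCLike.re ⟪f, f⟫_ℂ)))) :=
      ((tendsto_const_nhds.sub ((RCLike.continuous_re.tendsto _).comp h)).const_mul 2).sqrt
    simpa using h2
  have hmp : ∀ η : PhaseIdx ι → ℝ,
      MeasurePreserving (fun x : ι → ℝ => x + fun j => η (j, 1)) volume volume :=
    fun η => measurePreserving_add_right volume _
  let τ : (PhaseIdx ι → ℝ) → C(ι → ℝ, ι → ℝ) := fun η =>
    ⟨fun x : ι → ℝ => x + fun j => η (j, 1), by fun_prop⟩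
  have hτ : Continuous τ := by
    refine ContinuousMap.continuous_of_continuous_uncurry _ ?_
    change Continuous fun p : (PhaseIdx ι → ℝ) × (ι → ℝ) => p.2 + fun j => p.1 (j, 1)
    fun_prop
  -- the translation part of the Weyl operator
  let Tr : (PhaseIdx ι → ℝ) → ModeSpace ι := fun η => Lp.compMeasurePreserving (τ η) (hmp η) f
  have hTr : Continuous Tr :=
    continuous_const.compMeasurePreservingLp hτ hmp (by simp)
  have hTr0 : Tr 0 = f := by
    refine Lp.ext ?_
    filter_upwards [Lp.coeFn_compMeasurePreserving f (hmp 0)] with x hx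
    refine hx.trans ?_
    have : (x + fun j : ι => (0 : PhaseIdx ι → ℝ) (j, 1)) = x := by ext j; simp
    simp only [Function.comp, this]
  let θ : (PhaseIdx ι → ℝ) → (ι → ℝ) → ℂ := fun η x =>
    Complex.exp (Complex.I * ((∑ j, η (j, 0) * (x j + η (j, 1) / 2) : ℝ) : ℂ))
  have hθn : ∀ η x, ‖θ η x‖ = 1 := fun η x => by
    simp only [θ]
    rw [mul_comm Complex.I, Complex.norm_exp_ofReal_mul_I]
  have hθm : ∀ η, Continuous (θ η) := fun η => by fun_prop
  have hff : Integrable (fun x => ⟪f x, f x⟫_ℂ) := L2.integrable_inner f f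
  -- the multiplication part, applied to `f`
  have hmul : Tendsto (fun η => ∫ x, θ η x * ⟪f x, f x⟫_ℂ) (𝓝 0) (𝓝 ⟪f, f⟫_ℂ) := by
    rw [L2.inner_def]
    refine tendsto_integral_filter_of_dominated_convergence (fun x => ‖⟪f x, f x⟫_ℂ‖)
      (Eventually.of_forall fun η => (hθm η).aestronglyMeasurable.mul hff.1)
      (Eventually.of_forall fun η => Eventually.of_forall fun x => ?_) hff.norm
      (Eventually.of_forall fun x => ?_)
    · rw [norm_mul, hθn, one_mul]
    · have : Continuous fun η => θ η x := by fun_prop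
      have h := (this.tendsto 0).mul_const ⟪f x, f x⟫_ℂ
      simpa [θ] using h
  have hdiff : ∀ η, ‖⟪f, expIR η f⟫_ℂ - ∫ x, θ η x * ⟪f x, f x⟫_ℂ‖ ≤ ‖f‖ * ‖Tr η - f‖ := by
    intro η
    have hM : MemLp (fun x => θ η x * f x) 2 volume :=
      MemLp.of_le (Lp.memLp f) ((hθm η).aestronglyMeasurable.mul (Lp.aestronglyMeasurable f))
        (Eventually.of_forall fun x => by rw [norm_mul, hθn, one_mul])
    have h1 : ∫ x, θ η x * ⟪f x, f x⟫_ℂ = ⟪f, hM.toLp _⟫_ℂ := by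
      rw [L2.inner_def]
      refine integral_congr_ae ?_
      filter_upwards [hM.coeFn_toLp] with x hx
      rw [hx]
      simp only [RCLike.inner_apply]
      ring
    rw [h1, ← inner_sub_right]
    refine (norm_inner_le_norm _ _).trans (mul_le_mul_of_nonneg_left (le_of_eq ?_) (norm_nonneg _))
    rw [Lp.norm_def, Lp.norm_def]
    congr 1
    refine eLpNorm_congr_norm_ae ?_
    filter_upwards [Lp.coeFn_sub (expIR η f) (hM.toLp _), Lp.coeFn_sub (Tr η) f, hM.coeFn_toLp,
      expIR_coeFn η f, Lp.coeFn_compMeasurePreserving f (hmp η)] with x h1 h2 h3 h4 h5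
    rw [h1, h2, Pi.sub_apply, Pi.sub_apply, h3, h4]
    have h5' : Tr η x = f (x + fun j => η (j, 1)) := h5
    rw [h5']
    simp only [weylFun]
    rw [← mul_sub, norm_mul]
    change ‖θ η x‖ * _ = _
    rw [hθn, one_mul]
  have hlim : Tendsto (fun η => ‖f‖ * ‖Tr η - f‖) (𝓝 0) (𝓝 0) := by
    have h : Tendsto (fun η => ‖f‖ * ‖Tr η - f‖) (𝓝 0) (𝓝 (‖f‖ * ‖Tr 0 - f‖)) :=
      (Continuous.tendsto (by fun_prop) 0)
    simpa [hTr0] using h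
  have := (squeeze_zero_norm hdiff hlim).add hmul
  simpa using this

/-- The Weyl operators depend strongly continuously on the phase space point. -/
theorem continuous_expIR (f : ModeSpace ι) :
    Continuous fun η : PhaseIdx ι → ℝ => expIR η f := by
  rw [continuous_iff_continuousAt]
  intro η₀
  have h1 : ∀ η, expIR η f = Complex.exp ((Complex.I / 2) * (sympl η₀ (η - η₀) : ℝ)) •
      expIR η₀ (expIR (η - η₀) f) := by
    intro η
    rw [expIR_expIR, smul_smul, ← Complex.exp_add]
    simp
  have h2 : Tendsto (fun η : PhaseIdx ι → ℝ => η - η₀) (𝓝 η₀) (𝓝 0) := by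
    have : Tendsto (fun η : PhaseIdx ι → ℝ => η - η₀) (𝓝 η₀) (𝓝 (η₀ - η₀)) :=
      (continuous_id.sub continuous_const).tendsto η₀
    simpa using this
  have h3 := ((expIR η₀).continuous.tendsto f).comp ((tendsto_expIR_zero f).comp h2)
  have h4 : Tendsto (fun η : PhaseIdx ι → ℝ =>
      Complex.exp ((Complex.I / 2) * (sympl η₀ (η - η₀) : ℝ))) (𝓝 η₀) (𝓝 1) := by
    have : Continuous (fun η : PhaseIdx ι → ℝ =>
      Complex.exp ((Complex.I / 2) * (sympl η₀ (η - η₀) : ℝ))) := by fun_prop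
    have := this.tendsto η₀
    simpa [sympl_zero_right] using this
  have h5 := h4.smul h3
  rw [one_smul] at h5
  unfold ContinuousAt
  rw [show (fun η => expIR η f) = _ from funext h1]
  simpa [sympl_zero_right, expIR_zero] using h5

/-- The Weyl operators act irreducibly: a nonzero vector is cyclic. -/
theorem eq_zero_of_forall_inner_expIR {f g : ModeSpace ι}
    (h : ∀ η : PhaseIdx ι → ℝ, ⟪f, expIR η g⟫_ℂ = 0) : f = 0 ∨ g = 0 := by
  -- for fixed momentum components `v`, Fourier uniqueness in the position components `u` applies
  have hv : ∀ v : ι → ℝ, ∀ᵐ x, ‖f x‖ₑ * ‖g (x + v)‖ₑ = 0 := by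
    intro v
    have hT : MeasurePreserving (fun x : ι → ℝ => x + v) volume volume :=
      measurePreserving_add_right volume _
    have hg := (Lp.memLp g).comp_measurePreserving hT
    have hF : Integrable (fun x => g (x + v) * star (f x)) :=
      hg.integrable_mul (Lp.memLp f).star
    have h0 := ae_eq_zero_of_forall_integral_exp_mul_eq_zero hF (fun u => by
      let η : PhaseIdx ι → ℝ := fun p => if p.2 = 0 then u p.1 else v p.1
      have h1 := h η
      rw [L2.inner_def] at h1
      have h2 : ∫ x, ⟪f x, expIR η g x⟫_ℂ =
          Complex.exp (Complex.I * ((∑ j, u j * (v j / 2) : ℝ) : ℂ)) *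
          ∫ x, Complex.exp (Complex.I * ((∑ j, u j * x j : ℝ) : ℂ)) *
            (g (x + v) * star (f x)) := by
        rw [← integral_const_mul]
        refine integral_congr_ae ?_
        filter_upwards [expIR_coeFn η g] with x hx
        rw [hx]
        simp only [weylFun, RCLike.inner_apply, η, if_true, if_neg (one_ne_zero (α := Fin 2))]
        rw [← mul_assoc, ← mul_assoc, ← Complex.exp_add, ← mul_add, ← Complex.ofReal_add]
        congr 4
        rw [← Finset.sum_add_distrib]
        congr 1
        exact Finset.sum_congr rfl fun j _ => by ring
      rw [h2] at h1
      exact (mul_eq_zero.1 h1).resolve_left (Complex.exp_ne_zero _))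
    filter_upwards [h0] with x hx
    rcases mul_eq_zero.1 hx with h | h
    · simp [h]
    · rw [star_eq_zero.1 h]; simp
  have hfm : Measurable fun x => ‖f x‖ₑ := (Lp.stronglyMeasurable f).enorm
  have hgm : Measurable fun x => ‖g x‖ₑ := (Lp.stronglyMeasurable g).enorm
  -- integration over `v` first gives `‖f‖₁ ‖g‖₁ = 0`
  have h1 : ∫⁻ v, ∫⁻ x, ‖f x‖ₑ * ‖g (x + v)‖ₑ = 0 := by
    have h0 : ∀ v, ∫⁻ x, ‖f x‖ₑ * ‖g (x + v)‖ₑ = 0 := fun v => by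
      rw [lintegral_congr_ae (hv v), lintegral_zero]
    simp_rw [h0, lintegral_zero]
  rw [lintegral_lintegral_swap (by
    refine Measurable.aemeasurable ?_
    exact (hfm.comp measurable_snd).mul (hgm.comp (measurable_snd.add measurable_fst)))] at h1
  have h2 : ∀ x, ∫⁻ v, ‖f x‖ₑ * ‖g (x + v)‖ₑ = ‖f x‖ₑ * ∫⁻ v, ‖g v‖ₑ := by
    intro x
    rw [lintegral_const_mul _ (by fun_prop), lintegral_add_left_eq_self (fun v => ‖g v‖ₑ) x]
  simp_rw [h2] at h1
  rw [lintegral_mul_const _ hfm] at h1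
  have aux : ∀ k : ModeSpace ι, ∫⁻ x, ‖k x‖ₑ = 0 → k = 0 := by
    intro k hk
    rw [lintegral_eq_zero_iff (Lp.stronglyMeasurable k).enorm] at hk
    rw [Lp.eq_zero_iff_ae_eq_zero]
    filter_upwards [hk] with x hx
    simpa using hx
  rcases mul_eq_zero.1 h1 with h | h
  · exact Or.inl (aux f h)
  · exact Or.inr (aux g h)

end Weyl

end BosonicModes

namespace BosonicModes

/-! ### Density operators as mixtures of vector states -/

theorem integral_count_eq_of_hasSum {I : Type*} [MeasurableSpace I] [MeasurableSingletonClass I]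
    [Countable I] {g : I → ℂ} {x : ℂ} (hg : HasSum g x) : ∫ i, g i ∂Measure.count = x := by
  have hgi : Integrable g (Measure.count : Measure I) := by
    rw [integrable_count_iff]
    exact hg.summable.norm
  rw [integral_countable hgi, ← hg.tsum_eq]
  simp [measureReal_def]

section Mixtures

variable {H : Type} [NormedAddCommGroup H] [InnerProductSpace ℂ H]

theorem HilbertBasis.countable [TopologicalSpace.SeparableSpace H] {I : Type*}
    (b : HilbertBasis I ℂ H) : Countable I := by
  classical
  -- balls of radius `1 / 2` around the basis vectors are disjoint
  refine Pairwise.countable_of_isOpen_disjoint (s := fun i => Metric.ball (b i) (1 / 2)) ?_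
    (fun i => Metric.isOpen_ball) (fun i => ⟨b i, Metric.mem_ball_self (by norm_num)⟩)
  intro i j hij
  refine Metric.ball_disjoint_ball ?_
  have h1 : ‖b i - b j‖ ^ 2 = 2 := by
    rw [@norm_sub_sq ℂ, b.orthonormal.1, b.orthonormal.1, b.orthonormal.2 hij]
    norm_num
  rw [dist_eq_norm]
  nlinarith [norm_nonneg (b i - b j)]

theorem HilbertBasis.hasSum_norm_inner_sq {I : Type*} (b : HilbertBasis I ℂ H) (x : H) :
    HasSum (fun i => ‖⟪x, b i⟫_ℂ‖ ^ 2) (‖x‖ ^ 2) := by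
  have h := (b.hasSum_inner_mul_inner x x).mapL RCLike.reCLM
  simp only [RCLike.reCLM_apply] at h
  rw [inner_self_eq_norm_sq] at h
  convert! h using 2 with i
  rw [← inner_conj_symm (b i) x, RCLike.mul_conj]
  norm_cast

theorem HilbertBasis.hasSum_norm_inner_sq' {I : Type*} (b : HilbertBasis I ℂ H) (x : H) :
    HasSum (fun i => ‖⟪b i, x⟫_ℂ‖ ^ 2) (‖x‖ ^ 2) := by
  simpa only [norm_inner_symm] using HilbertBasis.hasSum_norm_inner_sq b x

variable [CompleteSpace H]

/-- The diagonal sum of `ρ T` in any orthonormal basis when `ρ = ∫ |f s⟩⟨f s| dμ(s)`. -/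
theorem hasSum_inner_mixture {X : Type*} [MeasurableSpace X] {μ : Measure X} {f : X → H}
    (hf : AEStronglyMeasurable f μ) (hint : Integrable (fun s => ‖f s‖ ^ 2) μ)
    {ρ : H →L[ℂ] H} (hρ : ∀ x y, ⟪x, ρ y⟫_ℂ = ∫ s, ⟪x, f s⟫_ℂ * ⟪f s, y⟫_ℂ ∂μ)
    {I : Type*} [Countable I] (b : HilbertBasis I ℂ H) (T : H →L[ℂ] H) :
    HasSum (fun i => ⟪b i, ρ (T (b i))⟫_ℂ) (∫ s, ⟪f s, T (f s)⟫_ℂ ∂μ) := by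
  simp_rw [hρ]
  have hA : ∀ (x y : H), ⟪x, T y⟫_ℂ = ⟪ContinuousLinearMap.adjoint T x, y⟫_ℂ := fun x y =>
    (ContinuousLinearMap.adjoint_inner_left T y x).symm
  have hb : ∀ s, HasSum (fun i => (‖⟪b i, f s⟫_ℂ‖ ^ 2 +
      ‖⟪ContinuousLinearMap.adjoint T (f s), b i⟫_ℂ‖ ^ 2) / 2)
      ((‖f s‖ ^ 2 + ‖ContinuousLinearMap.adjoint T (f s)‖ ^ 2) / 2) := fun s =>
    ((HilbertBasis.hasSum_norm_inner_sq' b (f s)).add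
      (HilbertBasis.hasSum_norm_inner_sq b _)).div_const 2
  have hTf : AEStronglyMeasurable (fun s => ContinuousLinearMap.adjoint T (f s)) μ :=
    (ContinuousLinearMap.adjoint T).continuous.comp_aestronglyMeasurable hf
  -- termwise integration, dominated by means of `|a b| ≤ (|a|² + |b|²) / 2`
  refine hasSum_integral_of_dominated_convergence
    (fun i s => (‖⟪b i, f s⟫_ℂ‖ ^ 2 + ‖⟪ContinuousLinearMap.adjoint T (f s), b i⟫_ℂ‖ ^ 2) / 2)
    (fun i => (aestronglyMeasurable_const.inner hf).mul (hf.inner aestronglyMeasurable_const))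
    (fun i => Eventually.of_forall fun s => ?_) (Eventually.of_forall fun s => (hb s).summable)
    ?_ (Eventually.of_forall fun s => ?_)
  · rw [norm_mul, hA]
    nlinarith [sq_nonneg (‖⟪b i, f s⟫_ℂ‖ - ‖⟪ContinuousLinearMap.adjoint T (f s), b i⟫_ℂ‖)]
  · simp_rw [fun s => (hb s).tsum_eq]
    refine (hint.add ?_).div_const 2
    refine (hint.const_mul (‖ContinuousLinearMap.adjoint T‖ ^ 2)).mono' (hTf.norm.pow 2)
      (Eventually.of_forall fun s => ?_)
    rw [Real.norm_of_nonneg (by positivity), ← mul_pow]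
    exact pow_le_pow_left₀ (norm_nonneg _) (ContinuousLinearMap.le_opNorm _ _) 2
  · rw [hA]
    have h := b.hasSum_inner_mul_inner (ContinuousLinearMap.adjoint T (f s)) (f s)
    convert! h using 2 with i
    rw [hA, mul_comm]

variable [TopologicalSpace.SeparableSpace H]

/-- A mixture `∫ |f s⟩⟨f s| dμ(s)` of total weight one is a density operator, and expectations in
it are averages. -/
theorem mixture_isDensityOperator {X : Type*} [MeasurableSpace X] {μ : Measure X} {f : X → H}
    (hf : AEStronglyMeasurable f μ) (hint : Integrable (fun s => ‖f s‖ ^ 2) μ)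
    (h1 : ∫ s, ‖f s‖ ^ 2 ∂μ = 1)
    {ρ : H →L[ℂ] H} (hρ : ∀ x y, ⟪x, ρ y⟫_ℂ = ∫ s, ⟪x, f s⟫_ℂ * ⟪f s, y⟫_ℂ ∂μ) :
    IsDensityOperator ρ ∧ ∀ T : H →L[ℂ] H, trace (ρ ∘L T) = ∫ s, ⟪f s, T (f s)⟫_ℂ ∂μ := by
  have htr : ∀ T : H →L[ℂ] H, trace (ρ ∘L T) = ∫ s, ⟪f s, T (f s)⟫_ℂ ∂μ := by
    intro T
    have := HilbertBasis.countable (onb H)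
    exact (hasSum_inner_mixture hf hint hρ (onb H) T).tsum_eq
  refine ⟨⟨?_, ?_, ?_⟩, htr⟩
  · have hx : ∀ x, ⟪x, ρ x⟫_ℂ = ((∫ s, ‖⟪x, f s⟫_ℂ‖ ^ 2 ∂μ : ℝ) : ℂ) := by
      intro x
      rw [hρ, ← integral_complex_ofReal]
      refine integral_congr_ae (Eventually.of_forall fun s => ?_)
      simp only
      rw [← inner_conj_symm (f s) x, RCLike.mul_conj]
      norm_cast
    rw [ContinuousLinearMap.isPositive_iff_complex]
    intro x
    rw [← inner_conj_symm, hx]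
    refine ⟨by simp, ?_⟩
    simp only [Complex.conj_ofReal]
    change 0 ≤ (∫ s, ‖⟪x, f s⟫_ℂ‖ ^ 2 ∂μ : ℝ)
    positivity
  · intro w b
    have := HilbertBasis.countable b
    simpa using (hasSum_inner_mixture hf hint hρ b (ContinuousLinearMap.id ℂ H)).summable
  · have h := htr (ContinuousLinearMap.id ℂ H)
    rw [ContinuousLinearMap.comp_id] at h
    rw [h]
    have h2 : ∀ s, ⟪f s, ContinuousLinearMap.id ℂ H (f s)⟫_ℂ = ((‖f s‖ ^ 2 : ℝ) : ℂ) := fun s => by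
      rw [ContinuousLinearMap.id_apply, inner_self_eq_norm_sq_to_K]
      norm_cast
    simp_rw [h2]
    rw [integral_complex_ofReal, h1, Complex.ofReal_one]

theorem countable_mixture_isDensityOperator {I : Type*} [Countable I] {f : I → H}
    (h1 : HasSum (fun i => ‖f i‖ ^ 2) 1)
    {ρ : H →L[ℂ] H} (hρ : ∀ x y, HasSum (fun i => ⟪x, f i⟫_ℂ * ⟪f i, y⟫_ℂ) ⟪x, ρ y⟫_ℂ) :
    IsDensityOperator ρ ∧ ∀ T : H →L[ℂ] H,
      HasSum (fun i => ⟪f i, T (f i)⟫_ℂ) (trace (ρ ∘L T)) := by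
  let _ : MeasurableSpace I := ⊤
  have hint : Integrable (fun i => ‖f i‖ ^ 2) (Measure.count : Measure I) := by
    rw [integrable_count_iff]
    simpa using h1.summable
  have hT : ∀ T : H →L[ℂ] H, Summable fun i => ⟪f i, T (f i)⟫_ℂ := by
    intro T
    refine Summable.of_norm_bounded (h1.summable.mul_left ‖T‖) fun i => ?_
    refine (norm_inner_le_norm _ _).trans ?_
    nlinarith [T.le_opNorm (f i), norm_nonneg (f i)]
  have h := mixture_isDensityOperator (μ := (Measure.count : Measure I)) (f := f)
    (StronglyMeasurable.of_discrete (f := f)).aestronglyMeasurable hint (by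
      rw [integral_countable hint, ← h1.tsum_eq]
      simp [measureReal_def]) (fun x y =>
        (integral_count_eq_of_hasSum (hρ x y)).symm)
  refine ⟨h.1, fun T => ?_⟩
  rw [h.2 T, integral_count_eq_of_hasSum (hT T).hasSum]
  exact (hT T).hasSum

/-- Every density operator is a mixture `∑ |f i⟩⟨f i|`: take `f i = √ρ e i` for an orthonormal
basis `e`. -/
theorem IsDensityOperator.exists_mixture {ρ : H →L[ℂ] H} (hρ : IsDensityOperator ρ) :
    ∃ f : basisSet H → H, HasSum (fun i => ‖f i‖ ^ 2) 1 ∧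
      (∀ x y, HasSum (fun i => ⟪x, f i⟫_ℂ * ⟪f i, y⟫_ℂ) ⟪x, ρ y⟫_ℂ) ∧
      ∀ T : H →L[ℂ] H, HasSum (fun i => ⟪f i, T (f i)⟫_ℂ) (trace (ρ ∘L T)) := by
  have := HilbertBasis.countable (onb H)
  have hρ0 : 0 ≤ ρ := (ContinuousLinearMap.nonneg_iff_isPositive ρ).2 hρ.isPositive
  set R : H →L[ℂ] H := CFC.sqrt ρ with hR
  have hRR : R * R = ρ := CFC.sqrt_mul_sqrt_self ρ hρ0
  have hRp : R.IsPositive := (ContinuousLinearMap.nonneg_iff_isPositive R).1 (CFC.sqrt_nonneg ρ)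
  have hxy : ∀ x y, ⟪x, ρ y⟫_ℂ = ⟪R x, R y⟫_ℂ := by
    intro x y
    rw [← hRR, hRp.inner_left_eq_inner_right]
    rfl
  have h2 : ∀ x y, HasSum (fun i => ⟪x, R (onb H i)⟫_ℂ * ⟪R (onb H i), y⟫_ℂ) ⟪x, ρ y⟫_ℂ := by
    intro x y
    rw [hxy]
    simp_rw [← hRp.inner_left_eq_inner_right x, hRp.inner_left_eq_inner_right _ y]
    exact (onb H).hasSum_inner_mul_inner (R x) (R y)
  have h1 : HasSum (fun i => ‖R (onb H i)‖ ^ 2) 1 := by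
    have hs : HasSum (fun i => ⟪onb H i, ρ (onb H i)⟫_ℂ) 1 := by
      have := (hρ.isTraceClass _ (onb H)).hasSum
      rw [← hρ.trace_eq_one]
      exact this
    have := hs.mapL RCLike.reCLM
    simp only [RCLike.reCLM_apply, hxy, inner_self_eq_norm_sq] at this
    exact this
  exact ⟨fun i => R (onb H i), h1, h2, (countable_mixture_isDensityOperator h1 h2).2⟩

end Mixtures

instance instSeparableSpaceModeSpace {ι : Type} [Fintype ι] :
    TopologicalSpace.SeparableSpace (ModeSpace ι) := by
  have : Fact ((2 : ℝ≥0∞) ≠ ∞) := ⟨by simp⟩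
  infer_instance

end BosonicModes

namespace BosonicModes

/-! ### Diffusion of a Gaussian state -/

section RandomUnitary

variable {H : Type} [NormedAddCommGroup H] [InnerProductSpace ℂ H] [CompleteSpace H]

/-- A weakly convergent expansion `∑ |f i⟩⟨f i|` of total weight `∑ ‖f i‖² < ∞` converges in
operator norm. -/
theorem hasSum_rankOne {I : Type*} {f : I → H} (h1 : Summable fun i => ‖f i‖ ^ 2)
    {ρ : H →L[ℂ] H} (hρ : ∀ x y, HasSum (fun i => ⟪x, f i⟫_ℂ * ⟪f i, y⟫_ℂ) ⟪x, ρ y⟫_ℂ) :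
    HasSum (fun i => InnerProductSpace.rankOne ℂ (f i) (f i)) ρ := by
  have hs : Summable (fun i => InnerProductSpace.rankOne ℂ (f i) (f i)) := by
    refine Summable.of_norm ?_
    simpa only [InnerProductSpace.norm_rankOne, ← sq] using h1
  convert! hs.hasSum
  ext y
  refine ext_inner_left ℂ fun x => ?_
  refine (hρ x y).unique ?_
  have h := (hs.hasSum.mapL (ContinuousLinearMap.apply ℂ H y)).mapL (innerSL ℂ x)
  convert! h using 2 with i
  simp [mul_comm]

variable [TopologicalSpace.SeparableSpace H]

/-- A random unitary evolution maps density operators to density operators; expectations are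
averages over the evolution in the Heisenberg picture. -/
theorem IsDensityOperator.integral_conj {ρ : H →L[ℂ] H} (hρ : IsDensityOperator ρ)
    {Ξ : Type*} [TopologicalSpace Ξ] [TopologicalSpace.MetrizableSpace Ξ] [MeasurableSpace Ξ]
    [SecondCountableTopology Ξ] [BorelSpace Ξ] (γ : Measure Ξ) [IsProbabilityMeasure γ]
    {U : Ξ → H →L[ℂ] H} (hU : ∀ x, Continuous fun ξ => U ξ x) (hn : ∀ ξ x, ‖U ξ x‖ = ‖x‖) :
    IsDensityOperator (∫ ξ, U ξ ∘L ρ ∘L ContinuousLinearMap.adjoint (U ξ) ∂γ) ∧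
    ∀ T : H →L[ℂ] H, trace ((∫ ξ, U ξ ∘L ρ ∘L ContinuousLinearMap.adjoint (U ξ) ∂γ) ∘L T) =
      ∫ ξ, trace (ρ ∘L (ContinuousLinearMap.adjoint (U ξ) ∘L T ∘L U ξ)) ∂γ := by
  have := HilbertBasis.countable (onb H)
  obtain ⟨f, hf1, hf2, hf3⟩ := hρ.exists_mixture
  let _ : MeasurableSpace (basisSet H) := ⊤
  -- the norm-convergent expansion of the integrand
  have hexp : ∀ ξ, HasSum (fun i => InnerProductSpace.rankOne ℂ (U ξ (f i)) (U ξ (f i)))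
      (U ξ ∘L ρ ∘L ContinuousLinearMap.adjoint (U ξ)) := by
    intro ξ
    refine hasSum_rankOne (by simpa only [hn] using hf1.summable) fun x y => ?_
    have h := hf2 (ContinuousLinearMap.adjoint (U ξ) x) (ContinuousLinearMap.adjoint (U ξ) y)
    simpa only [ContinuousLinearMap.adjoint_inner_left, ContinuousLinearMap.adjoint_inner_right,
      ContinuousLinearMap.comp_apply] using h
  have hcont : Continuous fun ξ => U ξ ∘L ρ ∘L ContinuousLinearMap.adjoint (U ξ) := by
    rw [show (fun ξ => U ξ ∘L ρ ∘L ContinuousLinearMap.adjoint (U ξ)) =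
      fun ξ => ∑' i, InnerProductSpace.rankOne ℂ (U ξ (f i)) (U ξ (f i)) from
      funext fun ξ => (hexp ξ).tsum_eq.symm]
    refine continuous_tsum (fun i => ?_) hf1.summable fun i ξ => ?_
    · exact ((ContinuousLinearMap.smulRightL ℂ H H).continuous.comp
        ((innerSL ℂ).continuous.comp (hU (f i)))).clm_apply (hU (f i))
    · rw [InnerProductSpace.norm_rankOne, hn, sq]
  have hUn : ∀ ξ, ‖U ξ‖ ≤ 1 := fun ξ =>
    ContinuousLinearMap.opNorm_le_bound _ zero_le_one fun x => by rw [hn, one_mul]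
  have hint : Integrable (fun ξ => U ξ ∘L ρ ∘L ContinuousLinearMap.adjoint (U ξ)) γ := by
    refine Integrable.of_bound hcont.aestronglyMeasurable ‖ρ‖ (Eventually.of_forall fun ξ => ?_)
    refine (ContinuousLinearMap.opNorm_comp_le _ _).trans ?_
    have h1 := ContinuousLinearMap.opNorm_comp_le ρ (ContinuousLinearMap.adjoint (U ξ))
    have h2 : ‖ContinuousLinearMap.adjoint (U ξ)‖ ≤ 1 := by
      rw [LinearIsometryEquiv.norm_map]; exact hUn ξ
    have h3 : ‖ρ ∘L ContinuousLinearMap.adjoint (U ξ)‖ ≤ ‖ρ‖ :=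
      h1.trans (mul_le_of_le_one_right (norm_nonneg _) h2)
    calc _ ≤ 1 * ‖ρ‖ := mul_le_mul (hUn ξ) h3 (norm_nonneg _) zero_le_one
      _ = ‖ρ‖ := one_mul _
  let g : Ξ × basisSet H → H := fun p => U p.1 (f p.2)
  have hg : StronglyMeasurable g :=
    stronglyMeasurable_uncurry_of_continuous_of_stronglyMeasurable
      (u := fun ξ i => U ξ (f i)) (fun i => hU (f i)) fun ξ => StronglyMeasurable.of_discrete
  have hf1i : Integrable (fun i => ‖f i‖ ^ 2) (Measure.count : Measure (basisSet H)) := by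
    rw [integrable_count_iff]
    simpa using hf1.summable
  have hf1p : Integrable (fun p : Ξ × basisSet H => ‖f p.2‖ ^ 2) (γ.prod Measure.count) :=
    hf1i.comp_snd γ
  have hgn : ∀ p, ‖g p‖ ^ 2 = ‖f p.2‖ ^ 2 := fun p => by rw [hn]
  have hgi : Integrable (fun p => ‖g p‖ ^ 2) (γ.prod Measure.count) := by
    simpa only [hgn] using hf1p
  have hTi : ∀ T : H →L[ℂ] H, Integrable (fun p => ⟪g p, T (g p)⟫_ℂ) (γ.prod Measure.count) := by
    intro T
    refine (hgi.const_mul ‖T‖).mono' (hg.aestronglyMeasurable.inner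
      (T.continuous.comp_aestronglyMeasurable hg.aestronglyMeasurable))
      (Eventually.of_forall fun p => (norm_inner_le_norm _ _).trans ?_)
    nlinarith [T.le_opNorm (g p), norm_nonneg (g p)]
  have hmix := mixture_isDensityOperator (μ := γ.prod Measure.count) hg.aestronglyMeasurable
    hgi (by
      simp_rw [hgn]
      rw [integral_prod _ hf1p]
      simp only [integral_const, probReal_univ, one_smul]
      rw [integral_countable hf1i, ← hf1.tsum_eq]
      simp [measureReal_def])
    (ρ := ∫ ξ, U ξ ∘L ρ ∘L ContinuousLinearMap.adjoint (U ξ) ∂γ) (fun x y => by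
      have h1 : ⟪x, (∫ ξ, U ξ ∘L ρ ∘L ContinuousLinearMap.adjoint (U ξ) ∂γ) y⟫_ℂ =
          ∫ ξ, ⟪x, (U ξ ∘L ρ ∘L ContinuousLinearMap.adjoint (U ξ)) y⟫_ℂ ∂γ := by
        rw [ContinuousLinearMap.integral_apply hint, ← integral_inner]
        exact hint.apply_continuousLinearMap y
      have h2 : Integrable (fun p => ⟪x, g p⟫_ℂ * ⟪g p, y⟫_ℂ) (γ.prod Measure.count) := by
        refine (hf1p.const_mul (‖x‖ * ‖y‖)).mono'
          ((aestronglyMeasurable_const.inner hg.aestronglyMeasurable).mul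
            (hg.aestronglyMeasurable.inner aestronglyMeasurable_const))
          (Eventually.of_forall fun p => ?_)
        rw [norm_mul, ← hgn]
        calc ‖⟪x, g p⟫_ℂ‖ * ‖⟪g p, y⟫_ℂ‖ ≤ (‖x‖ * ‖g p‖) * (‖g p‖ * ‖y‖) :=
              mul_le_mul (norm_inner_le_norm _ _) (norm_inner_le_norm _ _) (norm_nonneg _)
                (by positivity)
          _ = ‖x‖ * ‖y‖ * ‖g p‖ ^ 2 := by ring
      rw [h1, integral_prod _ h2]
      refine integral_congr_ae (Eventually.of_forall fun ξ => ?_)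
      have h3 := ((hexp ξ).mapL (ContinuousLinearMap.apply ℂ H y)).mapL (innerSL ℂ x)
      have h4 : HasSum (fun i => ⟪x, g (ξ, i)⟫_ℂ * ⟪g (ξ, i), y⟫_ℂ)
          ⟪x, (U ξ ∘L ρ ∘L ContinuousLinearMap.adjoint (U ξ)) y⟫_ℂ := by
        convert! h3 using 2 with i
        simp [g, mul_comm]
      exact (integral_count_eq_of_hasSum h4).symm)
  refine ⟨hmix.1, fun T => ?_⟩
  rw [hmix.2 T, integral_prod _ (hTi T)]
  refine integral_congr_ae (Eventually.of_forall fun ξ => ?_)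
  refine integral_count_eq_of_hasSum ?_
  convert! hf3 (ContinuousLinearMap.adjoint (U ξ) ∘L T ∘L U ξ) using 2 with i
  simp only [ContinuousLinearMap.comp_apply, ContinuousLinearMap.adjoint_inner_right, g]

end RandomUnitary

section Diffusion

variable {ι κ : Type} [Fintype ι] [Fintype κ] [DecidableEq ι] [DecidableEq κ]

/-- Displacing a Weyl operator multiplies it by a phase. -/
theorem conj_displacement_expIR {ι : Type} [Fintype ι] [DecidableEq ι] (ξ η : PhaseIdx ι → ℝ) :
    ContinuousLinearMap.adjoint (displacement ξ) ∘L expIR η ∘L displacement ξ =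
      Complex.exp (Complex.I * ((η ⬝ᵥ ξ : ℝ) : ℂ)) • expIR η := by
  ext1 f
  have hs : sympl η (sympForm ι *ᵥ ξ) = -(η ⬝ᵥ ξ) := by
    simp only [sympl, dotProduct, Fintype.sum_prod_type, Fin.sum_univ_two, sympForm_mulVec,
      ← Finset.sum_neg_distrib]
    exact Finset.sum_congr rfl fun j _ => by ring
  simp only [displacement, ContinuousLinearMap.comp_apply, adjoint_expIR, expIR_expIR, map_smul,
    _root_.smul_apply, smul_smul, ← Complex.exp_add]
  rw [show -(sympForm ι *ᵥ ξ) + (η + sympForm ι *ᵥ ξ) = η by abel]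
  congr 2
  rw [sympl_neg_left, sympl_add_right, sympl_self, sympl_swap (sympForm ι *ᵥ ξ) η, hs]
  push_cast
  ring

instance instIsProbabilityMeasureDiffusionLaw (t : ℝ) :
    IsProbabilityMeasure (diffusionLaw ι κ t) := by
  unfold diffusionLaw
  infer_instance

/-- The characteristic function of the law of the random displacement. -/
theorem integral_exp_diffusionLaw {t : ℝ} (ht : 0 ≤ t) (η : PhaseIdx (ι ⊕ κ) → ℝ) :
    ∫ ξ, Complex.exp (Complex.I * ((η ⬝ᵥ ξ : ℝ) : ℂ)) ∂(diffusionLaw ι κ t) =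
      Complex.exp (-((η ⬝ᵥ ((t • projA ι κ) *ᵥ η) : ℝ) : ℂ) / 4) := by
  have h1 : ∀ ξ : PhaseIdx (ι ⊕ κ) → ℝ, Complex.exp (Complex.I * ((η ⬝ᵥ ξ : ℝ) : ℂ)) =
      ∏ p, Complex.exp (η p * ξ p * Complex.I) := by
    intro ξ
    rw [← Complex.exp_sum, dotProduct]
    push_cast
    rw [← Finset.sum_mul, mul_comm]
  simp_rw [h1]
  rw [diffusionLaw, integral_fintype_prod_eq_prod (fun p (x : ℝ) =>
    Complex.exp (η p * x * Complex.I))]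
  simp_rw [← charFun_apply_real, charFun_gaussianReal]
  rw [← Complex.exp_sum]
  congr 1
  simp only [dotProduct, Matrix.smul_mulVec, projA, Pi.smul_apply, Matrix.mulVec_diagonal]
  push_cast
  rw [← Finset.sum_neg_distrib, Finset.sum_div]
  refine Finset.sum_congr rfl fun p _ => ?_
  rcases p with ⟨j | j, i⟩
  · simp only [Sum.elim_inl, smul_eq_mul]
    rw [Real.coe_toNNReal _ (by positivity)]
    push_cast
    ring
  · simp

/-- Diffusion for time `t` adds `t` to the variances of the `A`-coordinates. -/
theorem IsGaussianState.diffusionA {ρ : ModeOp (ι ⊕ κ)}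
    {M : Matrix (PhaseIdx (ι ⊕ κ)) (PhaseIdx (ι ⊕ κ)) ℝ} {d : PhaseIdx (ι ⊕ κ) → ℝ}
    (hρ : IsGaussianState ρ M d) {t : ℝ} (ht : 0 ≤ t) :
    IsGaussianState (diffusionA t ρ) (M + t • projA ι κ) d := by
  have h := hρ.isDensityOperator.integral_conj (diffusionLaw ι κ t) (U := displacement)
    (fun x => (continuous_expIR x).comp
      (by fun_prop : Continuous fun ξ => sympForm (ι ⊕ κ) *ᵥ ξ)) (fun ξ x => norm_expIR _ x)
  refine ⟨h.1, ?_, fun η => ?_⟩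
  · refine hρ.isSymm.add (Matrix.IsSymm.smul ?_ t)
    exact Matrix.isSymm_diagonal _
  · refine (h.2 (expIR η)).trans ?_
    simp_rw [conj_displacement_expIR, ContinuousLinearMap.comp_smul]
    have htr : ∀ (c : ℂ) (T : ModeOp (ι ⊕ κ)), trace (c • T) = c * trace T := by
      intro c T
      simp only [trace, _root_.smul_apply, inner_smul_right, tsum_mul_left]
    simp_rw [htr]
    rw [integral_mul_const, integral_exp_diffusionLaw ht, hρ.charFun_eq, ← Complex.exp_add,
      Matrix.add_mulVec, dotProduct_add]
    congr 1
    push_cast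
    ring

end Diffusion

end BosonicModes

namespace BosonicModes

/-! ### The reduced state of a Gaussian state -/

theorem exists_ne_zero_modeSpace (ι : Type) [Fintype ι] : ∃ f : ModeSpace ι, f ≠ 0 := by
  have hv : (volume : Measure (ι → ℝ)) (Set.Icc 0 1) = 1 := by
    simp [Real.volume_Icc_pi]
  refine ⟨indicatorConstLp 2 (s := Set.Icc 0 1) measurableSet_Icc (by simp [hv]) (1 : ℂ), ?_⟩
  rw [← norm_ne_zero_iff, norm_indicatorConstLp (by simp) (by simp)]
  simp [measureReal_def, hv]

section Tensor

variable {ι κ : Type} [Fintype ι] [Fintype κ]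

theorem inner_tensorLeft (e e' : ModeSpace ι) (f f' : ModeSpace κ) :
    ⟪tensorLeft e f, tensorLeft e' f'⟫_ℂ = ⟪e, e'⟫_ℂ * ⟪f, f'⟫_ℂ := by
  have hmp : MeasurePreserving (MeasurableEquiv.sumPiEquivProdPi (fun _ : ι ⊕ κ => ℝ))
      volume volume := volume_measurePreserving_sumPiEquivProdPi (fun _ : ι ⊕ κ => ℝ)
  rw [L2.inner_def, L2.inner_def, L2.inner_def, ← integral_prod_mul,
    ← Measure.volume_eq_prod, ← hmp.integral_comp (MeasurableEquiv.measurableEmbedding _)]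
  refine integral_congr_ae ?_
  filter_upwards [tensorLeft_coeFn e f, tensorLeft_coeFn e' f'] with z h1 h2
  rw [h1, h2]
  simp only [tensorFun, RCLike.inner_apply, map_mul]
  change _ = (e' (fun i => z (Sum.inl i)) * _) * (f' (fun j => z (Sum.inr j)) * _)
  simp only [MeasurableEquiv.coe_sumPiEquivProdPi, Equiv.sumPiEquivProdPi, Equiv.coe_fn_mk]
  ring

theorem norm_tensorLeft (e : ModeSpace ι) (f : ModeSpace κ) : ‖tensorLeft e f‖ = ‖e‖ * ‖f‖ := by
  have h := inner_tensorLeft e e f f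
  simp only [inner_self_eq_norm_sq_to_K] at h
  have h' : ‖tensorLeft e f‖ ^ 2 = (‖e‖ * ‖f‖) ^ 2 := by
    rw [mul_pow]
    exact_mod_cast h
  exact (pow_left_inj₀ (norm_nonneg _) (by positivity) two_ne_zero).1 h'

theorem ae_left_of_ae {p : (ι → ℝ) → Prop} (h : ∀ᵐ y : ι → ℝ, p y) :
    ∀ᵐ z : ι ⊕ κ → ℝ, p (fun j => z (Sum.inl j)) :=
  (Measure.quasiMeasurePreserving_fst.comp
    (measurePreserving_split (ι := ι) (κ := κ)).quasiMeasurePreserving).ae h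

/-- The operator `e ↦ e ⊗ f`. -/
noncomputable def tensorRight (f : ModeSpace κ) : ModeSpace ι →L[ℂ] ModeSpace (ι ⊕ κ) :=
  LinearMap.mkContinuous
    { toFun := fun e => tensorLeft e f
      map_add' := by
        intro e e'
        refine Lp.ext ?_
        filter_upwards [tensorLeft_coeFn (e + e') f, tensorLeft_coeFn e f, tensorLeft_coeFn e' f,
          Lp.coeFn_add (tensorLeft e f) (tensorLeft e' f),
          ae_left_of_ae (κ := κ) (Lp.coeFn_add e e')] with z h1 h2 h3 h4 h5
        rw [h1, h4, Pi.add_apply, h2, h3]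
        simp only [tensorFun]
        rw [h5, Pi.add_apply, add_mul]
      map_smul' := by
        intro c e
        refine Lp.ext ?_
        filter_upwards [tensorLeft_coeFn (c • e) f, tensorLeft_coeFn e f,
          Lp.coeFn_smul c (tensorLeft e f),
          ae_left_of_ae (κ := κ) (Lp.coeFn_smul c e)] with z h1 h2 h4 h5
        rw [RingHom.id_apply, h1, h4, Pi.smul_apply, h2]
        simp only [tensorFun]
        rw [h5, Pi.smul_apply, smul_mul_assoc] }
    ‖f‖ (fun e => by
      rw [mul_comm]
      exact (norm_tensorLeft e f).le)

theorem tensorRight_apply (f : ModeSpace κ) (e : ModeSpace ι) :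
    tensorRight f e = tensorLeft e f := rfl

theorem expIR_tensorLeft (η : PhaseIdx (ι ⊕ κ) → ℝ) (e : ModeSpace ι) (f : ModeSpace κ) :
    expIR η (tensorLeft e f) =
      tensorLeft (expIR (fun p => η (Sum.inl p.1, p.2)) e)
        (expIR (fun p => η (Sum.inr p.1, p.2)) f) := by
  refine Lp.ext ?_
  have hT : MeasurePreserving (fun x : ι ⊕ κ → ℝ => x + fun j => η (j, 1)) volume volume :=
    measurePreserving_add_right volume _
  filter_upwards [expIR_coeFn η (tensorLeft e f), hT.quasiMeasurePreserving.ae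
    (tensorLeft_coeFn e f), tensorLeft_coeFn (expIR (fun p => η (Sum.inl p.1, p.2)) e)
        (expIR (fun p => η (Sum.inr p.1, p.2)) f),
    ae_left_of_ae (κ := κ) (expIR_coeFn (fun p => η (Sum.inl p.1, p.2)) e),
    ae_right_of_ae (ι := ι) (expIR_coeFn (fun p => η (Sum.inr p.1, p.2)) f)]
    with z h1 h2 h3 h4 h5
  rw [h1, h3]
  simp only [weylFun, tensorFun] at h2 h4 h5 ⊢
  rw [h2, h4, h5, mul_mul_mul_comm, ← Complex.exp_add, ← mul_add, ← Complex.ofReal_add,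
    Fintype.sum_sum_type]
  rfl

/-- Product vectors are total, because the Weyl orbit of a product vector consists of product
vectors. -/
theorem eq_zero_of_forall_inner_tensorLeft {F : ModeSpace (ι ⊕ κ)}
    (h : ∀ e f, ⟪F, tensorLeft e f⟫_ℂ = 0) : F = 0 := by
  obtain ⟨e, he⟩ := exists_ne_zero_modeSpace ι
  obtain ⟨f, hf⟩ := exists_ne_zero_modeSpace κ
  refine (eq_zero_of_forall_inner_expIR (f := F) (g := tensorLeft e f) fun η => ?_).resolve_right ?_
  · rw [expIR_tensorLeft, h]
  · rw [← ne_eq, ← norm_ne_zero_iff, norm_tensorLeft]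
    exact mul_ne_zero (norm_ne_zero_iff.2 he) (norm_ne_zero_iff.2 hf)

theorem hilbertBasis_ext {H : Type} {I : Type*} [NormedAddCommGroup H] [InnerProductSpace ℂ H]
    (b : HilbertBasis I ℂ H) {x : H} (h : ∀ i, ⟪x, b i⟫_ℂ = 0) : x = 0 := by
  have h1 := HilbertBasis.hasSum_norm_inner_sq b x
  simp only [h, norm_zero, ne_eq, OfNat.ofNat_ne_zero, not_false_eq_true, zero_pow] at h1
  have h2 := h1.unique hasSum_zero
  exact norm_eq_zero.1 (pow_eq_zero_iff two_ne_zero |>.1 h2)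

/-- The product of two orthonormal bases. -/
theorem exists_tensorBasis {I K : Type*} (b : HilbertBasis I ℂ (ModeSpace ι))
    (c : HilbertBasis K ℂ (ModeSpace κ)) :
    ∃ B : HilbertBasis (I × K) ℂ (ModeSpace (ι ⊕ κ)), ∀ p, B p = tensorLeft (b p.1) (c p.2) := by
  have ho : Orthonormal ℂ (fun p : I × K => tensorLeft (b p.1) (c p.2)) := by
    refine ⟨fun p => ?_, fun p q hpq => ?_⟩
    · rw [norm_tensorLeft, b.orthonormal.1, c.orthonormal.1, one_mul]
    · change ⟪tensorLeft (b p.1) (c p.2), tensorLeft (b q.1) (c q.2)⟫_ℂ = 0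
      rw [inner_tensorLeft]
      by_cases h1 : p.1 = q.1
      · have h2 : p.2 ≠ q.2 := fun h2 => hpq (Prod.ext h1 h2)
        rw [c.orthonormal.2 h2, mul_zero]
      · rw [b.orthonormal.2 h1, zero_mul]
  refine ⟨HilbertBasis.mkOfOrthogonalEqBot ho ?_, fun p => by
    rw [HilbertBasis.coe_mkOfOrthogonalEqBot]⟩
  rw [Submodule.eq_bot_iff]
  intro F hF
  have h0 : ∀ i k, ⟪F, tensorLeft (b i) (c k)⟫_ℂ = 0 := fun i k =>
    Submodule.inner_left_of_mem_orthogonal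
      (Submodule.subset_span (Set.mem_range_self ((i, k) : I × K))) hF
  have h1 : ∀ i f, ⟪F, tensorLeft (b i) f⟫_ℂ = 0 := by
    intro i f
    rw [← ContinuousLinearMap.adjoint_inner_left,
      hilbertBasis_ext c (x := ContinuousLinearMap.adjoint (tensorLeft (b i)) F)
        (fun k => by rw [ContinuousLinearMap.adjoint_inner_left, h0]), inner_zero_left]
  refine eq_zero_of_forall_inner_tensorLeft fun e f => ?_
  rw [← tensorRight_apply, ← ContinuousLinearMap.adjoint_inner_left,
    hilbertBasis_ext b (x := ContinuousLinearMap.adjoint (tensorRight f) F)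
      (fun k => by rw [ContinuousLinearMap.adjoint_inner_left, tensorRight_apply, h1]),
    inner_zero_left]

/-- `∑ k, |e_k⟩⟨e_k| ⊗ I = I`. -/
theorem hasSum_inner_adjoint_tensorLeft {I : Type*} (b : HilbertBasis I ℂ (ModeSpace ι))
    (F G : ModeSpace (ι ⊕ κ)) :
    HasSum (fun k => ⟪ContinuousLinearMap.adjoint (tensorLeft (κ := κ) (b k)) F,
      ContinuousLinearMap.adjoint (tensorLeft (κ := κ) (b k)) G⟫_ℂ) ⟪F, G⟫_ℂ := by
  obtain ⟨B, hB⟩ := exists_tensorBasis b (onb (ModeSpace κ))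
  refine (B.hasSum_inner_mul_inner F G).prod_fiberwise fun k => ?_
  simp_rw [hB, ← ContinuousLinearMap.adjoint_inner_left (tensorLeft (κ := κ) (b k)),
    ← ContinuousLinearMap.adjoint_inner_right (tensorLeft (κ := κ) (b k))]
  exact HilbertBasis.hasSum_inner_mul_inner _ _ _

theorem hasSum_norm_adjoint_tensorLeft {I : Type*} (b : HilbertBasis I ℂ (ModeSpace ι))
    (F : ModeSpace (ι ⊕ κ)) :
    HasSum (fun k => ‖ContinuousLinearMap.adjoint (tensorLeft (κ := κ) (b k)) F‖ ^ 2)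
      (‖F‖ ^ 2) := by
  have h := (hasSum_inner_adjoint_tensorLeft b F F).mapL RCLike.reCLM
  simpa only [RCLike.reCLM_apply, inner_self_eq_norm_sq] using h

/-- The partial trace of a density operator is a density operator, and expectations of operators
`I ⊗ T` are expectations of `T` in the reduced state. The intertwining relation expresses that `T'`
is `I ⊗ T`. -/
theorem IsDensityOperator.partialTraceA {ρ : ModeOp (ι ⊕ κ)} (hρ : IsDensityOperator ρ) :
    IsDensityOperator (partialTraceA ρ) ∧ ∀ (T : ModeOp κ) (T' : ModeOp (ι ⊕ κ)),
      (∀ e, ContinuousLinearMap.adjoint (tensorLeft (κ := κ) e) ∘L T' =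
        T ∘L ContinuousLinearMap.adjoint (tensorLeft e)) →
      trace (partialTraceA ρ ∘L T) = trace (ρ ∘L T') := by
  have := HilbertBasis.countable (onb (ModeSpace ι))
  have := HilbertBasis.countable (onb (ModeSpace (ι ⊕ κ)))
  obtain ⟨f, hf1, hf2, hf3⟩ := hρ.exists_mixture
  set E := onb (ModeSpace ι) with hE
  -- the reduced state is the mixture of the vectors `(⟨e_k| ⊗ I) f i`
  let A : basisSet (ModeSpace ι) → ModeSpace (ι ⊕ κ) →L[ℂ] ModeSpace κ := fun k =>
    ContinuousLinearMap.adjoint (tensorLeft (κ := κ) (E k))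
  let g : basisSet (ModeSpace (ι ⊕ κ)) × basisSet (ModeSpace ι) → ModeSpace κ :=
    fun p => A p.2 (f p.1)
  have hgs : Summable fun p => ‖g p‖ ^ 2 := by
    rw [summable_prod_of_nonneg (fun p => by positivity)]
    refine ⟨fun i => (hasSum_norm_adjoint_tensorLeft E (f i)).summable, ?_⟩
    have : ∀ i, ∑' k, ‖g (i, k)‖ ^ 2 = ‖f i‖ ^ 2 := fun i =>
      (hasSum_norm_adjoint_tensorLeft E (f i)).tsum_eq
    simp_rw [this]
    exact hf1.summable
  have hg1 : HasSum (fun p => ‖g p‖ ^ 2) 1 := by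
    have h := hgs.hasSum.prod_fiberwise fun i => hasSum_norm_adjoint_tensorLeft E (f i)
    rw [← h.unique hf1]
    exact hgs.hasSum
  have hrs : Summable (fun p => InnerProductSpace.rankOne ℂ (g p) (g p)) := by
    refine Summable.of_norm ?_
    simpa only [InnerProductSpace.norm_rankOne, ← sq] using hgs
  have hk : ∀ k, HasSum (fun i => InnerProductSpace.rankOne ℂ (g (i, k)) (g (i, k)))
      (A k ∘L ρ ∘L tensorLeft (κ := κ) (E k)) := by
    intro k
    refine hasSum_rankOne (hgs.comp_injective (i := fun i => (i, k))
      fun i i' h => (Prod.ext_iff.1 h).1) fun x y => ?_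
    have h := hf2 (tensorLeft (E k) x) (tensorLeft (E k) y)
    simpa only [A, g, ContinuousLinearMap.adjoint_inner_left,
      ContinuousLinearMap.adjoint_inner_right, ContinuousLinearMap.comp_apply] using h
  have hpt : HasSum (fun p => InnerProductSpace.rankOne ℂ (g p) (g p))
      (BosonicModes.partialTraceA ρ) := by
    have h := ((Equiv.prodComm _ _).hasSum_iff.2 hrs.hasSum).prod_fiberwise hk
    have h2 : BosonicModes.partialTraceA ρ = _ := h.tsum_eq
    rw [h2]
    exact hrs.hasSum
  have hmix := countable_mixture_isDensityOperator hg1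
    (ρ := BosonicModes.partialTraceA ρ) (fun x y => by
      have h3 := (hpt.mapL (ContinuousLinearMap.apply ℂ (ModeSpace κ) y)).mapL (innerSL ℂ x)
      convert! h3 using 2 with p
      simp [mul_comm])
  refine ⟨hmix.1, fun T T' hT => ?_⟩
  refine ((hmix.2 T).prod_fiberwise (g := fun i => ⟪f i, T' (f i)⟫_ℂ) fun i => ?_).unique (hf3 T')
  convert! hasSum_inner_adjoint_tensorLeft E (f i) (T' (f i)) using 2 with k
  have h := DFunLike.congr_fun (hT (E k)) (f i)
  simp only [ContinuousLinearMap.comp_apply] at h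
  rw [h]

/-- The reduced state of a Gaussian state is Gaussian, with the covariance matrix and displacement
vector of the subsystem. -/
theorem IsGaussianState.partialTraceA {ρ : ModeOp (ι ⊕ κ)}
    {M : Matrix (PhaseIdx (ι ⊕ κ)) (PhaseIdx (ι ⊕ κ)) ℝ} {d : PhaseIdx (ι ⊕ κ) → ℝ}
    (hρ : IsGaussianState ρ M d) :
    IsGaussianState (partialTraceA ρ)
      (M.submatrix (fun p => (Sum.inr p.1, p.2)) (fun p => (Sum.inr p.1, p.2)))
      (fun p => d (Sum.inr p.1, p.2)) := by
  have h := hρ.isDensityOperator.partialTraceA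
  refine ⟨h.1, hρ.isSymm.submatrix _, fun η => ?_⟩
  -- `I ⊗ W(η)` is the Weyl operator of the extension of `η` by zero
  let η' : PhaseIdx (ι ⊕ κ) → ℝ := fun p => Sum.elim (fun _ => 0) (fun j => η (j, p.2)) p.1
  have hT : ∀ ζ : PhaseIdx κ → ℝ, ∀ e : ModeSpace ι,
      expIR (fun p : PhaseIdx (ι ⊕ κ) => Sum.elim (fun _ => 0) (fun j => ζ (j, p.2)) p.1) ∘L
        tensorLeft e = tensorLeft e ∘L expIR ζ := by
    intro ζ e
    ext1 f
    simp only [ContinuousLinearMap.comp_apply, expIR_tensorLeft, Sum.elim_inl, Sum.elim_inr]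
    congr 2
    exact expIR_zero e
  rw [h.2 (expIR η) (expIR η') ?_, hρ.charFun_eq]
  · have h1 : ∀ v : PhaseIdx (ι ⊕ κ) → ℝ, η' ⬝ᵥ v = η ⬝ᵥ fun p => v (Sum.inr p.1, p.2) := by
      intro v
      simp [dotProduct, Fintype.sum_prod_type, Fintype.sum_sum_type, η']
    rw [h1, h1]
    congr 5
    ext p
    change M (Sum.inr p.1, p.2) ⬝ᵥ η' = _
    rw [dotProduct_comm, h1, dotProduct_comm]
    rfl
  · intro e
    have h2 := congrArg ContinuousLinearMap.adjoint (hT (-η) e)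
    rw [ContinuousLinearMap.adjoint_comp, ContinuousLinearMap.adjoint_comp, adjoint_expIR,
      adjoint_expIR, neg_neg] at h2
    rw [← h2]
    congr 2
    ext ⟨j | j, i⟩ <;> simp [η']

end Tensor

end BosonicModes

namespace BosonicModes

/-! ### Gaussian integrals on phase space -/

section GaussianIntegrals

variable {ι : Type} [Fintype ι]

theorem mode_gaussian_exponent (b : ι → ℝ) (c₀ c₁ k : ι → ℂ) (η : PhaseIdx ι → ℝ) :
    Complex.exp (∑ j, (-(b j : ℂ) * ((η (j, 0) : ℂ) ^ 2 + (η (j, 1) : ℂ) ^ 2) +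
      c₀ j * η (j, 0) + c₁ j * η (j, 1) + k j)) =
    Complex.exp (∑ j, k j) * Complex.exp (-∑ p : PhaseIdx ι, (b p.1 : ℂ) * (η p : ℂ) ^ 2 +
      ∑ p : PhaseIdx ι, (if p.2 = 0 then c₀ p.1 else c₁ p.1) * η p) := by
  rw [← Complex.exp_add]
  congr 1
  simp only [Fintype.sum_prod_type, Fin.sum_univ_two, ← Finset.sum_neg_distrib,
    ← Finset.sum_add_distrib, if_true, one_ne_zero, if_false]
  exact Finset.sum_congr rfl fun j _ => by ring

theorem integrable_mode_gaussian {b : ι → ℝ} (hb : ∀ j, 0 < b j) (c₀ c₁ k : ι → ℂ) :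
    Integrable fun η : PhaseIdx ι → ℝ =>
      Complex.exp (∑ j, (-(b j : ℂ) * ((η (j, 0) : ℂ) ^ 2 + (η (j, 1) : ℂ) ^ 2) +
        c₀ j * η (j, 0) + c₁ j * η (j, 1) + k j)) := by
  simp_rw [mode_gaussian_exponent]
  exact (GaussianFourier.integrable_cexp_neg_sum_mul_add (b := fun p : PhaseIdx ι => (b p.1 : ℂ))
    (fun p => by simpa using hb p.1) _).const_mul _

theorem integral_mode_gaussian {b : ι → ℝ} (hb : ∀ j, 0 < b j) (c₀ c₁ k : ι → ℂ) :
    ∫ η : PhaseIdx ι → ℝ,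
      Complex.exp (∑ j, (-(b j : ℂ) * ((η (j, 0) : ℂ) ^ 2 + (η (j, 1) : ℂ) ^ 2) +
        c₀ j * η (j, 0) + c₁ j * η (j, 1) + k j)) =
      (∏ j, (Real.pi / b j : ℂ)) *
        Complex.exp (∑ j, (k j + (c₀ j ^ 2 + c₁ j ^ 2) / (4 * b j))) := by
  simp_rw [mode_gaussian_exponent]
  rw [integral_const_mul, GaussianFourier.integral_cexp_neg_sum_mul_add
    (b := fun p : PhaseIdx ι => (b p.1 : ℂ)) (fun p => by simpa using hb p.1)]
  rw [Fintype.prod_prod_type]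
  have h : ∀ j, ∏ i : Fin 2, (Real.pi / (b j : ℂ)) ^ (1 / 2 : ℂ) *
      Complex.exp ((if i = 0 then c₀ j else c₁ j) ^ 2 / (4 * (b j : ℂ))) =
      (Real.pi / b j : ℂ) * Complex.exp ((c₀ j ^ 2 + c₁ j ^ 2) / (4 * b j)) := by
    intro j
    have hne : (Real.pi / (b j : ℂ)) ≠ 0 :=
      div_ne_zero (by exact_mod_cast Real.pi_ne_zero) (by exact_mod_cast (hb j).ne')
    rw [Fin.prod_univ_two, mul_mul_mul_comm, ← Complex.cpow_add _ _ hne, ← Complex.exp_add]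
    rw [show (1 / 2 + 1 / 2 : ℂ) = 1 by norm_num, Complex.cpow_one]
    simp only [if_true, one_ne_zero, if_false]
    rw [add_div]
  simp_rw [h]
  rw [Finset.prod_mul_distrib, ← Complex.exp_sum, mul_left_comm, ← Complex.exp_add,
    ← Finset.sum_add_distrib]

/-- The characteristic function `exp (-|η|² / 4)` of the vacuum. -/
noncomputable def vacuumChar (η : PhaseIdx ι → ℝ) : ℂ :=
  Complex.exp (∑ j, (-(1 / 4 : ℂ) * ((η (j, 0) : ℂ) ^ 2 + (η (j, 1) : ℂ) ^ 2)))

theorem integrable_vacuumChar : Integrable (vacuumChar : (PhaseIdx ι → ℝ) → ℂ) := by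
  have h := integrable_mode_gaussian (ι := ι) (b := fun _ => 1 / 4) (fun _ => by norm_num) 0 0 0
  convert! h using 2 with η
  simp [vacuumChar]

theorem continuous_vacuumChar : Continuous (vacuumChar : (PhaseIdx ι → ℝ) → ℂ) := by
  unfold vacuumChar
  fun_prop

theorem vacuumChar_neg (η : PhaseIdx ι → ℝ) : vacuumChar (-η) = vacuumChar η := by
  simp [vacuumChar]

theorem vacuumChar_zero : vacuumChar (0 : PhaseIdx ι → ℝ) = 1 := by
  simp [vacuumChar]

theorem conj_vacuumChar (η : PhaseIdx ι → ℝ) :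
    (starRingEnd ℂ) (vacuumChar η) = vacuumChar η := by
  simp [vacuumChar, ← Complex.exp_conj, map_ofNat]

/-- The twisted convolution of the vacuum characteristic function with itself. -/
theorem integral_vacuumChar_twisted (κ ζ : PhaseIdx ι → ℝ) :
    ∫ η : PhaseIdx ι → ℝ, vacuumChar η * vacuumChar (κ - (η + ζ)) *
      Complex.exp (-(Complex.I / 2) * ((sympl η ζ + sympl (η + ζ) κ : ℝ) : ℂ)) =
    (2 * Real.pi) ^ Fintype.card ι * (vacuumChar κ * vacuumChar ζ) := by
  have h := integral_mode_gaussian (ι := ι) (b := fun _ => 1 / 2) (fun _ => by norm_num)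
    (fun j => (1 / 2) * ((κ (j, 0) : ℂ) - ζ (j, 0)) -
      (Complex.I / 2) * ((κ (j, 1) : ℂ) + ζ (j, 1)))
    (fun j => (1 / 2) * ((κ (j, 1) : ℂ) - ζ (j, 1)) +
      (Complex.I / 2) * ((κ (j, 0) : ℂ) + ζ (j, 0)))
    (fun j => -(1 / 4) * (((κ (j, 0) : ℂ) - ζ (j, 0)) ^ 2 + ((κ (j, 1) : ℂ) - ζ (j, 1)) ^ 2) -
      (Complex.I / 2) * ((ζ (j, 0) : ℂ) * κ (j, 1) - ζ (j, 1) * κ (j, 0)))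
  convert! h using 1
  · refine integral_congr_ae (Eventually.of_forall fun η => ?_)
    simp only [vacuumChar, sympl]
    push_cast
    rw [← Complex.exp_add, ← Complex.exp_add]
    congr 1
    rw [← Finset.sum_add_distrib, mul_add, Finset.mul_sum, Finset.mul_sum,
      ← Finset.sum_add_distrib, ← Finset.sum_add_distrib]
    refine Finset.sum_congr rfl fun j _ => ?_
    simp only [Pi.sub_apply, Pi.add_apply]
    push_cast
    ring
  · simp only [vacuumChar]
    rw [← Complex.exp_add, Finset.prod_const, Finset.card_univ, ← Finset.sum_add_distrib]
    congr 1
    · congr 1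
      push_cast
      ring
    · congr 1
      refine Finset.sum_congr rfl fun j _ => ?_
      push_cast
      ring_nf
      simp only [Complex.I_sq]
      ring

end GaussianIntegrals

/-! ### Weyl systems and their vacuum -/

section WeylSystem

variable {ι : Type} [Fintype ι] {H : Type} [NormedAddCommGroup H] [InnerProductSpace ℂ H]
  [CompleteSpace H]

/-- An irreducible, strongly continuous unitary representation of the canonical commutation
relations in Weyl form. Irreducibility is expressed by the cyclicity of all nonzero vectors. -/
structure IsWeylSystem (V : (PhaseIdx ι → ℝ) → H →L[ℂ] H) : Prop where
  mul : ∀ η ζ x, V η (V ζ x) = Complex.exp (-(Complex.I / 2) * (sympl η ζ : ℝ)) • V (η + ζ) x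
  zero : ∀ x, V 0 x = x
  adjoint : ∀ η, ContinuousLinearMap.adjoint (V η) = V (-η)
  cont : ∀ x, Continuous fun η => V η x
  irred : ∀ x y, (∀ η, ⟪x, V η y⟫_ℂ = 0) → x = 0 ∨ y = 0

namespace IsWeylSystem

variable {V : (PhaseIdx ι → ℝ) → H →L[ℂ] H} (hV : IsWeylSystem V)

include hV

theorem neg_apply (η : PhaseIdx ι → ℝ) (x : H) : V (-η) (V η x) = x := by
  rw [hV.mul, sympl_neg_left, sympl_self]
  simp [hV.zero]

theorem inner_left (η : PhaseIdx ι → ℝ) (x y : H) : ⟪V η x, y⟫_ℂ = ⟪x, V (-η) y⟫_ℂ := by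
  rw [← hV.adjoint, ContinuousLinearMap.adjoint_inner_right]

theorem norm_apply (η : PhaseIdx ι → ℝ) (x : H) : ‖V η x‖ = ‖x‖ := by
  have h : ‖V η x‖ ^ 2 = ‖x‖ ^ 2 := by
    rw [← @inner_self_eq_norm_sq ℂ, hV.inner_left, hV.neg_apply, inner_self_eq_norm_sq]
  exact (pow_left_inj₀ (norm_nonneg _) (norm_nonneg _) two_ne_zero).1 h

theorem mul_mul (η ζ κ : PhaseIdx ι → ℝ) (x : H) : V η (V ζ (V κ x)) =
    Complex.exp (-(Complex.I / 2) * ((sympl η ζ + sympl (η + ζ) κ : ℝ) : ℂ)) •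
      V (η + ζ + κ) x := by
  rw [hV.mul η ζ, hV.mul, smul_smul, ← Complex.exp_add]
  congr 2
  push_cast
  ring

theorem integrable_vacuum (x : H) : Integrable fun η => vacuumChar η • V η x := by
  refine (integrable_vacuumChar.norm.mul_const ‖x‖).mono'
    (continuous_vacuumChar.smul (hV.cont x)).aestronglyMeasurable
    (Eventually.of_forall fun η => ?_)
  rw [norm_smul, hV.norm_apply]

omit hV in
/-- The vacuum projection `(2π)^{-N} ∫ exp (-|η|² / 4) V(η) dη`, applied to a vector. -/
noncomputable def vacuumProj (V : (PhaseIdx ι → ℝ) → H →L[ℂ] H) (x : H) : H :=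
  ((2 * Real.pi : ℂ) ^ Fintype.card ι)⁻¹ • ∫ η, vacuumChar η • V η x

theorem inner_vacuumProj (x y : H) : ⟪x, vacuumProj V y⟫_ℂ =
    ((2 * Real.pi : ℂ) ^ Fintype.card ι)⁻¹ * ∫ η, vacuumChar η * ⟪x, V η y⟫_ℂ := by
  rw [vacuumProj, inner_smul_right, ← integral_inner (hV.integrable_vacuum y)]
  simp_rw [inner_smul_right]

theorem vacuumProj_symm (x y : H) : ⟪vacuumProj V x, y⟫_ℂ = ⟪x, vacuumProj V y⟫_ℂ := by
  rw [← inner_conj_symm, hV.inner_vacuumProj, hV.inner_vacuumProj, map_mul, ← integral_conj,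
    ← integral_neg_eq_self]
  congr 1
  · simp [map_ofNat]
  · refine integral_congr_ae (Eventually.of_forall fun η => ?_)
    simp only [map_mul, conj_vacuumChar, vacuumChar_neg, inner_conj_symm]
    rw [hV.inner_left, neg_neg]

/-- The compression of a Weyl operator to the range of the vacuum projection is a multiple of the
identity. -/
theorem vacuumProj_compress (ζ : PhaseIdx ι → ℝ) (x y : H) :
    ⟪x, vacuumProj V (V ζ (vacuumProj V y))⟫_ℂ = vacuumChar ζ * ⟪x, vacuumProj V y⟫_ℂ := by
  set N : ℂ := (2 * Real.pi : ℂ) ^ Fintype.card ι with hN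
  have hN0 : N ≠ 0 := pow_ne_zero _ (by simp [Real.pi_ne_zero])
  let φ : (PhaseIdx ι → ℝ) → ℂ := fun κ => ⟪x, V κ y⟫_ℂ
  have hφc : Continuous φ := continuous_const.inner (hV.cont y)
  let Ph : (PhaseIdx ι → ℝ) → (PhaseIdx ι → ℝ) → ℂ := fun η κ =>
    Complex.exp (-(Complex.I / 2) * ((sympl η ζ + sympl (η + ζ) κ : ℝ) : ℂ))
  have hPhn : ∀ η κ, ‖Ph η κ‖ = 1 := fun η κ => by
    simp only [Ph]
    rw [show -(Complex.I / 2) * ((sympl η ζ + sympl (η + ζ) κ : ℝ) : ℂ) =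
      ((-(1 / 2) * (sympl η ζ + sympl (η + ζ) κ) : ℝ) : ℂ) * Complex.I by push_cast; ring]
    exact Complex.norm_exp_ofReal_mul_I _
  have h1 : ∀ η, ⟪x, V η (V ζ (vacuumProj V y))⟫_ℂ =
      N⁻¹ * ∫ κ, vacuumChar (κ - (η + ζ)) * (Ph η κ * φ κ) := by
    intro η
    rw [← neg_neg η, ← hV.inner_left, ← neg_neg ζ, ← hV.inner_left, hV.inner_vacuumProj]
    congr 1
    rw [← integral_sub_right_eq_self _ (η + ζ)]
    simp only [neg_neg]
    refine integral_congr_ae (Eventually.of_forall fun κ => ?_)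
    simp only
    congr 1
    rw [hV.inner_left, neg_neg, hV.inner_left, neg_neg, hV.mul_mul, inner_smul_right]
    simp only [Ph, φ]
    rw [sympl_sub_right, sympl_self, sub_zero, add_sub_cancel]
  rw [hV.inner_vacuumProj]
  simp_rw [h1]
  have hprod : Integrable (fun p : (PhaseIdx ι → ℝ) × (PhaseIdx ι → ℝ) =>
      vacuumChar p.1 * vacuumChar (p.2 - (p.1 + ζ)) * (Ph p.1 p.2 * φ p.2))
      (volume.prod volume) := by
    have h2 : Integrable (fun p : (PhaseIdx ι → ℝ) × (PhaseIdx ι → ℝ) =>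
        vacuumChar p.1 * vacuumChar (p.2 - (p.1 + ζ))) (volume.prod volume) := by
      have h3 := (integrable_vacuumChar (ι := ι)).convolution_integrand
        (ContinuousLinearMap.mul ℂ ℂ)
        ((integrable_vacuumChar (ι := ι)).comp_sub_right ζ)
      refine h3.swap.congr (Eventually.of_forall fun p => ?_)
      simp only [Function.comp, Prod.fst_swap, Prod.snd_swap, ContinuousLinearMap.mul_apply']
      rw [sub_sub]
    refine (h2.norm.mul_const (‖x‖ * ‖y‖)).mono' ?_ (Eventually.of_forall fun p => ?_)
    · refine h2.1.mul (Continuous.aestronglyMeasurable ?_)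
      have := hφc.comp (continuous_snd : Continuous
        (Prod.snd : (PhaseIdx ι → ℝ) × (PhaseIdx ι → ℝ) → _))
      refine Continuous.mul ?_ this
      simp only [Ph]
      fun_prop
    · rw [norm_mul, norm_mul (Ph _ _), hPhn, one_mul]
      refine mul_le_mul_of_nonneg_left ?_ (norm_nonneg _)
      exact (norm_inner_le_norm _ _).trans (by rw [hV.norm_apply])
  have h4 : ∫ η, vacuumChar η * (N⁻¹ * ∫ κ, vacuumChar (κ - (η + ζ)) * (Ph η κ * φ κ)) =
      N⁻¹ * ∫ η, ∫ κ, vacuumChar η * vacuumChar (κ - (η + ζ)) * (Ph η κ * φ κ) := by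
    rw [← integral_const_mul]
    refine integral_congr_ae (Eventually.of_forall fun η => ?_)
    simp only
    rw [mul_left_comm, ← integral_const_mul]
    simp_rw [mul_assoc]
  rw [h4, integral_integral_swap hprod]
  have h5 : ∀ κ, ∫ η, vacuumChar η * vacuumChar (κ - (η + ζ)) * (Ph η κ * φ κ) =
      N * vacuumChar ζ * (vacuumChar κ * φ κ) := by
    intro κ
    simp_rw [← mul_assoc]
    rw [integral_mul_const]
    simp only [Ph]
    rw [integral_vacuumChar_twisted]
    ring
  simp_rw [h5]
  rw [integral_const_mul, hV.inner_vacuumProj]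
  field_simp
  rfl

/-- The vacuum projection does not vanish, by Fourier uniqueness for `η ↦ ⟪x, V(η) x⟫`. -/
theorem exists_vacuumProj_ne_zero {x : H} (hx : x ≠ 0) : ∃ y, vacuumProj V y ≠ 0 := by
  by_contra! h
  have hN0 : ((2 * Real.pi : ℂ) ^ Fintype.card ι)⁻¹ ≠ 0 :=
    inv_ne_zero (pow_ne_zero _ (by simp [Real.pi_ne_zero]))
  let F : (PhaseIdx ι → ℝ) → ℂ := fun η => vacuumChar η * ⟪x, V η x⟫_ℂ
  have hFc : Continuous F := continuous_vacuumChar.mul (continuous_const.inner (hV.cont x))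
  have hFi : Integrable F := by
    refine (integrable_vacuumChar.norm.mul_const (‖x‖ * ‖x‖)).mono' hFc.aestronglyMeasurable
      (Eventually.of_forall fun η => ?_)
    rw [norm_mul]
    refine mul_le_mul_of_nonneg_left ?_ (norm_nonneg _)
    exact (norm_inner_le_norm _ _).trans (by rw [hV.norm_apply])
  have h0 := ae_eq_zero_of_forall_integral_exp_mul_eq_zero hFi fun u => by
    -- conjugation by `V a` turns the phase `exp (i u·η)` into a displacement
    let a : PhaseIdx ι → ℝ := fun p => if p.2 = 0 then u (p.1, 1) else -u (p.1, 0)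
    have h1 : ⟪V a x, vacuumProj V (V a x)⟫_ℂ = 0 := by rw [h, inner_zero_right]
    rw [hV.inner_vacuumProj] at h1
    rw [← (mul_eq_zero.1 h1).resolve_left hN0]
    refine integral_congr_ae (Eventually.of_forall fun η => ?_)
    simp only [F]
    rw [hV.inner_left, hV.mul_mul, inner_smul_right,
      show -a + η + a = η by abel, mul_left_comm]
    congr 1
    have h2 : sympl (-a) η + sympl (-a + η) a = -2 * ∑ p, u p * η p := by
      rw [sympl_add_left, sympl_neg_left, sympl_neg_left, sympl_self, sympl_swap a η]
      simp only [sympl, a, Fintype.sum_prod_type, Fin.sum_univ_two, if_true, one_ne_zero, if_false]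
      rw [neg_neg, neg_zero, zero_add, ← two_mul, neg_mul, ← mul_neg, ← Finset.sum_neg_distrib]
      congr 1
      exact Finset.sum_congr rfl fun j _ => by ring
    rw [h2]
    congr 1
    push_cast
    ring_nf
  have h3 : F = fun _ => 0 := (hFc.ae_eq_iff_eq volume continuous_const).1 h0
  have h4 := congrFun h3 0
  simp only [F, vacuumChar_zero, one_mul, hV.zero] at h4
  exact hx (inner_self_eq_zero.1 h4)

/-- The Stone-von Neumann theorem, in the form of the existence of a unique vacuum vector. -/
theorem exists_vacuum {x₀ : H} (hx₀ : x₀ ≠ 0) : ∃ Ω : H,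
    (∀ ζ, ⟪Ω, V ζ Ω⟫_ℂ = vacuumChar ζ) ∧
    ∀ x y, ⟪x, Ω⟫_ℂ * ⟪Ω, y⟫_ℂ =
      ((2 * Real.pi : ℂ) ^ Fintype.card ι)⁻¹ * ∫ η, vacuumChar η * ⟪x, V η y⟫_ℂ := by
  obtain ⟨y, hy⟩ := hV.exists_vacuumProj_ne_zero hx₀
  have hPP : ∀ z, vacuumProj V (vacuumProj V z) = vacuumProj V z := by
    intro z
    refine ext_inner_left ℂ fun x => ?_
    have := hV.vacuumProj_compress 0 x z
    rwa [hV.zero, vacuumChar_zero, one_mul] at this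
  have hsm : ∀ (c : ℂ) z, vacuumProj V (c • z) = c • vacuumProj V z := by
    intro c z
    simp only [vacuumProj, map_smul, smul_comm _ c, integral_smul]
  set c : ℂ := ((‖vacuumProj V y‖ : ℂ))⁻¹ with hc
  obtain ⟨Ω, hΩ⟩ : ∃ Ω : H, Ω = c • vacuumProj V y := ⟨_, rfl⟩
  have hΩn : ‖Ω‖ = 1 := by
    rw [hΩ, hc, norm_smul, norm_inv, Complex.norm_real, norm_norm,
      inv_mul_cancel₀ (norm_ne_zero_iff.2 hy)]
  have hPΩ : vacuumProj V Ω = Ω := by rw [hΩ, hsm, hPP]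
  have hΩΩ : ⟪Ω, Ω⟫_ℂ = 1 := by rw [inner_self_eq_norm_sq_to_K, hΩn]; simp
  -- vectors in the range of the projection
  have hcomp : ∀ z w ζ, ⟪vacuumProj V z, V ζ (vacuumProj V w)⟫_ℂ =
      vacuumChar ζ * ⟪vacuumProj V z, vacuumProj V w⟫_ℂ := by
    intro z w ζ
    rw [hV.vacuumProj_symm, hV.vacuumProj_compress, hV.vacuumProj_symm, hPP]
  refine ⟨Ω, fun ζ => ?_, fun x z => ?_⟩
  · have := hcomp Ω Ω ζ
    rwa [hPΩ, hΩΩ, mul_one] at this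
  · rw [← hV.inner_vacuumProj]
    -- by irreducibility the range is spanned by the vacuum vector
    have hh : vacuumProj V z = ⟪Ω, z⟫_ℂ • Ω := by
      rw [← sub_eq_zero]
      have hPh : vacuumProj V z - ⟪Ω, z⟫_ℂ • Ω = vacuumProj V (z - ⟪Ω, z⟫_ℂ • Ω) := by
        refine ext_inner_left ℂ fun w => ?_
        rw [← hV.vacuumProj_symm w (z - _), inner_sub_right, inner_sub_right, hV.vacuumProj_symm,
          inner_smul_right, inner_smul_right, hV.vacuumProj_symm, hPΩ]
      refine (hV.irred Ω _ fun ζ => ?_).resolve_left ?_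
      · have := hcomp Ω (z - ⟪Ω, z⟫_ℂ • Ω) ζ
        rw [hPΩ] at this
        rw [hPh, this, ← hPΩ, hV.vacuumProj_symm, hPP, hPΩ, ← hPh, inner_sub_right,
          ← hV.vacuumProj_symm, hPΩ, inner_smul_right, hΩΩ, mul_one, sub_self, mul_zero]
      · intro h
        rw [h, norm_zero] at hΩn
        exact zero_ne_one hΩn
    rw [hh, inner_smul_right, mul_comm]

end IsWeylSystem

end WeylSystem

end BosonicModes

namespace BosonicModes

/-! ### Series over multi-indices -/

section MultiIndex

variable {ι : Type} [Fintype ι]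

theorem pi_count_eq_count :
    Measure.pi (fun _ : ι => (Measure.count : Measure ℕ)) = Measure.count := by
  refine Measure.ext_of_singleton fun n => ?_
  rw [Measure.pi_singleton]
  simp

/-- A product of absolutely convergent series is a series over multi-indices. -/
theorem hasSum_multiIndex_prod {𝕜 : Type*} [RCLike 𝕜] {f : ι → ℕ → 𝕜}
    (hf : ∀ i, Summable fun k => ‖f i k‖) :
    (Summable fun n : ι → ℕ => ‖∏ i, f i (n i)‖) ∧
      HasSum (fun n : ι → ℕ => ∏ i, f i (n i)) (∏ i, ∑' k, f i k) := by
  have h1 : ∀ i, Integrable (f i) (Measure.count : Measure ℕ) := fun i =>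
    integrable_count_iff.2 (hf i)
  have h2 := Integrable.fintype_prod (μ := fun _ : ι => (Measure.count : Measure ℕ)) h1
  rw [pi_count_eq_count] at h2
  have h3 := integrable_count_iff.1 h2
  refine ⟨h3, ?_⟩
  have h4 := integral_fintype_prod_eq_prod f (μ := fun _ : ι => (Measure.count : Measure ℕ))
  rw [pi_count_eq_count, integral_countable h2] at h4
  simp_rw [fun i => integral_countable (h1 i)] at h4
  simp only [measureReal_def, Measure.count_singleton, ENNReal.toReal_one, one_smul] at h4
  rw [← h4]
  exact h3.of_norm.hasSum

/-- Uniqueness of the coefficients of an everywhere convergent power series. -/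
theorem eq_zero_of_hasSum_pow {a : ℕ → ℂ} (h : ∀ s : ℂ, HasSum (fun k => s ^ k * a k) 0) :
    ∀ k, a k = 0 := by
  let p : FormalMultilinearSeries ℂ ℂ ℂ := fun n =>
    ContinuousMultilinearMap.mkPiRing ℂ (Fin n) (a n)
  have hp : HasFPowerSeriesAt (0 : ℂ → ℂ) p 0 := by
    rw [hasFPowerSeriesAt_iff]
    refine Eventually.of_forall fun z => ?_
    have : ∀ n, p.coeff n = a n := fun n => by simp [p, FormalMultilinearSeries.coeff]
    simpa only [this, smul_eq_mul, Pi.zero_apply] using h z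
  intro k
  have h0 := hp.eq_zero
  have h1 : p.coeff k = a k := by simp [p, FormalMultilinearSeries.coeff]
  rw [← h1, h0]
  simp [FormalMultilinearSeries.coeff]

/-- Uniqueness of the coefficients of an everywhere convergent power series in several variables:
group the series by total degree. -/
theorem eq_zero_of_hasSum_multiIndex [DecidableEq ι] {w : (ι → ℕ) → ℂ}
    (h : ∀ z : ι → ℂ, HasSum (fun n => w n * ∏ j, z j ^ n j) 0) : ∀ n, w n = 0 := by
  have h1 : ∀ (k : ℕ) (z : ι → ℂ),
      ∑ n ∈ Finset.piAntidiag Finset.univ k, w n * ∏ j, z j ^ n j = 0 := by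
    intro k z
    refine eq_zero_of_hasSum_pow
      (a := fun k => ∑ n ∈ Finset.piAntidiag Finset.univ k, w n * ∏ j, z j ^ n j) (fun s => ?_) k
    have h2 := (h fun j => s * z j).tsum_fiberwise (fun n : ι → ℕ => ∑ j, n j)
    convert! h2 using 2 with k
    have h3 : (fun n : ι → ℕ => ∑ j, n j) ⁻¹' {k} =
        ((Finset.piAntidiag Finset.univ k : Finset (ι → ℕ)) : Set (ι → ℕ)) := by
      ext n; simp
    rw [h3, Finset.tsum_subtype' (Finset.piAntidiag Finset.univ k)
      (fun n => w n * ∏ j, (s * z j) ^ n j), Finset.mul_sum]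
    refine Finset.sum_congr rfl fun n hn => ?_
    have h4 : ∑ j, n j = k := by simpa using hn
    simp_rw [mul_pow]
    rw [Finset.prod_mul_distrib, Finset.prod_pow_eq_pow_sum, h4]
    ring
  intro n
  set k := ∑ j, n j with hk
  have hn : n ∈ Finset.piAntidiag Finset.univ k := by simp [hk]
  let P : MvPolynomial ι ℂ := ∑ n ∈ Finset.piAntidiag Finset.univ k,
    MvPolynomial.monomial (Finsupp.equivFunOnFinite.symm n) (w n)
  have hP : P = 0 := by
    refine MvPolynomial.funext fun z => ?_
    rw [map_zero, ← h1 k z, map_sum]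
    refine Finset.sum_congr rfl fun n _ => ?_
    rw [MvPolynomial.eval_monomial, Finsupp.prod_fintype _ _ (by simp)]
    simp
  have h5 := congrArg (MvPolynomial.coeff (Finsupp.equivFunOnFinite.symm n)) hP
  simp only [P, MvPolynomial.coeff_sum, MvPolynomial.coeff_monomial, EmbeddingLike.apply_eq_iff_eq,
    MvPolynomial.coeff_zero] at h5
  rwa [Finset.sum_ite_eq_of_mem' _ _ _ hn] at h5

end MultiIndex

/-! ### Orthonormal bases from Gram kernels -/

theorem denseRange_linearCombination {K I : Type*} [NormedAddCommGroup K] [InnerProductSpace ℂ K]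
    [CompleteSpace K] {k : I → K} (hk : ∀ h, (∀ a, ⟪h, k a⟫_ℂ = 0) → h = 0) :
    DenseRange (Finsupp.linearCombination ℂ k) := by
  have h1 : (LinearMap.range (Finsupp.linearCombination ℂ k)).topologicalClosure = ⊤ := by
    rw [Submodule.topologicalClosure_eq_top_iff, Submodule.eq_bot_iff]
    intro h hh
    refine hk h fun a => Submodule.inner_left_of_mem_orthogonal ?_ hh
    exact ⟨Finsupp.single a 1, by simp⟩
  have h2 := Submodule.dense_iff_topologicalClosure_eq_top.2 h1
  rwa [LinearMap.coe_range] at h2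

/-- A total family of vectors whose Gram kernel is the Gram kernel of a total family of square
summable sequences determines an orthonormal basis in which the vectors have these sequences as
coefficients. -/
theorem exists_hilbertBasis_of_gram {H : Type} [NormedAddCommGroup H] [InnerProductSpace ℂ H]
    [CompleteSpace H] {I N : Type*} {x : I → H} {c : I → N → ℂ}
    (hsum : ∀ a b, HasSum (fun n => (starRingEnd ℂ) (c a n) * c b n) ⟪x a, x b⟫_ℂ)
    (hx : ∀ h, (∀ a, ⟪h, x a⟫_ℂ = 0) → h = 0)
    (hc : ∀ v : N → ℂ, (∀ a, HasSum (fun n => (starRingEnd ℂ) (v n) * c a n) 0) → v = 0) :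
    ∃ B : HilbertBasis N ℂ H, ∀ a n, ⟪B n, x a⟫_ℂ = c a n := by
  have hmem : ∀ a, Memℓp (c a) 2 := by
    intro a
    rw [memℓp_gen_iff (by simp)]
    have h := (hsum a a).summable.norm
    refine h.congr fun n => ?_
    rw [norm_mul, RCLike.norm_conj]
    simp [sq]
  -- the map `x a ↦ c a` extends to a unitary operator onto `ℓ²`
  let y : I → lp (fun _ : N => ℂ) 2 := fun a => ⟨c a, hmem a⟩
  have hy : ∀ a b, ⟪y a, y b⟫_ℂ = ⟪x a, x b⟫_ℂ := by
    intro a b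
    refine (lp.hasSum_inner (y a) (y b)).unique ?_
    convert! hsum a b using 2 with n
    simp [y, mul_comm]
  have hdx : DenseRange (Finsupp.linearCombination ℂ x) := denseRange_linearCombination hx
  have hdy : DenseRange (Finsupp.linearCombination ℂ y) := by
    refine denseRange_linearCombination fun h hh => lp.ext (hc _ fun a => ?_)
    rw [← hh a]
    convert! lp.hasSum_inner h (y a) using 2 with n
    simp [y, mul_comm]
  have hnorm : ∀ u : I →₀ ℂ, ‖Finsupp.linearCombination ℂ y u‖ =
      ‖Finsupp.linearCombination ℂ x u‖ := by
    intro u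
    have h : ⟪Finsupp.linearCombination ℂ y u, Finsupp.linearCombination ℂ y u⟫_ℂ =
        ⟪Finsupp.linearCombination ℂ x u, Finsupp.linearCombination ℂ x u⟫_ℂ := by
      simp only [Finsupp.linearCombination_apply, Finsupp.sum, sum_inner, inner_sum,
        inner_smul_left, inner_smul_right, hy]
    rw [inner_self_eq_norm_sq_to_K, inner_self_eq_norm_sq_to_K] at h
    exact (pow_left_inj₀ (norm_nonneg _) (norm_nonneg _) two_ne_zero).1 (by exact_mod_cast h)
  let e : H ≃ₗᵢ[ℂ] lp (fun _ : N => ℂ) 2 :=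
    LinearEquiv.extendOfIsometry (LinearEquiv.refl ℂ (I →₀ ℂ)) (Finsupp.linearCombination ℂ x)
      (Finsupp.linearCombination ℂ y) hdx hdy hnorm
  have he : ∀ a, e (x a) = y a := by
    intro a
    have h := LinearEquiv.extendOfIsometry_eq (LinearEquiv.refl ℂ (I →₀ ℂ)) _ _ hdx hdy hnorm
      (Finsupp.single a 1)
    simpa using h
  refine ⟨HilbertBasis.ofRepr e, fun a n => ?_⟩
  rw [← HilbertBasis.repr_apply_apply]
  change (e (x a)) n = c a n
  rw [he]

end BosonicModes

namespace BosonicModes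

/-! ### Coherent vectors and the spectrum of a Gaussian state -/

section Spectrum

variable {ι : Type}

/-- The complex amplitude `(α_Q + i α_P) / √2` of a phase space point. -/
noncomputable def amplitude (α : PhaseIdx ι → ℝ) (j : ι) : ℂ :=
  (α (j, 0) + Complex.I * α (j, 1)) / (√2 : ℝ)

theorem exists_amplitude_eq (z : ι → ℂ) : ∃ α : PhaseIdx ι → ℝ, amplitude α = z := by
  refine ⟨fun p => if p.2 = 0 then √2 * (z p.1).re else √2 * (z p.1).im, ?_⟩
  funext j
  have h2 : ((√2 : ℝ) : ℂ) ≠ 0 := by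
    exact_mod_cast (Real.sqrt_pos.2 two_pos).ne'
  simp only [amplitude, if_true, one_ne_zero, if_false]
  rw [div_eq_iff h2]
  conv_rhs => rw [← Complex.re_add_im (z j)]
  push_cast
  ring

theorem conj_amplitude_mul (α β : PhaseIdx ι → ℝ) (j : ι) :
    (starRingEnd ℂ) (amplitude α j) * amplitude β j =
      (1 / 2) * ((α (j, 0) : ℂ) * β (j, 0) + α (j, 1) * β (j, 1) +
        Complex.I * ((α (j, 0) : ℂ) * β (j, 1) - α (j, 1) * β (j, 0))) := by
  have h2 : ((√2 : ℝ) : ℂ) * ((√2 : ℝ) : ℂ) = 2 := by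
    rw [← Complex.ofReal_mul, Real.mul_self_sqrt zero_le_two]; norm_num
  simp only [amplitude, map_div₀, map_add, map_mul, Complex.conj_ofReal, Complex.conj_I]
  rw [div_mul_div_comm, h2]
  ring_nf
  simp only [Complex.I_sq]
  ring

variable [Fintype ι]

/-- The coefficients of the coherent vectors in the number basis: `∏ j, z j ^ n j / √(n j)!`. -/
noncomputable def fockCoeff (α : PhaseIdx ι → ℝ) (n : ι → ℕ) : ℂ :=
  ∏ j, amplitude α j ^ n j / (√((n j).factorial : ℝ) : ℝ)

/-- Generating function of the products of Fock coefficients. -/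
theorem hasSum_fockCoeff (q : ι → ℝ) (α β : PhaseIdx ι → ℝ) :
    HasSum (fun n => ((∏ j, q j ^ n j : ℝ) : ℂ) *
      ((starRingEnd ℂ) (fockCoeff α n) * fockCoeff β n))
      (Complex.exp (∑ j, q j * ((starRingEnd ℂ) (amplitude α j) * amplitude β j))) := by
  have h1 : ∀ j, HasSum (fun k : ℕ =>
      (q j * ((starRingEnd ℂ) (amplitude α j) * amplitude β j)) ^ k / (k.factorial : ℂ))
      (Complex.exp (q j * ((starRingEnd ℂ) (amplitude α j) * amplitude β j))) := by
    intro j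
    rw [Complex.exp_eq_exp_ℂ]
    exact NormedSpace.expSeries_div_hasSum_exp _
  have h2 := (hasSum_multiIndex_prod (f := fun j k =>
      (q j * ((starRingEnd ℂ) (amplitude α j) * amplitude β j)) ^ k / (k.factorial : ℂ))
      (fun j => (h1 j).summable.norm)).2
  simp_rw [fun j => (h1 j).tsum_eq, ← Complex.exp_sum] at h2
  convert! h2 using 2 with n
  simp only [fockCoeff, map_prod, map_div₀, map_pow, Complex.conj_ofReal]
  push_cast
  rw [← Finset.prod_mul_distrib, ← Finset.prod_mul_distrib]
  refine Finset.prod_congr rfl fun j _ => ?_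
  have h3 : ((√((n j).factorial : ℝ) : ℝ) : ℂ) * ((√((n j).factorial : ℝ) : ℝ) : ℂ) =
      ((n j).factorial : ℂ) := by
    rw [← Complex.ofReal_mul, Real.mul_self_sqrt (by positivity)]; norm_num
  rw [div_mul_div_comm, h3, mul_pow, mul_pow]
  ring

/-- The sequences `fockCoeff α` are total in `ℓ²`. -/
theorem eq_zero_of_hasSum_fockCoeff {v : (ι → ℕ) → ℂ}
    (h : ∀ α : PhaseIdx ι → ℝ, HasSum (fun n => (starRingEnd ℂ) (v n) * fockCoeff α n) 0) :
    v = 0 := by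
  classical
  have hne : ∀ n : ι → ℕ, (∏ j, ((√((n j).factorial : ℝ) : ℝ) : ℂ)) ≠ 0 := fun n =>
    Finset.prod_ne_zero_iff.2 fun j _ => by
      exact_mod_cast (Real.sqrt_pos.2 (by positivity)).ne'
  have h1 := eq_zero_of_hasSum_multiIndex
    (w := fun n => (starRingEnd ℂ) (v n) / ∏ j, ((√((n j).factorial : ℝ) : ℝ) : ℂ)) (fun z => by
      obtain ⟨α, rfl⟩ := exists_amplitude_eq z
      convert! h α using 2 with n
      simp only [fockCoeff, Finset.prod_div_distrib]
      ring)
  funext n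
  have h2 := (div_eq_zero_iff.1 (h1 n)).resolve_right (hne n)
  simpa using h2

variable {H : Type} [NormedAddCommGroup H] [InnerProductSpace ℂ H] [CompleteSpace H]
  {V : (PhaseIdx ι → ℝ) → H →L[ℂ] H}

/-- The unnormalized coherent vector `exp (|α|² / 4) V(α) Ω`. With this normalization the Gram kernel
is the exponential of the sesquilinear form of the amplitudes. -/
noncomputable def coherent (V : (PhaseIdx ι → ℝ) → H →L[ℂ] H) (Ω : H) (α : PhaseIdx ι → ℝ) : H :=
  Complex.exp (∑ j, (1 / 4 : ℂ) * ((α (j, 0) : ℂ) ^ 2 + (α (j, 1) : ℂ) ^ 2)) • V α Ω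

omit [CompleteSpace H] in
theorem inner_coherent (Ω : H) (α β : PhaseIdx ι → ℝ) (T : H →L[ℂ] H) :
    ⟪coherent V Ω α, T (coherent V Ω β)⟫_ℂ =
      Complex.exp (∑ j, (1 / 4 : ℂ) * ((α (j, 0) : ℂ) ^ 2 + (α (j, 1) : ℂ) ^ 2 +
        (β (j, 0) : ℂ) ^ 2 + (β (j, 1) : ℂ) ^ 2)) * ⟪V α Ω, T (V β Ω)⟫_ℂ := by
  simp only [coherent, map_smul, inner_smul_left, inner_smul_right, ← Complex.exp_conj, map_sum,
    map_mul, map_add, map_pow, Complex.conj_ofReal, map_div₀, map_one, map_ofNat]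
  rw [← mul_assoc, ← Complex.exp_add, ← Finset.sum_add_distrib]
  congr 2
  exact Finset.sum_congr rfl fun j _ => by ring

variable [TopologicalSpace.SeparableSpace H]

/-- The matrix elements of a Gaussian state between coherent vectors: expand the vacuum projection
into Weyl operators and evaluate a Gaussian integral. -/
theorem IsWeylSystem.inner_coherent_gaussian (hV : IsWeylSystem V) {Ω : H}
    (hΩ : ∀ x y, ⟪x, Ω⟫_ℂ * ⟪Ω, y⟫_ℂ =
      ((2 * Real.pi : ℂ) ^ Fintype.card ι)⁻¹ * ∫ η, vacuumChar η * ⟪x, V η y⟫_ℂ)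
    {ρ : H →L[ℂ] H} (hρ : IsDensityOperator ρ) {lam : ι → ℝ} (hlam : ∀ j, 0 ≤ lam j)
    (hχ : ∀ η, trace (ρ ∘L V η) =
      Complex.exp (∑ j, (-(1 / 4 : ℂ) * (lam j * ((η (j, 0) : ℂ) ^ 2 + (η (j, 1) : ℂ) ^ 2)))))
    (α β : PhaseIdx ι → ℝ) :
    ⟪coherent V Ω α, ρ (coherent V Ω β)⟫_ℂ =
      ((∏ j, 2 / (lam j + 1) : ℝ) : ℂ) *
        Complex.exp (∑ j, (((lam j - 1) / (lam j + 1) : ℝ) : ℂ) *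
          ((starRingEnd ℂ) (amplitude α j) * amplitude β j)) := by
  have := HilbertBasis.countable (onb H)
  obtain ⟨f, hf1, hf2, hf3⟩ := hρ.exists_mixture
  have h1 : ∀ i, ⟪V α Ω, f i⟫_ℂ * ⟪f i, V β Ω⟫_ℂ =
      ((2 * Real.pi : ℂ) ^ Fintype.card ι)⁻¹ *
        ∫ η, vacuumChar η * ⟪f i, V β (V η (V (-α) (f i)))⟫_ℂ := by
    intro i
    have h : ⟪V α Ω, f i⟫_ℂ * ⟪f i, V β Ω⟫_ℂ = ⟪V (-β) (f i), Ω⟫_ℂ * ⟪Ω, V (-α) (f i)⟫_ℂ := by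
      rw [hV.inner_left, hV.inner_left, neg_neg, mul_comm]
    rw [h, hΩ]
    simp_rw [hV.inner_left, neg_neg]
  have h2 : HasSum (fun i => ∫ η, vacuumChar η * ⟪f i, V β (V η (V (-α) (f i)))⟫_ℂ)
      (∫ η, vacuumChar η * trace (ρ ∘L (V β ∘L V η ∘L V (-α)))) := by
    refine hasSum_integral_of_dominated_convergence
      (fun i η => ‖(vacuumChar η : ℂ)‖ * ‖f i‖ ^ 2) (fun i => ?_)
      (fun i => Eventually.of_forall fun η => ?_)
      (Eventually.of_forall fun η => hf1.summable.mul_left _) ?_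
      (Eventually.of_forall fun η => (hf3 (V β ∘L V η ∘L V (-α))).mul_left _)
    · exact (continuous_vacuumChar.mul (continuous_const.inner
        ((V β).continuous.comp (hV.cont _)))).aestronglyMeasurable
    · rw [norm_mul]
      refine mul_le_mul_of_nonneg_left ?_ (norm_nonneg _)
      refine (norm_inner_le_norm _ _).trans ?_
      rw [hV.norm_apply, hV.norm_apply, hV.norm_apply, sq]
    · simp_rw [tsum_mul_left, hf1.tsum_eq, mul_one]
      exact integrable_vacuumChar.norm
  have h3 : ⟪V α Ω, ρ (V β Ω)⟫_ℂ = ((2 * Real.pi : ℂ) ^ Fintype.card ι)⁻¹ *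
      ∫ η, vacuumChar η * trace (ρ ∘L (V β ∘L V η ∘L V (-α))) := by
    refine (hf2 _ _).unique ?_
    simp_rw [h1]
    exact h2.mul_left _
  have htr : ∀ η, trace (ρ ∘L (V β ∘L V η ∘L V (-α))) =
      Complex.exp (-(Complex.I / 2) * ((sympl β η + sympl (β + η) (-α) : ℝ) : ℂ)) *
        Complex.exp (∑ j, (-(1 / 4 : ℂ) * (lam j * (((β + η + -α) (j, 0) : ℂ) ^ 2 +
          ((β + η + -α) (j, 1) : ℂ) ^ 2)))) := by
    intro η
    rw [← hχ]
    have h4 : V β ∘L V η ∘L V (-α) = Complex.exp (-(Complex.I / 2) *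
        ((sympl β η + sympl (β + η) (-α) : ℝ) : ℂ)) • V (β + η + -α) := by
      ext1 x
      exact hV.mul_mul β η (-α) x
    rw [h4, ContinuousLinearMap.comp_smul]
    simp only [trace, _root_.smul_apply, inner_smul_right, tsum_mul_left]
  have hG := integral_mode_gaussian (ι := ι) (b := fun j => (1 + lam j) / 4)
    (fun j => by have := hlam j; positivity)
    (fun j => -(1 / 2) * lam j * ((β (j, 0) : ℂ) - α (j, 0)) +
      (Complex.I / 2) * ((β (j, 1) : ℂ) + α (j, 1)))
    (fun j => -(1 / 2) * lam j * ((β (j, 1) : ℂ) - α (j, 1)) -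
      (Complex.I / 2) * ((β (j, 0) : ℂ) + α (j, 0)))
    (fun j => -(1 / 4) * lam j * (((β (j, 0) : ℂ) - α (j, 0)) ^ 2 +
      ((β (j, 1) : ℂ) - α (j, 1)) ^ 2) +
      (Complex.I / 2) * ((β (j, 0) : ℂ) * α (j, 1) - β (j, 1) * α (j, 0)))
  have h5 := hG.symm.trans (integral_congr_ae
    (g := fun η => vacuumChar η * trace (ρ ∘L (V β ∘L V η ∘L V (-α))))
    (Eventually.of_forall fun η => by
      simp only [htr, vacuumChar, sympl]
      rw [← Complex.exp_add, ← Complex.exp_add]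
      congr 1
      push_cast
      rw [mul_add, Finset.mul_sum, Finset.mul_sum, ← Finset.sum_add_distrib,
        ← Finset.sum_add_distrib, ← Finset.sum_add_distrib]
      refine Finset.sum_congr rfl fun j _ => ?_
      simp only [Pi.add_apply, Pi.neg_apply]
      push_cast
      ring))
  rw [inner_coherent Ω, h3, ← h5]
  have hc : ((2 * Real.pi : ℂ) ^ Fintype.card ι)⁻¹ *
      ∏ j, ((Real.pi : ℂ) / (((1 + lam j) / 4 : ℝ) : ℂ)) = ((∏ j, 2 / (lam j + 1) : ℝ) : ℂ) := by
    rw [← Finset.card_univ, ← Finset.prod_const, ← Finset.prod_inv_distrib,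
      ← Finset.prod_mul_distrib]
    push_cast
    refine Finset.prod_congr rfl fun j _ => ?_
    have h6 : (1 + lam j : ℂ) ≠ 0 := by
      have := hlam j
      exact_mod_cast (by positivity : 1 + lam j ≠ 0)
    have h7 : (lam j + 1 : ℂ) ≠ 0 := by rwa [add_comm]
    have hpi : (Real.pi : ℂ) ≠ 0 := by exact_mod_cast Real.pi_ne_zero
    field_simp
    ring
  rw [← mul_assoc (_⁻¹ : ℂ), hc, mul_left_comm, ← Complex.exp_add, ← Finset.sum_add_distrib]
  congr 2
  refine Finset.sum_congr rfl fun j _ => ?_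
  rw [conj_amplitude_mul]
  have h7 : (lam j + 1 : ℂ) ≠ 0 := by
    have := hlam j
    exact_mod_cast (by positivity : lam j + 1 ≠ 0)
  have h6 : (1 + lam j : ℂ) ≠ 0 := by rwa [add_comm]
  push_cast
  field_simp
  ring_nf
  simp only [Complex.I_sq]
  ring

/-- The spectral decomposition of a Gaussian state: it is diagonal in the number basis, with a
product of geometric distributions as eigenvalues. -/
theorem IsWeylSystem.gaussian_spectrum (hV : IsWeylSystem V)
    {ρ : H →L[ℂ] H} (hρ : IsDensityOperator ρ) {lam : ι → ℝ} (hlam : ∀ j, 0 ≤ lam j)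
    (hχ : ∀ η, trace (ρ ∘L V η) =
      Complex.exp (∑ j, (-(1 / 4 : ℂ) * (lam j * ((η (j, 0) : ℂ) ^ 2 + (η (j, 1) : ℂ) ^ 2))))) :
    ∃ B : HilbertBasis (ι → ℕ) ℂ H, ∀ n, ρ (B n) =
      ((∏ j, 2 / (lam j + 1) * ((lam j - 1) / (lam j + 1)) ^ n j : ℝ) : ℂ) • B n := by
  obtain ⟨x₀, hx₀⟩ : ∃ x₀ : H, x₀ ≠ 0 := by
    by_contra! h
    have h1 := hρ.trace_eq_one
    simp only [trace, h, inner_zero_left, tsum_zero] at h1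
    exact zero_ne_one h1
  obtain ⟨Ω, hΩ1, hΩ2⟩ := hV.exists_vacuum hx₀
  have hΩ0 : Ω ≠ 0 := by
    intro h
    have := hΩ1 0
    rw [h, inner_zero_left, vacuumChar_zero] at this
    exact zero_ne_one this
  have htot : ∀ h : H, (∀ α, ⟪h, coherent V Ω α⟫_ℂ = 0) → h = 0 := by
    intro h hh
    refine (hV.irred h Ω fun η => ?_).resolve_right hΩ0
    have := hh η
    rw [coherent, inner_smul_right] at this
    exact (mul_eq_zero.1 this).resolve_left (Complex.exp_ne_zero _)
  have hgram : ∀ α β, HasSum (fun n => (starRingEnd ℂ) (fockCoeff α n) * fockCoeff β n)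
      ⟪coherent V Ω α, coherent V Ω β⟫_ℂ := by
    intro α β
    have h1 := hasSum_fockCoeff (fun _ => 1) α β
    simp only [one_pow, Finset.prod_const_one, Complex.ofReal_one, one_mul] at h1
    convert! h1 using 1
    have h2 := inner_coherent (V := V) Ω α β (ContinuousLinearMap.id ℂ H)
    simp only [ContinuousLinearMap.id_apply] at h2
    rw [h2, hV.inner_left, hV.mul, inner_smul_right, hΩ1, vacuumChar, sympl, ← Complex.exp_add,
      ← Complex.exp_add]
    congr 1
    push_cast
    rw [Finset.mul_sum, ← Finset.sum_add_distrib, ← Finset.sum_add_distrib]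
    refine Finset.sum_congr rfl fun j _ => ?_
    rw [conj_amplitude_mul]
    simp only [Pi.add_apply, Pi.neg_apply]
    push_cast
    ring
  -- the number basis
  obtain ⟨B, hB⟩ := exists_hilbertBasis_of_gram hgram htot fun v hv =>
    eq_zero_of_hasSum_fockCoeff hv
  refine ⟨B, ?_⟩
  set p : (ι → ℕ) → ℝ := fun n => ∏ j, 2 / (lam j + 1) * ((lam j - 1) / (lam j + 1)) ^ n j with hp
  have hρs : ∀ x y, ⟪ρ x, y⟫_ℂ = ⟪x, ρ y⟫_ℂ := hρ.isPositive.inner_left_eq_inner_right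
  -- compare the expansions of `⟪coherent α, ρ (coherent β)⟫` in powers of the amplitude of `α`
  have hpB : ∀ β n, ⟪B n, ρ (coherent V Ω β)⟫_ℂ = p n * fockCoeff β n := by
    intro β n
    rw [← sub_eq_zero]
    refine congrFun (eq_zero_of_hasSum_fockCoeff
      (v := fun n => ⟪B n, ρ (coherent V Ω β)⟫_ℂ - p n * fockCoeff β n) fun α => ?_) n
    have h1 := B.hasSum_inner_mul_inner (ρ (coherent V Ω β)) (coherent V Ω α)
    rw [hρs, hV.inner_coherent_gaussian hΩ2 hρ hlam hχ] at h1
    have h2 := (hasSum_fockCoeff (fun j => (lam j - 1) / (lam j + 1)) β α).mul_left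
      (((∏ j, 2 / (lam j + 1) : ℝ) : ℂ))
    have h3 := h1.sub h2
    rw [sub_self] at h3
    convert! h3 using 2 with n
    rw [hB, map_sub, inner_conj_symm, sub_mul, map_mul, Complex.conj_ofReal]
    simp only [hp, Finset.prod_mul_distrib]
    push_cast
    ring
  intro n
  rw [← sub_eq_zero]
  refine htot _ fun β => ?_
  rw [inner_sub_left, hρs, hpB, inner_smul_left, hB, Complex.conj_ofReal, sub_self]

end Spectrum

end BosonicModes

namespace BosonicModes

/-! ### Symplectic changes of the mode operators -/

section SymplecticWeyl

variable {ι : Type} [Fintype ι] [DecidableEq ι]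

theorem sympForm_mul_self : sympForm ι * sympForm ι = -1 := by
  unfold sympForm
  rw [← Matrix.mul_kronecker_mul, one_mul,
    show (!![0, 1; -1, 0] * !![0, 1; -1, 0] : Matrix (Fin 2) (Fin 2) ℝ) = -1 by
      ext i j; fin_cases i <;> fin_cases j <;> simp [Matrix.mul_apply]]
  ext p q
  simp only [Matrix.kroneckerMap_apply, Matrix.neg_apply, Matrix.one_apply, Prod.ext_iff]
  split_ifs <;> simp_all

omit [Fintype ι] in
theorem sympForm_transpose : (sympForm ι)ᵀ = -sympForm ι := by
  ext ⟨i, a⟩ ⟨j, b⟩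
  simp only [sympForm, Matrix.transpose_apply, Matrix.kroneckerMap_apply, Matrix.neg_apply,
    Matrix.one_apply, eq_comm (a := j)]
  fin_cases a <;> fin_cases b <;> simp

theorem IsSymplectic.mul_inverse {S : Matrix (PhaseIdx ι) (PhaseIdx ι) ℝ} (hS : IsSymplectic S) :
    S * (-(sympForm ι * Sᵀ * sympForm ι)) = 1 := by
  rw [mul_neg, ← mul_assoc, ← mul_assoc, hS, sympForm_mul_self, neg_neg]

theorem IsSymplectic.inverse_mul {S : Matrix (PhaseIdx ι) (PhaseIdx ι) ℝ} (hS : IsSymplectic S) :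
    (-(sympForm ι * Sᵀ * sympForm ι)) * S = 1 :=
  mul_eq_one_comm.1 hS.mul_inverse

theorem IsSymplectic.sympl_transpose {S : Matrix (PhaseIdx ι) (PhaseIdx ι) ℝ}
    (hS : IsSymplectic S) (η ζ : PhaseIdx ι → ℝ) :
    sympl (Sᵀ *ᵥ η) (Sᵀ *ᵥ ζ) = sympl η ζ := by
  rw [sympl_eq_dotProduct, sympl_eq_dotProduct, Matrix.mulVec_transpose,
    ← Matrix.dotProduct_mulVec, Matrix.mulVec_mulVec, Matrix.mulVec_mulVec]
  rw [show S * sympForm ι * Sᵀ = sympForm ι from hS]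

/-- The Weyl operators `exp (i η·R')` of the mode operators `R' = S (R - d)`. -/
noncomputable def transformedWeyl (S : Matrix (PhaseIdx ι) (PhaseIdx ι) ℝ) (d : PhaseIdx ι → ℝ)
    (η : PhaseIdx ι → ℝ) : ModeOp ι :=
  Complex.exp (-Complex.I * ((Sᵀ *ᵥ η ⬝ᵥ d : ℝ) : ℂ)) • expIR (Sᵀ *ᵥ η)

/-- A symplectic transformation preserves the canonical commutation relations. -/
theorem isWeylSystem_transformedWeyl {S : Matrix (PhaseIdx ι) (PhaseIdx ι) ℝ}
    (hS : IsSymplectic S) (d : PhaseIdx ι → ℝ) : IsWeylSystem (transformedWeyl S d) where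
  mul η ζ x := by
    simp only [transformedWeyl, _root_.smul_apply, map_smul, smul_smul, expIR_expIR,
      hS.sympl_transpose, Matrix.mulVec_add, add_dotProduct]
    congr 1
    rw [← Complex.exp_add, ← Complex.exp_add, ← Complex.exp_add]
    congr 1
    push_cast
    ring
  zero x := by simp [transformedWeyl, expIR_zero]
  adjoint η := by
    simp only [transformedWeyl, map_smulₛₗ, adjoint_expIR, Matrix.mulVec_neg, neg_dotProduct,
      ← Complex.exp_conj, map_mul, map_neg, Complex.conj_I, Complex.conj_ofReal,
      Complex.ofReal_neg]
    congr 2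
    ring
  cont x := by
    simp only [transformedWeyl, _root_.smul_apply]
    have h1 : Continuous fun η : PhaseIdx ι → ℝ => Sᵀ *ᵥ η :=
      continuous_const.matrix_mulVec continuous_id
    have h2 : Continuous fun η : PhaseIdx ι → ℝ =>
        Complex.exp (-Complex.I * ((Sᵀ *ᵥ η ⬝ᵥ d : ℝ) : ℂ)) :=
      Complex.continuous_exp.comp (continuous_const.mul
        (Complex.continuous_ofReal.comp (h1.dotProduct continuous_const)))
    exact h2.smul ((continuous_expIR x).comp h1)
  irred x y h := by
    refine eq_zero_of_forall_inner_expIR fun η => ?_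
    have h1 := h ((-(sympForm ι * Sᵀ * sympForm ι))ᵀ *ᵥ η)
    simp only [transformedWeyl, _root_.smul_apply, inner_smul_right, Matrix.mulVec_mulVec,
      ← Matrix.transpose_mul, hS.inverse_mul, Matrix.transpose_one, Matrix.one_mulVec] at h1
    exact (mul_eq_zero.1 h1).resolve_left (Complex.exp_ne_zero _)

theorem trace_comp_smul {H : Type} [NormedAddCommGroup H] [InnerProductSpace ℂ H]
    [CompleteSpace H] (ρ T : H →L[ℂ] H) (c : ℂ) : trace (ρ ∘L (c • T)) = c * trace (ρ ∘L T) := by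
  simp only [trace, ContinuousLinearMap.comp_apply, _root_.smul_apply, map_smul, inner_smul_right,
    tsum_mul_left]

theorem doubledDiagonal_quadratic (lam : ι → ℝ) (η : PhaseIdx ι → ℝ) :
    η ⬝ᵥ (doubledDiagonal lam *ᵥ η) = ∑ j, lam j * (η (j, 0) ^ 2 + η (j, 1) ^ 2) := by
  simp only [doubledDiagonal, Matrix.mulVec_diagonal, dotProduct, Fintype.sum_prod_type,
    Fin.sum_univ_two]
  exact Finset.sum_congr rfl fun j _ => by ring

/-- In the transformed mode operators the Gaussian state is centred and has diagonal covariance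
matrix. -/
theorem IsGaussianState.trace_transformedWeyl {ρ : ModeOp ι}
    {M S : Matrix (PhaseIdx ι) (PhaseIdx ι) ℝ} {d : PhaseIdx ι → ℝ} (hρ : IsGaussianState ρ M d)
    {lam : ι → ℝ} (hSM : S * M * Sᵀ = doubledDiagonal lam) (η : PhaseIdx ι → ℝ) :
    trace (ρ ∘L transformedWeyl S d η) =
      Complex.exp (∑ j, (-(1 / 4 : ℂ) * (lam j * ((η (j, 0) : ℂ) ^ 2 + (η (j, 1) : ℂ) ^ 2)))) := by
  have h : (Sᵀ *ᵥ η) ⬝ᵥ (M *ᵥ (Sᵀ *ᵥ η)) = ∑ j, lam j * (η (j, 0) ^ 2 + η (j, 1) ^ 2) := by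
    rw [← doubledDiagonal_quadratic, ← hSM]
    conv_lhs => rw [Matrix.mulVec_transpose]
    rw [← Matrix.dotProduct_mulVec, Matrix.mulVec_mulVec, ← Matrix.mulVec_transpose S η,
      Matrix.mulVec_mulVec]
  rw [transformedWeyl, trace_comp_smul, hρ.charFun_eq, ← Complex.exp_add, h]
  congr 1
  push_cast
  rw [← Finset.mul_sum]
  ring

end SymplecticWeyl

/-! ### Spectral functions on eigenvectors -/

section Entropy

variable {H : Type} [NormedAddCommGroup H] [InnerProductSpace ℂ H] [CompleteSpace H]

theorem IsDensityOperator.norm_trace_le_one [TopologicalSpace.SeparableSpace H] {ρ : H →L[ℂ] H}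
    (hρ : IsDensityOperator ρ)
    {V : H →L[ℂ] H} (hV : ∀ x, ‖V x‖ = ‖x‖) : ‖trace (ρ ∘L V)‖ ≤ 1 := by
  obtain ⟨f, hf1, -, hf⟩ := hρ.exists_mixture
  rw [← (hf V).tsum_eq, ← hf1.tsum_eq]
  refine tsum_of_norm_bounded hf1.summable.hasSum fun i => ?_
  calc ‖⟪f i, V (f i)⟫_ℂ‖ ≤ ‖f i‖ * ‖V (f i)‖ := norm_inner_le_norm _ _
    _ = ‖f i‖ ^ 2 := by rw [hV, sq]

omit [CompleteSpace H] in
theorem aeval_apply_eigenvector (T : H →L[ℂ] H) {p : ℝ} {v : H} (hv : T v = (p : ℂ) • v)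
    (q : Polynomial ℝ) : Polynomial.aeval T q v = ((q.eval p : ℝ) : ℂ) • v := by
  induction q using Polynomial.induction_on' with
  | add a b ha hb => simp only [map_add, _root_.add_apply, ha, hb, Polynomial.eval_add,
      Complex.ofReal_add, add_smul]
  | monomial n a =>
    have h : ∀ n : ℕ, (T ^ n) v = ((p : ℂ) ^ n) • v := by
      intro n
      induction n with
      | zero => simp
      | succ n ih => rw [pow_succ', mul_apply_eq_comp, ih, map_smul, hv, smul_smul,
          pow_succ]
    rw [Polynomial.aeval_monomial, mul_apply_eq_comp, h, Polynomial.eval_monomial,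
      Algebra.algebraMap_eq_smul_one, _root_.smul_apply, one_apply_eq_self]
    push_cast
    rw [← smul_smul]
    exact (Complex.coe_smul a _).symm

/-- The functional calculus acts on eigenvectors as expected, by polynomial approximation of `f` on
an interval that contains the spectrum and the eigenvalue. -/
theorem cfc_apply_eigenvector {T : H →L[ℂ] H} (hT : IsSelfAdjoint T) {p : ℝ} {v : H}
    (hv : T v = (p : ℂ) • v) {f : ℝ → ℝ} (hf : Continuous f) :
    cfc f T v = ((f p : ℝ) : ℂ) • v := by
  rw [← sub_eq_zero, ← norm_le_zero_iff]
  refine le_of_forall_pos_le_add fun ε hε => ?_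
  obtain ⟨δ, hδ, hδε⟩ : ∃ δ : ℝ, 0 < δ ∧ 2 * δ * ‖v‖ ≤ ε := by
    refine ⟨ε / (2 * (‖v‖ + 1)), by positivity, ?_⟩
    rw [show 2 * (ε / (2 * (‖v‖ + 1))) * ‖v‖ = ε * (‖v‖ / (‖v‖ + 1)) by field_simp]
    exact mul_le_of_le_one_right hε.le (div_le_one_of_le₀ (by linarith) (by positivity))
  set R : ℝ := max |p| ‖T‖
  obtain ⟨q, hq⟩ := exists_polynomial_near_of_continuousOn (-R) R f hf.continuousOn δ hδ
  have h1 : ‖cfc f T - Polynomial.aeval T q‖ ≤ δ := by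
    rw [← cfc_polynomial q T, ← cfc_sub f (fun x => q.eval x) T]
    refine norm_cfc_le hδ.le fun x hx => ?_
    have hx' : |x| ≤ ‖T‖ := by
      have := spectrum.norm_le_norm_mul_of_mem hx
      refine this.trans (mul_le_of_le_one_right (norm_nonneg _) ?_)
      exact ContinuousLinearMap.norm_id_le
    rw [Real.norm_eq_abs, abs_sub_comm]
    exact (hq x (abs_le.1 (hx'.trans (le_max_right _ _)))).le
  have h2 : |q.eval p - f p| ≤ δ := (hq p (abs_le.1 (le_max_left _ _))).le
  have h3 : cfc f T v - ((f p : ℝ) : ℂ) • v =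
      (cfc f T - Polynomial.aeval T q) v + ((q.eval p - f p : ℝ) : ℂ) • v := by
    rw [_root_.sub_apply, aeval_apply_eigenvector T hv, Complex.ofReal_sub, sub_smul]
    abel
  calc ‖cfc f T v - ((f p : ℝ) : ℂ) • v‖
      ≤ ‖cfc f T - Polynomial.aeval T q‖ * ‖v‖ + |q.eval p - f p| * ‖v‖ := by
        rw [h3]
        refine (norm_add_le _ _).trans (add_le_add (ContinuousLinearMap.le_opNorm _ _) ?_)
        rw [norm_smul, Complex.norm_real, Real.norm_eq_abs]
    _ ≤ δ * ‖v‖ + δ * ‖v‖ := by gcongr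
    _ ≤ 0 + ε := by linarith

/-- The entropy of a state that is diagonal in an orthonormal basis is the Shannon entropy of its
eigenvalues. -/
theorem entropy_eq_tsum {ρ : H →L[ℂ] H} (hρ : IsSelfAdjoint ρ) {I : Type*}
    (B : HilbertBasis I ℂ H) {p : I → ℝ} (h0 : ∀ n, 0 ≤ p n) (h1 : ∀ n, p n ≤ 1)
    (hB : ∀ n, ρ (B n) = (p n : ℂ) • B n) :
    entropy ρ = ∑' n, ENNReal.ofReal (Real.negMulLog (p n)) := by
  set T := cfc (fun x : ℝ => -(x * Real.log x)) ρ with hT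
  have hcont : Continuous fun x : ℝ => -(x * Real.log x) := Real.continuous_mul_log.neg
  have hTB : ∀ n, T (B n) = ((Real.negMulLog (p n) : ℝ) : ℂ) • B n := by
    intro n
    rw [hT, cfc_apply_eigenvector hρ (hB n) hcont, Real.negMulLog]
    congr 2
    ring
  have hTs : IsSelfAdjoint T := cfc_predicate _ _
  have hdiag : ∀ x : H, ENNReal.ofReal (RCLike.re ⟪x, T x⟫_ℂ) =
      ∑' n, ENNReal.ofReal (Real.negMulLog (p n)) * ENNReal.ofReal (‖⟪x, B n⟫_ℂ‖ ^ 2) := by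
    intro x
    have h2 := (B.hasSum_inner_mul_inner x (T x)).mapL RCLike.reCLM
    simp only [RCLike.reCLM_apply] at h2
    have h3 : ∀ n, RCLike.re (⟪x, B n⟫_ℂ * ⟪B n, T x⟫_ℂ) =
        Real.negMulLog (p n) * ‖⟪x, B n⟫_ℂ‖ ^ 2 := by
      intro n
      have h4 : ⟪B n, T x⟫_ℂ = ⟪T (B n), x⟫_ℂ := by
        rw [← ContinuousLinearMap.adjoint_inner_left, hTs.adjoint_eq]
      rw [h4, hTB, inner_smul_left, Complex.conj_ofReal, mul_left_comm, ← inner_conj_symm (B n) x,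
        RCLike.mul_conj]
      change (((Real.negMulLog (p n) : ℝ) : ℂ) * ((‖⟪x, B n⟫_ℂ‖ : ℝ) : ℂ) ^ 2).re = _
      rw [← Complex.ofReal_pow, ← Complex.ofReal_mul, Complex.ofReal_re]
    simp_rw [h3] at h2
    rw [← h2.tsum_eq, ENNReal.ofReal_tsum_of_nonneg _ h2.summable]
    · exact tsum_congr fun n => ENNReal.ofReal_mul (Real.negMulLog_nonneg (h0 n) (h1 n))
    · exact fun n => mul_nonneg (Real.negMulLog_nonneg (h0 n) (h1 n)) (sq_nonneg _)
  simp only [entropy]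
  simp_rw [← hT, hdiag]
  rw [ENNReal.tsum_comm]
  refine tsum_congr fun n => ?_
  have h5 := HilbertBasis.hasSum_norm_inner_sq' (onb H) (B n)
  rw [ENNReal.tsum_mul_left, ← ENNReal.ofReal_tsum_of_nonneg (fun _ => sq_nonneg _) h5.summable,
    h5.tsum_eq, B.orthonormal.1 n]
  simp

end Entropy

/-! ### The entropy of a Gaussian state -/

section GaussianEntropy

/-- The entropy of a thermal state of one mode whose covariance matrix is `x` times the identity.
At `x = 1`, the vacuum, the second term vanishes, because `0 * log 0 = 0`. -/
noncomputable def modeEntropy (x : ℝ) : ℝ :=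
  (x + 1) / 2 * Real.log ((x + 1) / 2) - (x - 1) / 2 * Real.log ((x - 1) / 2)

/-- The Shannon entropy of the geometric distribution with ratio `(x - 1) / (x + 1)`. -/
theorem hasSum_negMulLog_geometric {x : ℝ} (hx : 1 ≤ x) :
    HasSum (fun k : ℕ => Real.negMulLog (2 / (x + 1) * ((x - 1) / (x + 1)) ^ k))
      (modeEntropy x) := by
  have hx1 : 0 < x + 1 := by linarith
  set q : ℝ := (x - 1) / (x + 1) with hq
  have hq0 : 0 ≤ q := div_nonneg (by linarith) hx1.le
  have hq1 : q < 1 := by rw [hq, div_lt_one hx1]; linarith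
  have h1q : 1 - q = 2 / (x + 1) := by rw [hq]; field_simp; ring
  have h1 := (hasSum_geometric_of_lt_one hq0 hq1).mul_right (Real.negMulLog (2 / (x + 1)))
  have h2 := (hasSum_coe_mul_geometric_of_norm_lt_one (𝕜 := ℝ) (r := q)
    (by rwa [Real.norm_of_nonneg hq0])).mul_left (2 / (x + 1) * -Real.log q)
  convert! h1.add h2 using 1
  · funext k
    rw [Real.negMulLog_mul]
    congr 1
    rw [Real.negMulLog, Real.log_pow]
    ring
  · rw [h1q, modeEntropy, Real.negMulLog, inv_div]
    rcases hx.eq_or_lt with rfl | hx2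
    · norm_num [hq]
    · have e : x - 1 ≠ 0 := by linarith
      rw [hq, Real.log_div e hx1.ne', Real.log_div hx1.ne' two_ne_zero,
        Real.log_div e two_ne_zero, show (2 / (x + 1)) = ((x+1)/2)⁻¹ by rw [inv_div],
        Real.log_inv, Real.log_div hx1.ne' two_ne_zero]
      field_simp
      ring

theorem hasSum_geometric_distribution {x : ℝ} (hx : 1 ≤ x) :
    HasSum (fun k : ℕ => 2 / (x + 1) * ((x - 1) / (x + 1)) ^ k) 1 := by
  have hx1 : 0 < x + 1 := by linarith
  have h := (hasSum_geometric_of_lt_one (r := (x - 1) / (x + 1)) (div_nonneg (by linarith) hx1.le)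
    (by rw [div_lt_one hx1]; linarith)).mul_left (2 / (x + 1))
  convert! h using 1
  have : 1 - (x - 1) / (x + 1) = 2 / (x + 1) := by field_simp; ring
  rw [this, mul_inv_cancel₀ (by positivity)]

/-- The product rule for `-x log x`; it holds also if some factors vanish. -/
theorem negMulLog_prod {ι : Type*} [DecidableEq ι] (s : Finset ι) (a : ι → ℝ) :
    Real.negMulLog (∏ j ∈ s, a j) =
      ∑ l ∈ s, ∏ j ∈ s, if j = l then Real.negMulLog (a j) else a j := by
  induction s using Finset.induction_on with
  | empty => simp
  | insert i s hi ih =>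
    rw [Finset.prod_insert hi, Real.negMulLog_mul, ih, Finset.sum_insert hi, Finset.prod_insert hi,
      if_pos rfl, Finset.mul_sum]
    congr 1
    · rw [mul_comm]
      congr 1
      exact Finset.prod_congr rfl fun j hj => (if_neg (by rintro rfl; exact hi hj)).symm
    · refine Finset.sum_congr rfl fun l hl => ?_
      rw [Finset.prod_insert hi, if_neg (by rintro rfl; exact hi hl)]

variable {ι : Type} [Fintype ι] [DecidableEq ι]

/-- The Shannon entropy of a product of geometric distributions is the sum of their entropies. -/
theorem hasSum_negMulLog_prod_geometric {lam : ι → ℝ} (hlam : ∀ j, 1 ≤ lam j) :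
    HasSum (fun n : ι → ℕ =>
      Real.negMulLog (∏ j, 2 / (lam j + 1) * ((lam j - 1) / (lam j + 1)) ^ n j))
      (∑ l, modeEntropy (lam l)) := by
  simp_rw [negMulLog_prod]
  refine hasSum_sum fun l _ => ?_
  have h := (hasSum_multiIndex_prod (ι := ι) (f := fun j k => if j = l then
    Real.negMulLog (2 / (lam j + 1) * ((lam j - 1) / (lam j + 1)) ^ k) else
      2 / (lam j + 1) * ((lam j - 1) / (lam j + 1)) ^ k) fun j => ?_).2
  · convert! h using 1
    rw [Finset.prod_eq_single l]
    · simp only [if_true]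
      exact (hasSum_negMulLog_geometric (hlam l)).tsum_eq.symm
    · intro j _ hj
      simp only [if_neg hj]
      exact (hasSum_geometric_distribution (hlam j)).tsum_eq
    · simp
  · split_ifs with hj
    · exact (hasSum_negMulLog_geometric (hlam j)).summable.norm
    · exact (hasSum_geometric_distribution (hlam j)).summable.norm

/-- The symplectic eigenvalues of the covariance matrix of a Gaussian state are at least one, and
they determine its entropy. -/
theorem IsGaussianState.entropy_eq {ρ : ModeOp ι}
    {M S : Matrix (PhaseIdx ι) (PhaseIdx ι) ℝ} {d : PhaseIdx ι → ℝ} (hρ : IsGaussianState ρ M d)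
    (hS : IsSymplectic S) {lam : ι → ℝ} (hSM : S * M * Sᵀ = doubledDiagonal lam) :
    (∀ l, 1 ≤ lam l) ∧ entropy ρ = ENNReal.ofReal (∑ l, modeEntropy (lam l)) := by
  have hV := isWeylSystem_transformedWeyl hS d
  have hχ := hρ.trace_transformedWeyl hSM
  have hd := hρ.isDensityOperator
  -- a characteristic function is bounded by one
  have hlam0 : ∀ l, 0 ≤ lam l := by
    intro l
    have h := hd.norm_trace_le_one (hV.norm_apply (Pi.single (l, 0) 1))
    rw [hχ, Finset.sum_eq_single l, Complex.norm_exp] at h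
    · simpa using h
    · intro j _ hj
      simp [hj]
    · simp
  obtain ⟨B, hB⟩ := hV.gaussian_spectrum hd hlam0 hχ
  -- the eigenvalue belonging to a single excitation of the mode `l` is nonnegative
  have hlam1 : ∀ l, 1 ≤ lam l := by
    intro l
    have h := hd.isPositive.inner_nonneg_right (B (Pi.single l 1))
    rw [hB, inner_smul_right, inner_self_eq_norm_sq_to_K, B.orthonormal.1] at h
    have h1 : 0 ≤ ∏ j, 2 / (lam j + 1) * ((lam j - 1) / (lam j + 1)) ^
        (Pi.single l 1 : ι → ℕ) j := by
      rw [← Complex.zero_le_real]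
      simpa using h
    rw [Finset.prod_mul_distrib, Finset.prod_eq_single (f := fun j => _ ^ _) l] at h1
    · simp only [Pi.single_eq_same, pow_one] at h1
      have h2 : 0 < ∏ j, 2 / (lam j + 1) :=
        Finset.prod_pos fun j _ => div_pos two_pos (by linarith [hlam0 j])
      have h3 := nonneg_of_mul_nonneg_right h1 h2
      rw [div_nonneg_iff] at h3
      rcases h3 with h3 | h3 <;> linarith [hlam0 l]
    · intro j _ hj
      simp [hj]
    · simp
  refine ⟨hlam1, ?_⟩
  have hp0 : ∀ n : ι → ℕ, 0 ≤ ∏ j, 2 / (lam j + 1) * ((lam j - 1) / (lam j + 1)) ^ n j := by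
    intro n
    refine Finset.prod_nonneg fun j _ => ?_
    have := hlam1 j
    exact mul_nonneg (div_nonneg two_pos.le (by linarith))
      (pow_nonneg (div_nonneg (by linarith) (by linarith)) _)
  have hp1 : ∀ n : ι → ℕ, ∏ j, 2 / (lam j + 1) * ((lam j - 1) / (lam j + 1)) ^ n j ≤ 1 := by
    intro n
    refine Finset.prod_le_one (fun j _ => ?_) fun j _ => ?_ <;> have := hlam1 j
    · exact mul_nonneg (div_nonneg two_pos.le (by linarith))
        (pow_nonneg (div_nonneg (by linarith) (by linarith)) _)
    · refine mul_le_one₀ ?_ (pow_nonneg (div_nonneg (by linarith) (by linarith)) _)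
        (pow_le_one₀ (div_nonneg (by linarith) (by linarith)) ?_)
      · rw [div_le_one (by linarith)]; linarith
      · rw [div_le_one (by linarith)]; linarith
  rw [entropy_eq_tsum hd.isPositive.isSelfAdjoint B hp0 hp1 hB]
  have h := hasSum_negMulLog_prod_geometric hlam1
  rw [← h.tsum_eq, ENNReal.ofReal_tsum_of_nonneg
    (fun n => Real.negMulLog_nonneg (hp0 n) (hp1 n)) h.summable]

end GaussianEntropy

end BosonicModes

namespace BosonicModes

/-! ### The normal form of a skew-symmetric operator -/

section SkewNormalForm

variable {E : Type*} [NormedAddCommGroup E] [InnerProductSpace ℝ E] [FiniteDimensional ℝ E]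

/-- An invariant subspace of an invertible skew-symmetric operator contains an invariant plane: it
is spanned by an eigenvector `e` of `-K²` and by `K e`. -/
theorem exists_skew_invariant_plane {K : E →ₗ[ℝ] E} (hK : ∀ x y, ⟪K x, y⟫_ℝ = -⟪x, K y⟫_ℝ)
    (hinj : ∀ x, K x = 0 → x = 0) {W : Submodule ℝ E} (hW : ∀ x ∈ W, K x ∈ W) (hne : W ≠ ⊥) :
    ∃ e ∈ W, ∃ f ∈ W, ∃ μ : ℝ, 0 < μ ∧ ⟪e, e⟫_ℝ = 1 ∧ ⟪f, f⟫_ℝ = 1 ∧ ⟪e, f⟫_ℝ = 0 ∧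
      K e = (-μ) • f ∧ K f = μ • e := by
  have hnt : Nontrivial W := Submodule.nontrivial_iff_ne_bot.2 hne
  set T : W →ₗ[ℝ] W := -(K.restrict hW ∘ₗ K.restrict hW) with hT
  have hTc : ∀ x : W, ((T x : W) : E) = -K (K x) := fun x => by simp [hT]
  have hsym : T.IsSymmetric := by
    intro x y
    simp only [Submodule.coe_inner, hTc, inner_neg_left, inner_neg_right, hK, neg_neg]
  obtain ⟨w, hw⟩ := hsym.hasEigenvalue_iSup_of_finiteDimensional.exists_hasEigenvector
  set c : ℝ := ⨆ x : { x : W // x ≠ 0 }, RCLike.re ⟪T x, x⟫_ℝ / ‖(x : W)‖ ^ 2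
  have hw1 : -K (K w) = c • (w : E) := by
    rw [← hTc, hw.apply_eq_smul]
    rfl
  have hw0 : (w : E) ≠ 0 := by simpa using hw.2
  have hKw : K (w : E) ≠ 0 := fun h => hw0 (hinj _ h)
  have hc : c * ‖(w : E)‖ ^ 2 = ‖K (w : E)‖ ^ 2 := by
    rw [← real_inner_self_eq_norm_sq, ← real_inner_self_eq_norm_sq, hK, ← inner_neg_right, hw1,
      inner_smul_right]
  have hw2 : 0 < ‖(w : E)‖ := norm_pos_iff.2 hw0
  have hKw2 : 0 < ‖K (w : E)‖ := norm_pos_iff.2 hKw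
  set a := ‖(w : E)‖
  set b := ‖K (w : E)‖
  have haa : ⟪(w : E), w⟫_ℝ = a ^ 2 := real_inner_self_eq_norm_sq _
  have hbb : ⟪K (w : E), K w⟫_ℝ = b ^ 2 := real_inner_self_eq_norm_sq _
  have hab : ⟪(w : E), K w⟫_ℝ = 0 := by
    have := hK w w
    rw [real_inner_comm] at this
    linarith
  refine ⟨a⁻¹ • (w : E), W.smul_mem _ w.2, (-b⁻¹) • K (w : E), W.smul_mem _ (hW _ w.2), b / a,
    by positivity, ?_, ?_, ?_, ?_, ?_⟩
  · rw [real_inner_smul_left, real_inner_smul_right, haa]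
    field_simp
  · rw [real_inner_smul_left, real_inner_smul_right, hbb]
    field_simp
  · rw [real_inner_smul_left, real_inner_smul_right, hab]
    simp
  · rw [map_smul, smul_smul]
    congr 1
    field_simp
  · rw [map_smul, neg_smul, ← smul_neg, hw1, smul_smul, smul_smul]
    congr 1
    field_simp
    linarith

/-- An invertible skew-symmetric operator is, in a suitable orthonormal basis, a direct sum of
rotations by a quarter turn, scaled by positive numbers. -/
theorem exists_skew_normal_form {ι : Type*} [Fintype ι] [DecidableEq ι] {K : E →ₗ[ℝ] E}
    (hK : ∀ x y, ⟪K x, y⟫_ℝ = -⟪x, K y⟫_ℝ) (hinj : ∀ x, K x = 0 → x = 0)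
    (hdim : Module.finrank ℝ E = 2 * Fintype.card ι) :
    ∃ (v : ι × Fin 2 → E) (μ : ι → ℝ), (∀ l, 0 < μ l) ∧
      (∀ p q, ⟪v p, v q⟫_ℝ = if p = q then 1 else 0) ∧
      ∀ l, K (v (l, 0)) = (-μ l) • v (l, 1) ∧ K (v (l, 1)) = μ l • v (l, 0) := by
  classical
  -- the basis is extended plane by plane
  suffices h : ∀ s : Finset ι, ∃ (v : ι × Fin 2 → E) (μ : ι → ℝ), (∀ l, 0 < μ l) ∧
      (∀ p q, p.1 ∈ s → q.1 ∈ s → ⟪v p, v q⟫_ℝ = if p = q then 1 else 0) ∧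
      ∀ l ∈ s, K (v (l, 0)) = (-μ l) • v (l, 1) ∧ K (v (l, 1)) = μ l • v (l, 0) by
    obtain ⟨v, μ, h1, h2, h3⟩ := h Finset.univ
    exact ⟨v, μ, h1, fun p q => h2 p q (Finset.mem_univ _) (Finset.mem_univ _),
      fun l => h3 l (Finset.mem_univ _)⟩
  intro s
  induction s using Finset.induction_on with
  | empty => exact ⟨0, 1, by simp, by simp, by simp⟩
  | insert i s hi ih =>
    obtain ⟨v, μ, h1, h2, h3⟩ := ih
    set F : Finset E := (s ×ˢ (Finset.univ : Finset (Fin 2))).image v with hF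
    set W : Submodule ℝ E := (Submodule.span ℝ (F : Set E))ᗮ with hWdef
    have hmem : ∀ x, x ∈ W ↔ ∀ p : ι × Fin 2, p.1 ∈ s → ⟪v p, x⟫_ℝ = 0 := by
      intro x
      rw [hWdef, Submodule.mem_orthogonal]
      constructor
      · intro h p hp
        exact h _ (Submodule.subset_span (by
          simp only [hF, Finset.coe_image, Set.mem_image]
          exact ⟨p, by simp [hp], rfl⟩))
      · intro h u hu
        induction hu using Submodule.span_induction with
        | mem u hu =>
          simp only [hF, Finset.coe_image, Set.mem_image] at hu
          obtain ⟨p, hp, rfl⟩ := hu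
          exact h p (by simpa using hp)
        | zero => simp
        | add u w _ _ hu hw => rw [inner_add_left, hu, hw, add_zero]
        | smul c u _ hu => rw [inner_smul_left, hu, mul_zero]
    have hW : ∀ x ∈ W, K x ∈ W := by
      intro x hx
      rw [hmem] at hx ⊢
      rintro ⟨l, a⟩ hl
      have h4 := h3 l hl
      have h5 : ⟪v (l, a), K x⟫_ℝ = -⟪K (v (l, a)), x⟫_ℝ := by rw [hK, neg_neg]
      rw [h5]
      fin_cases a
      · simp only [Fin.zero_eta, h4.1, inner_smul_left, hx (l, 1) hl, mul_zero, neg_zero]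
      · simp only [Fin.mk_one, h4.2, inner_smul_left, hx (l, 0) hl, mul_zero, neg_zero]
    have hne : W ≠ ⊥ := by
      intro h
      rw [hWdef, Submodule.orthogonal_eq_bot_iff] at h
      have h6 : (F : Set E).finrank ℝ ≤ F.card := finrank_span_finset_le_card F
      rw [Set.finrank, h, finrank_top, hdim] at h6
      have h7 : F.card ≤ s.card * 2 := by
        refine Finset.card_image_le.trans ?_
        simp
      have h8 : s.card < Fintype.card ι := Finset.card_lt_univ_of_notMem hi
      omega
    obtain ⟨e, he, f, hf, m, hm, hee, hff, hef, hKe, hKf⟩ :=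
      exists_skew_invariant_plane hK hinj hW hne
    rw [hmem] at he hf
    have hfe : ⟪f, e⟫_ℝ = 0 := by rw [real_inner_comm, hef]
    refine ⟨fun p => if p.1 = i then (if p.2 = 0 then e else f) else v p,
      Function.update μ i m, ?_, ?_, ?_⟩
    · intro l
      by_cases hl : l = i
      · subst hl; simpa using hm
      · simpa [hl] using h1 l
    · rintro ⟨k, a⟩ ⟨l, b⟩ hk hl
      simp only at hk hl
      rw [Finset.mem_insert] at hk hl
      dsimp only
      by_cases hki : k = i <;> by_cases hli : l = i
      · subst hki
        subst hli
        fin_cases a <;> fin_cases b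
        · simpa using hee
        · simpa using hef
        · simpa using hfe
        · simpa using hff
      · have hkl : k ≠ l := fun h => hli (h ▸ hki)
        have key : ⟪v (l, b), if a = 0 then e else f⟫_ℝ = 0 := by
          split_ifs
          · exact he _ (hl.resolve_left hli)
          · exact hf _ (hl.resolve_left hli)
        rw [if_pos hki, if_neg hli, real_inner_comm, key,
          if_neg fun h => hkl (congrArg Prod.fst h)]
      · have hkl : k ≠ l := fun h => hki (h ▸ hli)
        have key : ⟪v (k, a), if b = 0 then e else f⟫_ℝ = 0 := by
          split_ifs
          · exact he _ (hk.resolve_left hki)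
          · exact hf _ (hk.resolve_left hki)
        rw [if_neg hki, if_pos hli, key, if_neg fun h => hkl (congrArg Prod.fst h)]
      · simp only [hki, hli, if_false]
        exact h2 _ _ (hk.resolve_left hki) (hl.resolve_left hli)
    · intro l hl
      rw [Finset.mem_insert] at hl
      by_cases hli : l = i
      · subst hli
        simp [hKe, hKf]
      · simp only [hli, if_false, Function.update_of_ne, ne_eq, not_false_eq_true]
        exact h3 l (hl.resolve_left hli)

end SkewNormalForm

/-! ### Williamson's theorem -/

section Williamson

variable {ι : Type} [Fintype ι] [DecidableEq ι]

theorem doubledDiagonal_mul_sympForm (a : ι → ℝ) :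
    doubledDiagonal a * sympForm ι = sympForm ι * doubledDiagonal a := by
  ext ⟨i, x⟩ ⟨j, y⟩
  simp only [doubledDiagonal, Matrix.diagonal_mul, Matrix.mul_diagonal, sympForm,
    Matrix.kroneckerMap_apply, Matrix.one_apply]
  by_cases h : i = j
  · subst h; ring
  · simp [h]

theorem doubledDiagonal_mul (a b : ι → ℝ) :
    doubledDiagonal a * doubledDiagonal b = doubledDiagonal fun l => a l * b l := by
  simp [doubledDiagonal, Matrix.diagonal_mul_diagonal]

omit [Fintype ι] in
theorem doubledDiagonal_one : doubledDiagonal (fun _ : ι => (1 : ℝ)) = 1 := by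
  simp [doubledDiagonal]

omit [Fintype ι] in
theorem doubledDiagonal_transpose (a : ι → ℝ) : (doubledDiagonal a)ᵀ = doubledDiagonal a := by
  simp [doubledDiagonal]

open scoped MatrixOrder in
/-- **Williamson's theorem**: a positive definite matrix is brought to diagonal form by a symplectic
matrix. If `M = Lᵀ L` and the orthogonal matrix `O` brings the skew-symmetric matrix `L⁻ᵀ J L⁻¹` to
the normal form `D(μ) J`, then `D(μ)^(-1/2) O L⁻ᵀ` does it. -/
theorem exists_symplectic_diagonalization {M : Matrix (PhaseIdx ι) (PhaseIdx ι) ℝ}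
    (hM : M.PosDef) :
    ∃ (S : Matrix (PhaseIdx ι) (PhaseIdx ι) ℝ) (lam : ι → ℝ), IsSymplectic S ∧
      S * M * Sᵀ = doubledDiagonal lam := by
  obtain ⟨L, hL⟩ : ∃ L : Matrix (PhaseIdx ι) (PhaseIdx ι) ℝ, M = Lᵀ * L := by
    obtain ⟨L, hL⟩ := CStarAlgebra.nonneg_iff_eq_star_mul_self.1 hM.posSemidef.nonneg
    exact ⟨L, hL⟩
  have hLu : IsUnit L := by
    have h := hM.isUnit
    rw [hL, Matrix.isUnit_iff_isUnit_det, Matrix.det_mul] at h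
    rw [Matrix.isUnit_iff_isUnit_det]
    exact isUnit_of_mul_isUnit_right h
  have hL1 : L * L⁻¹ = 1 := Matrix.mul_nonsing_inv _ ((Matrix.isUnit_iff_isUnit_det _).1 hLu)
  have hL2 : L⁻¹ * L = 1 := Matrix.nonsing_inv_mul _ ((Matrix.isUnit_iff_isUnit_det _).1 hLu)
  have hL3 : L⁻¹ᵀ * Lᵀ = 1 := by rw [← Matrix.transpose_mul, hL1, Matrix.transpose_one]
  have hL4 : Lᵀ * L⁻¹ᵀ = 1 := by rw [← Matrix.transpose_mul, hL2, Matrix.transpose_one]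
  set A : Matrix (PhaseIdx ι) (PhaseIdx ι) ℝ := L⁻¹ᵀ * sympForm ι * L⁻¹ with hA
  have hAt : Aᵀ = -A := by
    rw [hA, Matrix.transpose_mul, Matrix.transpose_mul, Matrix.transpose_transpose,
      sympForm_transpose]
    simp [mul_assoc]
  have hAinv : (L * (-sympForm ι) * Lᵀ) * A = 1 := by
    rw [hA]
    calc L * -sympForm ι * Lᵀ * (L⁻¹ᵀ * sympForm ι * L⁻¹)
        = L * -sympForm ι * (Lᵀ * L⁻¹ᵀ) * sympForm ι * L⁻¹ := by simp only [mul_assoc]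
      _ = 1 := by
        rw [hL4, mul_one, mul_assoc L, neg_mul, sympForm_mul_self, neg_neg, mul_one, hL1]
  set K : EuclideanSpace ℝ (PhaseIdx ι) →ₗ[ℝ] EuclideanSpace ℝ (PhaseIdx ι) :=
    Matrix.toEuclideanLin A with hKdef
  have hKx : ∀ x, (K x).ofLp = A *ᵥ x.ofLp := fun x => rfl
  have hin : ∀ x y : EuclideanSpace ℝ (PhaseIdx ι), ⟪x, y⟫_ℝ = x.ofLp ⬝ᵥ y.ofLp := by
    intro x y
    rw [EuclideanSpace.inner_eq_star_dotProduct, dotProduct_comm]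
    rfl
  obtain ⟨v, μ, hμ, hv, hKv⟩ := exists_skew_normal_form (ι := ι) (K := K)
    (by
      intro x y
      rw [hin, hin, hKx, hKx, Matrix.dotProduct_mulVec, ← Matrix.mulVec_transpose, hAt,
        Matrix.neg_mulVec, neg_dotProduct, neg_neg])
    (by
      intro x hx
      have h : A *ᵥ x.ofLp = 0 := by rw [← hKx, hx]; rfl
      have h2 : x.ofLp = 0 := by
        rw [← Matrix.one_mulVec x.ofLp, ← hAinv, ← Matrix.mulVec_mulVec, h, Matrix.mulVec_zero]
      ext i
      exact congrFun h2 i)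
    (by simp [mul_comm])
  set O : Matrix (PhaseIdx ι) (PhaseIdx ι) ℝ := Matrix.of fun p q => v p q with hO
  have hOO : O * Oᵀ = 1 := by
    ext p q
    rw [Matrix.one_apply, ← hv p q, hin]
    rfl
  have hOA : O * A * Oᵀ = doubledDiagonal μ * sympForm ι := by
    ext p q
    have h : (O * A * Oᵀ) p q = ⟪v p, K (v q)⟫_ℝ := by
      rw [hin, hKx, mul_assoc]
      rfl
    rw [h]
    obtain ⟨i, a⟩ := p
    obtain ⟨j, b⟩ := q
    have h1 := (hKv j).1
    have h2 := (hKv j).2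
    simp only [doubledDiagonal, Matrix.diagonal_mul, sympForm, Matrix.kroneckerMap_apply,
      Matrix.one_apply]
    fin_cases b
    · simp only [Fin.zero_eta, h1, inner_smul_right, hv, Prod.mk.injEq]
      by_cases hij : i = j
      · subst hij; fin_cases a <;> simp
      · simp [hij]
    · simp only [Fin.mk_one, h2, inner_smul_right, hv, Prod.mk.injEq]
      by_cases hij : i = j
      · subst hij; fin_cases a <;> simp
      · simp [hij]
  set D := doubledDiagonal fun l => Real.sqrt (μ l)⁻¹ with hD
  refine ⟨D * O * L⁻¹ᵀ, fun l => (μ l)⁻¹, ?_, ?_⟩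
  · have e : D * O * L⁻¹ᵀ * sympForm ι * (D * O * L⁻¹ᵀ)ᵀ = D * (O * A * Oᵀ) * D := by
      simp only [Matrix.transpose_mul, Matrix.transpose_transpose, hA, hD,
        doubledDiagonal_transpose, mul_assoc]
    rw [IsSymplectic, e, hOA, ← mul_assoc, mul_assoc, ← doubledDiagonal_mul_sympForm, ← mul_assoc,
      doubledDiagonal_mul, doubledDiagonal_mul]
    have : (fun l => Real.sqrt (μ l)⁻¹ * μ l * Real.sqrt (μ l)⁻¹) = fun _ => 1 := by
      funext l
      rw [mul_right_comm, Real.mul_self_sqrt (inv_nonneg.2 (hμ l).le), inv_mul_cancel₀ (hμ l).ne']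
    rw [this, doubledDiagonal_one, one_mul]
  · have e : D * O * L⁻¹ᵀ * M * (D * O * L⁻¹ᵀ)ᵀ =
        D * (O * ((L⁻¹ᵀ * Lᵀ) * (L * L⁻¹)) * Oᵀ) * D := by
      simp only [Matrix.transpose_mul, Matrix.transpose_transpose, hL, hD,
        doubledDiagonal_transpose, mul_assoc]
    rw [e, hL3, hL1, one_mul, mul_one, hOO, mul_one, doubledDiagonal_mul]
    congr 1
    funext l
    exact Real.mul_self_sqrt (inv_nonneg.2 (hμ l).le)

end Williamson

end BosonicModes

namespace BosonicModes

/-! ### Determinants along a ray of positive matrices -/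

section Determinants

open scoped MatrixOrder ComplexOrder in
/-- If `N` is positive definite and `P` positive semidefinite, then the determinant of `N + t P` is
`det N ∏ (1 + t κ_j)`, where the `κ_j` are the eigenvalues of `N^(-1/2) P N^(-1/2)`. -/
theorem exists_det_add_smul {n : Type*} [Fintype n] [DecidableEq n] {N P G : Matrix n n ℂ}
    (hN : N.PosDef) (hP : P.PosSemidef) (hG : N * G = 1) :
    ∃ κ : n → ℝ, (∀ j, 0 ≤ κ j) ∧ ((∑ j, κ j : ℝ) : ℂ) = (G * P).trace ∧
      ∀ t : ℝ, (N + (t : ℂ) • P).det = N.det * ∏ j, ((1 + t * κ j : ℝ) : ℂ) := by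
  obtain ⟨L, hL⟩ : ∃ L : Matrix n n ℂ, N = Lᴴ * L := by
    obtain ⟨L, hL⟩ := CStarAlgebra.nonneg_iff_eq_star_mul_self.1 hN.posSemidef.nonneg
    exact ⟨L, hL⟩
  have hLu : IsUnit L := by
    have h := hN.isUnit
    rw [hL, Matrix.isUnit_iff_isUnit_det, Matrix.det_mul] at h
    rw [Matrix.isUnit_iff_isUnit_det]
    exact isUnit_of_mul_isUnit_right h
  have hL1 : L * L⁻¹ = 1 := Matrix.mul_nonsing_inv _ ((Matrix.isUnit_iff_isUnit_det _).1 hLu)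
  have hL2 : L⁻¹ * L = 1 := Matrix.nonsing_inv_mul _ ((Matrix.isUnit_iff_isUnit_det _).1 hLu)
  have hL4 : Lᴴ * L⁻¹ᴴ = 1 := by
    rw [← Matrix.conjTranspose_mul, hL2, Matrix.conjTranspose_one]
  have hGL : G = L⁻¹ * L⁻¹ᴴ := by
    have h : (L⁻¹ * L⁻¹ᴴ) * N = 1 := by
      rw [mul_eq_one_comm, hL]
      calc Lᴴ * L * (L⁻¹ * L⁻¹ᴴ) = Lᴴ * (L * L⁻¹) * L⁻¹ᴴ := by simp only [mul_assoc]
        _ = 1 := by rw [hL1, mul_one, hL4]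
    exact (left_inv_eq_right_inv h hG).symm
  set Q : Matrix n n ℂ := L⁻¹ᴴ * P * L⁻¹ with hQdef
  have hQ : Q.PosSemidef := hP.conjTranspose_mul_mul_same L⁻¹
  refine ⟨hQ.1.eigenvalues, hQ.eigenvalues_nonneg, ?_, fun t => ?_⟩
  · rw [hGL, mul_assoc, Matrix.trace_mul_comm, ← hQdef, hQ.1.trace_eq_sum_eigenvalues]
    push_cast
    rfl
  · have h1 : N + (t : ℂ) • P = Lᴴ * (1 + (t : ℂ) • Q) * L := by
      have h2 : Lᴴ * Q * L = P := by
        calc Lᴴ * (L⁻¹ᴴ * P * L⁻¹) * L = (Lᴴ * L⁻¹ᴴ) * P * (L⁻¹ * L) := by simp only [mul_assoc]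
          _ = P := by rw [hL4, hL2, one_mul, mul_one]
      rw [mul_add, add_mul, mul_one, ← hL, mul_smul_comm, smul_mul_assoc, h2]
    set U : Matrix n n ℂ := (hQ.1.eigenvectorUnitary : Matrix n n ℂ) with hU
    set Λ : Matrix n n ℂ := Matrix.diagonal (RCLike.ofReal ∘ hQ.1.eigenvalues) with hΛ
    have hUU : U * star U = 1 := Unitary.coe_mul_star_self hQ.1.eigenvectorUnitary
    have h3 : Q = U * Λ * star U := by
      conv_lhs => rw [hQ.1.spectral_theorem, Unitary.conjStarAlgAut_apply]
    have h4 : 1 + (t : ℂ) • Q = U * (1 + (t : ℂ) • Λ) * star U := by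
      rw [mul_add, add_mul, mul_one, hUU, mul_smul_comm, smul_mul_assoc, ← h3]
    have h5 : (1 + (t : ℂ) • Λ).det = ∏ j, ((1 + t * hQ.1.eigenvalues j : ℝ) : ℂ) := by
      rw [← Matrix.diagonal_one, hΛ, ← Matrix.diagonal_smul, Matrix.diagonal_add,
        Matrix.det_diagonal]
      exact Finset.prod_congr rfl fun j _ => by simp
    have h6 : U.det * (star U).det = 1 := by rw [← Matrix.det_mul, hUU, Matrix.det_one]
    rw [h1, h4, Matrix.det_mul, Matrix.det_mul, Matrix.det_mul, Matrix.det_mul, h5, hL,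
      Matrix.det_mul]
    linear_combination (Lᴴ.det * L.det * ∏ j, ((1 + t * hQ.1.eigenvalues j : ℝ) : ℂ)) * h6

end Determinants

/-! ### The matrices `M + i s J` -/

section ComplexCovariance

variable {ι : Type} [Fintype ι] [DecidableEq ι]

/-- The complex matrix `M + i s J`. For a covariance matrix `M` it is positive semidefinite if
`|s| ≤ 1`, by the uncertainty relation. -/
noncomputable def complexCov (M : Matrix (PhaseIdx ι) (PhaseIdx ι) ℝ) (s : ℝ) :
    Matrix (PhaseIdx ι) (PhaseIdx ι) ℂ :=
  M.map (algebraMap ℝ ℂ) + (Complex.I * s) • (sympForm ι).map (algebraMap ℝ ℂ)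

theorem IsSymplectic.det_mul_self {S : Matrix (PhaseIdx ι) (PhaseIdx ι) ℝ} (hS : IsSymplectic S) :
    S.det * S.det = 1 := by
  have h := congrArg Matrix.det (show S * sympForm ι * Sᵀ = sympForm ι from hS)
  have hJ : (sympForm ι).det ≠ 0 := by
    intro h0
    have h1 := congrArg Matrix.det (sympForm_mul_self (ι := ι))
    rw [Matrix.det_mul, h0, zero_mul, Matrix.det_neg, Matrix.det_one, mul_one] at h1
    exact pow_ne_zero _ (by norm_num) h1.symm
  rw [Matrix.det_mul, Matrix.det_mul, Matrix.det_transpose] at h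
  have h2 : (S.det * S.det - 1) * (sympForm ι).det = 0 := by linarith
  linarith [(mul_eq_zero.1 h2).resolve_right hJ]

/-- `M + i s J` transforms like `M` under symplectic matrices. -/
theorem complexCov_congr {M N S : Matrix (PhaseIdx ι) (PhaseIdx ι) ℝ} (hS : IsSymplectic S)
    (h : S * M * Sᵀ = N) (s : ℝ) :
    S.map (algebraMap ℝ ℂ) * complexCov M s * (S.map (algebraMap ℝ ℂ))ᵀ = complexCov N s := by
  rw [complexCov, mul_add, add_mul, mul_smul_comm, smul_mul_assoc, ← Matrix.transpose_map,
    ← Matrix.map_mul, ← Matrix.map_mul, ← Matrix.map_mul, ← Matrix.map_mul, h,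
    show S * sympForm ι * Sᵀ = sympForm ι from hS, complexCov]

theorem det_complexCov_congr {M N S : Matrix (PhaseIdx ι) (PhaseIdx ι) ℝ} (hS : IsSymplectic S)
    (h : S * M * Sᵀ = N) (s : ℝ) : (complexCov M s).det = (complexCov N s).det := by
  rw [← complexCov_congr hS h, Matrix.det_mul, Matrix.det_mul, Matrix.det_transpose]
  have h1 : (S.map (algebraMap ℝ ℂ)).det = ((S.det : ℝ) : ℂ) := by
    have := (RingHom.map_det (algebraMap ℝ ℂ) S).symm
    exact this
  have h2 : ((S.det : ℝ) : ℂ) * ((S.det : ℝ) : ℂ) = 1 := by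
    rw [← Complex.ofReal_mul, hS.det_mul_self, Complex.ofReal_one]
  rw [h1]
  linear_combination (-(complexCov M s).det) * h2

theorem det_complexCov_doubledDiagonal (lam : ι → ℝ) (s : ℝ) :
    (complexCov (doubledDiagonal lam) s).det = ((∏ l, (lam l ^ 2 - s ^ 2) : ℝ) : ℂ) := by
  have h : complexCov (doubledDiagonal lam) s =
      (Matrix.blockDiagonal fun l : ι => (!![(lam l : ℂ), Complex.I * s; -(Complex.I * s), lam l] :
        Matrix (Fin 2) (Fin 2) ℂ)).submatrix (Equiv.prodComm ι (Fin 2))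
        (Equiv.prodComm ι (Fin 2)) := by
    ext ⟨i, a⟩ ⟨j, b⟩
    by_cases hij : i = j
    · subst hij
      fin_cases a <;> fin_cases b <;>
        simp [complexCov, doubledDiagonal, sympForm, Matrix.blockDiagonal_apply, Matrix.diagonal]
    · simp [complexCov, doubledDiagonal, sympForm, Matrix.blockDiagonal_apply, Matrix.diagonal, hij]
  rw [h, Matrix.det_submatrix_equiv_self, Matrix.det_blockDiagonal]
  push_cast
  refine Finset.prod_congr rfl fun l _ => ?_
  rw [Matrix.det_fin_two_of]
  linear_combination ((s : ℂ) ^ 2) * Complex.I_sq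

open scoped ComplexOrder in
theorem posDef_complexCov_doubledDiagonal {lam : ι → ℝ} (hlam : ∀ l, 1 ≤ lam l) {s : ℝ}
    (hs0 : 0 ≤ s) (hs1 : s < 1) : (complexCov (doubledDiagonal lam) s).PosDef := by
  set J : Matrix (PhaseIdx ι) (PhaseIdx ι) ℂ := (sympForm ι).map (algebraMap ℝ ℂ) with hJ
  have hJJ : J * J = -1 := by
    rw [hJ, ← Matrix.map_mul, sympForm_mul_self]
    ext i j
    simp [Matrix.one_apply, apply_ite]
  have hJt : Jᴴ = -J := by
    ext i j
    have h := congrFun (congrFun (sympForm_transpose (ι := ι)) i) j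
    simp only [Matrix.transpose_apply, Matrix.neg_apply] at h
    simp [hJ, Matrix.conjTranspose_apply, h]
  -- `1 + i J` is twice a projection
  set E : Matrix (PhaseIdx ι) (PhaseIdx ι) ℂ := 1 + Complex.I • J with hE
  have hEt : Eᴴ = E := by
    rw [hE, Matrix.conjTranspose_add, Matrix.conjTranspose_one, Matrix.conjTranspose_smul, hJt]
    simp
  have hEE : E * E = (2 : ℂ) • E := by
    rw [hE, add_mul, mul_add, mul_add, one_mul, mul_one, smul_mul_smul_comm, hJJ, Complex.I_mul_I,
      one_mul, two_smul]
    simp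
    abel
  have h1 : (Eᴴ * E).PosSemidef := Matrix.posSemidef_conjTranspose_mul_self E
  have h2 : (((s / 2 : ℝ) : ℂ) • (Eᴴ * E)).PosSemidef :=
    h1.smul (by rw [Complex.zero_le_real]; positivity)
  have h3 : (Matrix.diagonal fun p : PhaseIdx ι => ((lam p.1 - s : ℝ) : ℂ)).PosDef := by
    rw [Matrix.posDef_diagonal_iff]
    intro p
    rw [Complex.zero_lt_real]
    linarith [hlam p.1]
  have h4 : complexCov (doubledDiagonal lam) s =
      (Matrix.diagonal fun p : PhaseIdx ι => ((lam p.1 - s : ℝ) : ℂ)) +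
        ((s / 2 : ℝ) : ℂ) • (Eᴴ * E) := by
    rw [hEt, hEE, smul_smul, hE, complexCov, ← hJ]
    ext p q
    by_cases hpq : p = q
    · subst hpq
      simp [doubledDiagonal]
      ring
    · simp [doubledDiagonal, hpq]
      ring
  rw [h4]
  exact h3.add_posSemidef h2

/-- The inverse of `D(λ) + i s J`. -/
theorem complexCov_doubledDiagonal_mul_inverse {lam : ι → ℝ} (hlam : ∀ l, 1 ≤ lam l) {s : ℝ}
    (hs0 : 0 ≤ s) (hs1 : s < 1) :
    complexCov (doubledDiagonal lam) s *
      ((doubledDiagonal fun l => lam l / (lam l ^ 2 - s ^ 2)).map (algebraMap ℝ ℂ) -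
        Complex.I • (doubledDiagonal (fun l => s / (lam l ^ 2 - s ^ 2)) * sympForm ι).map
          (algebraMap ℝ ℂ)) = 1 := by
  have hne : ∀ l, lam l ^ 2 - s ^ 2 ≠ 0 := fun l => by nlinarith [hlam l]
  have e1 : doubledDiagonal lam * doubledDiagonal (fun l => lam l / (lam l ^ 2 - s ^ 2)) -
      s • doubledDiagonal (fun l => s / (lam l ^ 2 - s ^ 2)) = 1 := by
    ext p q
    by_cases hpq : p = q
    · subst hpq
      have := hne p.1
      simp [doubledDiagonal]
      field_simp
    · simp [doubledDiagonal, hpq]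
  have e2 : doubledDiagonal lam * doubledDiagonal (fun l => s / (lam l ^ 2 - s ^ 2)) =
      s • doubledDiagonal (fun l => lam l / (lam l ^ 2 - s ^ 2)) := by
    ext p q
    by_cases hpq : p = q
    · subst hpq
      have := hne p.1
      simp [doubledDiagonal]
      field_simp
    · simp [doubledDiagonal, hpq]
  set A := doubledDiagonal fun l => lam l / (lam l ^ 2 - s ^ 2) with hA
  set B := doubledDiagonal fun l => s / (lam l ^ 2 - s ^ 2) with hB
  set D := doubledDiagonal lam
  have hJBJ : sympForm ι * (B * sympForm ι) = -B := by
    rw [hB, doubledDiagonal_mul_sympForm, ← mul_assoc, sympForm_mul_self, neg_mul, one_mul]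
  have hJA : sympForm ι * A = A * sympForm ι := (doubledDiagonal_mul_sympForm _).symm
  have hDBJ : D * (B * sympForm ι) = s • (A * sympForm ι) := by
    rw [← mul_assoc, e2, smul_mul_assoc]
  have key : ∀ X : Matrix (PhaseIdx ι) (PhaseIdx ι) ℝ,
      (s • X).map (algebraMap ℝ ℂ) = (s : ℂ) • X.map (algebraMap ℝ ℂ) := by
    intro X
    ext p q
    simp
  have e1' : D.map (algebraMap ℝ ℂ) * A.map (algebraMap ℝ ℂ) - (s : ℂ) • B.map (algebraMap ℝ ℂ) =
      1 := by
    rw [← Matrix.map_mul, ← key, ← Matrix.map_sub _ (by simp), e1]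
    simp
  have m1 : D.map (algebraMap ℝ ℂ) * (B * sympForm ι).map (algebraMap ℝ ℂ) =
      (s : ℂ) • (A * sympForm ι).map (algebraMap ℝ ℂ) := by
    rw [← Matrix.map_mul, hDBJ, key]
  have m2 : (sympForm ι).map (algebraMap ℝ ℂ) * A.map (algebraMap ℝ ℂ) =
      (A * sympForm ι).map (algebraMap ℝ ℂ) := by
    rw [← Matrix.map_mul, hJA]
  have m3 : (sympForm ι).map (algebraMap ℝ ℂ) * (B * sympForm ι).map (algebraMap ℝ ℂ) =
      -(B.map (algebraMap ℝ ℂ)) := by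
    rw [← Matrix.map_mul, hJBJ]
    ext
    simp
  rw [complexCov, add_mul, mul_sub, mul_sub, mul_smul_comm, smul_mul_smul_comm, smul_mul_assoc,
    m1, m2, m3, ← e1']
  rw [mul_right_comm, Complex.I_mul_I, smul_smul]
  simp only [neg_mul, one_mul, smul_neg, neg_smul, neg_neg]
  abel

end ComplexCovariance

end BosonicModes

namespace BosonicModes

/-! ### The entropy as an integral of logarithms of determinants -/

section LogDet

/-- Since `∏ (λ_l² - s²) = det (M + i s J)`, this formula expresses the entropy of a Gaussian state
as the integral over `0 ≤ s ≤ 1` of `log det (M + i s J) / 2`, up to an additive constant. -/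
theorem modeEntropy_eq_integral {x : ℝ} (hx : 1 ≤ x) :
    IntervalIntegrable (fun s => Real.log (x - s) + Real.log (x + s)) volume 0 1 ∧
      modeEntropy x = 1 / 2 * (∫ s in (0 : ℝ)..1, (Real.log (x - s) + Real.log (x + s))) +
        (1 - Real.log 2) := by
  have h1 : IntervalIntegrable (fun s => Real.log (x - s)) volume 0 1 := by
    have := (intervalIntegral.intervalIntegrable_log' (a := x - 0) (b := x - 1)).comp_sub_left x
    simpa using this
  have h2 : IntervalIntegrable (fun s => Real.log (x + s)) volume 0 1 := by
    have := (intervalIntegral.intervalIntegrable_log' (a := x + 0) (b := x + 1)).comp_add_left x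
    simpa using this
  refine ⟨h1.add h2, ?_⟩
  rw [intervalIntegral.integral_add h1 h2, intervalIntegral.integral_comp_sub_left Real.log,
    intervalIntegral.integral_comp_add_left Real.log, integral_log, integral_log, modeEntropy,
    Real.log_div (by linarith) two_ne_zero]
  simp only [sub_zero, add_zero]
  rcases hx.eq_or_lt with rfl | hx
  · simp
    ring
  · rw [Real.log_div (by linarith) two_ne_zero]
    ring

variable {ι : Type} [Fintype ι] [DecidableEq ι]

/-- `∑ log (λ_l² - s²)`, the logarithm of `det (M + i s J)` for a matrix `M` with symplectic
eigenvalues `λ_l`. -/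
noncomputable def logDet (lam : ι → ℝ) (s : ℝ) : ℝ :=
  ∑ l, (Real.log (lam l - s) + Real.log (lam l + s))

omit [DecidableEq ι] in
theorem intervalIntegrable_logDet {lam : ι → ℝ} (hlam : ∀ l, 1 ≤ lam l) :
    IntervalIntegrable (logDet lam) volume 0 1 := by
  have h := IntervalIntegrable.sum (μ := volume) (a := 0) (b := 1) Finset.univ
    fun l (_ : l ∈ Finset.univ) => (modeEntropy_eq_integral (hlam l)).1
  convert! h using 1
  funext s
  simp [logDet]

omit [DecidableEq ι] in
theorem sum_modeEntropy_eq_integral {lam : ι → ℝ} (hlam : ∀ l, 1 ≤ lam l) :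
    ∑ l, modeEntropy (lam l) = 1 / 2 * (∫ s in (0 : ℝ)..1, logDet lam s) +
      Fintype.card ι * (1 - Real.log 2) := by
  unfold logDet
  rw [intervalIntegral.integral_finsetSum fun l _ => (modeEntropy_eq_integral (hlam l)).1,
    Finset.mul_sum]
  rw [Finset.sum_congr rfl fun l _ => (modeEntropy_eq_integral (hlam l)).2, Finset.sum_add_distrib,
    Finset.sum_const, Finset.card_univ, nsmul_eq_mul]

omit [DecidableEq ι] in
theorem logDet_eq_log_prod {lam : ι → ℝ} (hlam : ∀ l, 1 ≤ lam l) {s : ℝ} (hs0 : 0 ≤ s)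
    (hs1 : s < 1) : logDet lam s = Real.log (∏ l, (lam l ^ 2 - s ^ 2)) := by
  rw [Real.log_prod fun l _ => by nlinarith [hlam l]]
  refine Finset.sum_congr rfl fun l _ => ?_
  have := hlam l
  rw [← Real.log_mul (by linarith) (by linarith)]
  congr 1
  ring

/-- The derivative at `t = 0` of `log det (M + t P + i s J)`, where `x l` is the trace of the block
of `S P Sᵀ` belonging to the mode `l`. -/
noncomputable def logDetRate (lam x : ι → ℝ) (s : ℝ) : ℝ :=
  ∑ l, lam l / (lam l ^ 2 - s ^ 2) * x l

theorem trace_doubledDiagonal_mul (a : ι → ℝ) (X : Matrix (PhaseIdx ι) (PhaseIdx ι) ℝ) :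
    (doubledDiagonal a * X).trace = ∑ l, a l * (modeBlock X l).trace := by
  simp only [Matrix.trace, Matrix.diag_apply, doubledDiagonal, Matrix.diagonal_mul,
    Fintype.sum_prod_type, Fin.sum_univ_two, modeBlock, Matrix.submatrix_apply, mul_add]

theorem trace_doubledDiagonal_mul_sympForm_mul (a : ι → ℝ)
    {X : Matrix (PhaseIdx ι) (PhaseIdx ι) ℝ} (hX : X.IsSymm) :
    (doubledDiagonal a * sympForm ι * X).trace = 0 := by
  have h : (doubledDiagonal a * sympForm ι * X).trace =
      -(doubledDiagonal a * sympForm ι * X).trace := by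
    conv_lhs => rw [← Matrix.trace_transpose, Matrix.transpose_mul, Matrix.transpose_mul,
      sympForm_transpose, doubledDiagonal_transpose, hX, Matrix.trace_mul_comm, neg_mul, neg_mul,
      Matrix.trace_neg, ← doubledDiagonal_mul_sympForm]
  linarith

section Ray

variable {M S : Matrix (PhaseIdx ι) (PhaseIdx ι) ℝ} {lam : ι → ℝ} {p : PhaseIdx ι → ℝ}

theorem modeBlock_trace_nonneg (hp : ∀ i, 0 ≤ p i) (l : ι) :
    0 ≤ (modeBlock (S * Matrix.diagonal p * Sᵀ) l).trace := by
  refine Finset.sum_nonneg fun a _ => ?_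
  rw [modeBlock, Matrix.diag_apply, Matrix.submatrix_apply, Matrix.mul_apply]
  refine Finset.sum_nonneg fun q _ => ?_
  rw [Matrix.mul_diagonal, Matrix.transpose_apply, mul_right_comm]
  exact mul_nonneg (mul_self_nonneg _) (hp q)

open scoped ComplexOrder in
/-- Along the ray `M + t P` the function `det (M + t P + i s J)` is, for `0 ≤ s < 1`, a product of
factors `1 + t κ_j` with `κ_j ≥ 0`. -/
theorem exists_logDet_sub_eq (hS : IsSymplectic S) (hSM : S * M * Sᵀ = doubledDiagonal lam)
    (hlam : ∀ l, 1 ≤ lam l) (hp : ∀ i, 0 ≤ p i) {s : ℝ} (hs0 : 0 ≤ s) (hs1 : s < 1) :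
    ∃ κ : PhaseIdx ι → ℝ, (∀ j, 0 ≤ κ j) ∧
      ∑ j, κ j = logDetRate lam (fun l => (modeBlock (S * Matrix.diagonal p * Sᵀ) l).trace) s ∧
      ∀ (t : ℝ) (T : Matrix (PhaseIdx ι) (PhaseIdx ι) ℝ) (mu : ι → ℝ), 0 ≤ t → IsSymplectic T →
        T * (M + t • Matrix.diagonal p) * Tᵀ = doubledDiagonal mu → (∀ l, 1 ≤ mu l) →
        logDet mu s - logDet lam s = ∑ j, Real.log (1 + t * κ j) := by
  set P : Matrix (PhaseIdx ι) (PhaseIdx ι) ℝ := Matrix.diagonal p with hPdef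
  set X := S * P * Sᵀ with hX
  have hXs : X.IsSymm := by
    rw [Matrix.IsSymm, hX, Matrix.transpose_mul, Matrix.transpose_mul, Matrix.transpose_transpose,
      hPdef, Matrix.diagonal_transpose, mul_assoc]
  have hXp : (X.map (algebraMap ℝ ℂ)).PosSemidef := by
    have h1 : (Matrix.diagonal fun i => (p i : ℂ)).PosSemidef := by
      rw [Matrix.posSemidef_diagonal_iff]
      intro i
      rw [Complex.zero_le_real]
      exact hp i
    have h2 := h1.mul_mul_conjTranspose_same (S.map (algebraMap ℝ ℂ))
    have h3 : P.map (algebraMap ℝ ℂ) = Matrix.diagonal fun i => (p i : ℂ) := by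
      rw [hPdef, Matrix.diagonal_map (by simp)]
      rfl
    have h4 : Sᵀ.map (algebraMap ℝ ℂ) = (S.map (algebraMap ℝ ℂ))ᴴ := by
      ext i j
      simp [Matrix.conjTranspose_apply]
    rwa [hX, Matrix.map_mul, Matrix.map_mul, h3, h4]
  obtain ⟨κ, hκ0, hκ1, hκ⟩ := exists_det_add_smul
    (posDef_complexCov_doubledDiagonal hlam hs0 hs1) hXp
    (complexCov_doubledDiagonal_mul_inverse hlam hs0 hs1)
  refine ⟨κ, hκ0, ?_, fun t T mu ht hT hTM hmu => ?_⟩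
  · have hmap : ∀ Y : Matrix (PhaseIdx ι) (PhaseIdx ι) ℝ,
        (Y.map (algebraMap ℝ ℂ)).trace = ((Y.trace : ℝ) : ℂ) := by
      intro Y
      simp [Matrix.trace]
    rw [sub_mul, smul_mul_assoc, Matrix.trace_sub, Matrix.trace_smul, ← Matrix.map_mul,
      ← Matrix.map_mul, hmap, hmap, trace_doubledDiagonal_mul_sympForm_mul _ hXs,
      trace_doubledDiagonal_mul] at hκ1
    rw [Complex.ofReal_zero, smul_zero, sub_zero] at hκ1
    exact_mod_cast hκ1
  · have h1 : complexCov (doubledDiagonal lam) s + (t : ℂ) • X.map (algebraMap ℝ ℂ) =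
        complexCov (doubledDiagonal lam + t • X) s := by
      ext i j
      simp [complexCov]
      ring
    have h2 : S * (M + t • P) * Sᵀ = doubledDiagonal lam + t • X := by
      rw [mul_add, add_mul, hSM, mul_smul_comm, smul_mul_assoc]
    have h3 := hκ t
    rw [h1, ← det_complexCov_congr hS h2, det_complexCov_congr hT hTM,
      det_complexCov_doubledDiagonal, det_complexCov_doubledDiagonal, ← Complex.ofReal_prod,
      ← Complex.ofReal_mul, Complex.ofReal_inj] at h3
    have h4 : ∀ j, 0 < 1 + t * κ j := fun j => by have := mul_nonneg ht (hκ0 j); linarith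
    have h5 : ∏ l, (lam l ^ 2 - s ^ 2) ≠ 0 :=
      Finset.prod_ne_zero_iff.2 fun l _ => by nlinarith [hlam l]
    rw [logDet_eq_log_prod hmu hs0 hs1, logDet_eq_log_prod hlam hs0 hs1, h3,
      Real.log_mul h5 (Finset.prod_pos fun j _ => h4 j).ne', add_sub_cancel_left,
      Real.log_prod fun j _ => (h4 j).ne']

end Ray

/-- The derivative of `∑ log (1 + t κ_j)` at `t = 0`. -/
theorem tendsto_sum_log_div {n : Type*} [Fintype n] (κ : n → ℝ) :
    Tendsto (fun t : ℝ => (∑ j, Real.log (1 + t * κ j)) / t) (𝓝[>] 0) (𝓝 (∑ j, κ j)) := by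
  have h : HasDerivAt (fun t : ℝ => ∑ j, Real.log (1 + t * κ j)) (∑ j, κ j) 0 := by
    refine HasDerivAt.fun_sum fun j _ => ?_
    have h1 : HasDerivAt (fun t : ℝ => 1 + t * κ j) (κ j) 0 := by
      simpa using ((hasDerivAt_id (0 : ℝ)).mul_const (κ j)).const_add 1
    simpa using h1.log (by simp)
  have h2 := h.tendsto_slope_zero_right
  simp only [zero_add, zero_mul, add_zero, Real.log_one, Finset.sum_const_zero, sub_zero,
    smul_eq_mul] at h2
  refine h2.congr fun t => ?_
  rw [div_eq_inv_mul]

omit [DecidableEq ι] in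
theorem integral_logDetRate {lam x : ι → ℝ} {a : ℝ} (ha : 0 ≤ a)
    (h : ∀ l, x l = 0 ∨ a < lam l) :
    IntervalIntegrable (logDetRate lam x) volume 0 a ∧
      ∫ s in (0 : ℝ)..a, logDetRate lam x s =
        ∑ l, 1 / 2 * (Real.log (lam l + a) - Real.log (lam l - a)) * x l := by
  have key : ∀ l, IntervalIntegrable (fun s => lam l / (lam l ^ 2 - s ^ 2) * x l) volume 0 a ∧
      ∫ s in (0 : ℝ)..a, lam l / (lam l ^ 2 - s ^ 2) * x l =
        1 / 2 * (Real.log (lam l + a) - Real.log (lam l - a)) * x l := by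
    intro l
    rcases h l with h0 | h1
    · simp [h0]
    · have hpos : ∀ s ∈ Set.uIcc 0 a, 0 < lam l - s ∧ 0 < lam l + s := by
        intro s hs
        rw [Set.uIcc_of_le ha] at hs
        constructor <;> linarith [hs.1, hs.2]
      have hint : IntervalIntegrable (fun s => lam l / (lam l ^ 2 - s ^ 2)) volume 0 a := by
        refine ContinuousOn.intervalIntegrable ?_
        refine ContinuousOn.div (by fun_prop) (by fun_prop) fun s hs => ?_
        have := hpos s hs
        have e : lam l ^ 2 - s ^ 2 = (lam l - s) * (lam l + s) := by ring
        rw [e]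
        exact (mul_pos this.1 this.2).ne'
      refine ⟨hint.mul_const _, ?_⟩
      rw [intervalIntegral.integral_mul_const, intervalIntegral.integral_eq_sub_of_hasDerivAt
        (f := fun s => 1 / 2 * (Real.log (lam l + s) - Real.log (lam l - s))) _ hint]
      · simp
      · intro s hs
        have hs' := hpos s hs
        have h2 := ((hasDerivAt_id s).const_add (lam l)).log hs'.2.ne'
        have h3 := ((hasDerivAt_id s).const_sub (lam l)).log hs'.1.ne'
        convert! (h2.sub h3).const_mul (1 / 2) using 1
        have e1 := hs'.1.ne'
        have e2 := hs'.2.ne'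
        have e3 : lam l ^ 2 - s ^ 2 ≠ 0 := by
          rw [show lam l ^ 2 - s ^ 2 = (lam l - s) * (lam l + s) by ring]
          exact mul_ne_zero e1 e2
        simp only [id]
        field_simp
        ring
  unfold logDetRate
  refine ⟨?_, ?_⟩
  · have h2 := IntervalIntegrable.sum (μ := volume) (a := 0) (b := a) Finset.univ
      fun l (_ : l ∈ Finset.univ) => (key l).1
    convert! h2 using 1
    funext s
    simp
  · rw [intervalIntegral.integral_finsetSum fun l _ => (key l).1]
    exact Finset.sum_congr rfl fun l _ => (key l).2

/-- Convergence of the difference quotients of the entropy, cut off at `s = a` in the integral over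
`s`. -/
theorem tendsto_integral_logDet_quotient {M S : Matrix (PhaseIdx ι) (PhaseIdx ι) ℝ} {lam : ι → ℝ}
    {p : PhaseIdx ι → ℝ} (hS : IsSymplectic S) (hSM : S * M * Sᵀ = doubledDiagonal lam)
    (hlam : ∀ l, 1 ≤ lam l) (hp : ∀ i, 0 ≤ p i)
    {T : ℝ → Matrix (PhaseIdx ι) (PhaseIdx ι) ℝ} {mu : ℝ → ι → ℝ}
    (hT : ∀ t, 0 < t → IsSymplectic (T t))
    (hTM : ∀ t, 0 < t → T t * (M + t • Matrix.diagonal p) * (T t)ᵀ = doubledDiagonal (mu t))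
    (hmu : ∀ t, 0 < t → ∀ l, 1 ≤ mu t l) {a : ℝ} (ha0 : 0 ≤ a) (ha1 : a ≤ 1)
    (hint : IntervalIntegrable
      (logDetRate lam fun l => (modeBlock (S * Matrix.diagonal p * Sᵀ) l).trace) volume 0 a) :
    Tendsto (fun t => ∫ s in (0 : ℝ)..a, (logDet (mu t) s - logDet lam s) / t) (𝓝[>] 0)
      (𝓝 (∫ s in (0 : ℝ)..a,
        logDetRate lam (fun l => (modeBlock (S * Matrix.diagonal p * Sᵀ) l).trace) s)) := by
  have hsub : Set.uIcc 0 a ⊆ Set.uIcc (0 : ℝ) 1 := by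
    rw [Set.uIcc_of_le ha0, Set.uIcc_of_le zero_le_one]
    exact Set.Icc_subset_Icc_right ha1
  have hae : ∀ᵐ s : ℝ, s ≠ 1 := compl_mem_ae_iff.2 (measure_singleton 1)
  refine intervalIntegral.tendsto_integral_filter_of_dominated_convergence _ ?_ ?_ hint ?_
  · filter_upwards [self_mem_nhdsWithin] with t ht
    have h : IntervalIntegrable _ volume 0 a := (((intervalIntegrable_logDet (hmu t ht)).sub
      (intervalIntegrable_logDet hlam)).mono_set hsub).div_const t
    exact (intervalIntegrable_iff.1 h).aestronglyMeasurable
  · filter_upwards [self_mem_nhdsWithin] with t (ht : 0 < t)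
    filter_upwards [hae] with s hs1 hs
    rw [Set.uIoc_of_le ha0] at hs
    obtain ⟨κ, hκ0, hκ1, hκ⟩ := exists_logDet_sub_eq hS hSM hlam hp hs.1.le
      (lt_of_le_of_ne (hs.2.trans ha1) hs1)
    -- `0 ≤ log (1 + t κ) ≤ t κ`
    rw [hκ t _ _ ht.le (hT t ht) (hTM t ht) (hmu t ht), ← hκ1, Real.norm_of_nonneg, div_le_iff₀ ht,
      Finset.sum_mul]
    · refine Finset.sum_le_sum fun j _ => ?_
      have := mul_nonneg ht.le (hκ0 j)
      refine (Real.log_le_sub_one_of_pos (by linarith)).trans ?_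
      linarith
    · refine div_nonneg (Finset.sum_nonneg fun j _ => Real.log_nonneg ?_) ht.le
      have := mul_nonneg ht.le (hκ0 j)
      linarith
  · filter_upwards [hae] with s hs1 hs
    rw [Set.uIoc_of_le ha0] at hs
    obtain ⟨κ, hκ0, hκ1, hκ⟩ := exists_logDet_sub_eq hS hSM hlam hp hs.1.le
      (lt_of_le_of_ne (hs.2.trans ha1) hs1)
    rw [← hκ1]
    refine (tendsto_sum_log_div κ).congr' ?_
    filter_upwards [self_mem_nhdsWithin] with t (ht : 0 < t)
    rw [hκ t _ _ ht.le (hT t ht) (hTM t ht) (hmu t ht)]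

end LogDet

end BosonicModes

namespace BosonicModes

/-! ### The rate of entropy increase along a ray of covariance matrices -/

section Rate

variable {ι : Type} [Fintype ι] [DecidableEq ι]
  {M S : Matrix (PhaseIdx ι) (PhaseIdx ι) ℝ} {lam : ι → ℝ}
  {p : PhaseIdx ι → ℝ} {T : ℝ → Matrix (PhaseIdx ι) (PhaseIdx ι) ℝ} {mu : ℝ → ι → ℝ}

omit [DecidableEq ι] in
theorem sum_modeEntropy_quotient (hlam : ∀ l, 1 ≤ lam l) {nu : ι → ℝ} (hnu : ∀ l, 1 ≤ nu l)
    (t : ℝ) : (∑ l, modeEntropy (nu l) - ∑ l, modeEntropy (lam l)) / t =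
      1 / 2 * ∫ s in (0 : ℝ)..1, (logDet nu s - logDet lam s) / t := by
  rw [sum_modeEntropy_eq_integral hlam, sum_modeEntropy_eq_integral hnu,
    intervalIntegral.integral_div, intervalIntegral.integral_sub (intervalIntegrable_logDet hnu)
      (intervalIntegrable_logDet hlam)]
  ring

/-- If the modes with symplectic eigenvalue one are not heated, then the rate of the logarithm of the
determinant is integrable up to `s = 1`, and the difference quotients of the entropy converge. -/
theorem tendsto_entropy_quotient (hS : IsSymplectic S) (hSM : S * M * Sᵀ = doubledDiagonal lam)
    (hlam : ∀ l, 1 ≤ lam l) (hp : ∀ i, 0 ≤ p i)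
    (hT : ∀ t, 0 < t → IsSymplectic (T t))
    (hTM : ∀ t, 0 < t → T t * (M + t • Matrix.diagonal p) * (T t)ᵀ = doubledDiagonal (mu t))
    (hmu : ∀ t, 0 < t → ∀ l, 1 ≤ mu t l)
    (h : ∀ l, lam l = 1 → (modeBlock (S * Matrix.diagonal p * Sᵀ) l).trace = 0) :
    Tendsto (fun t => (∑ l, modeEntropy (mu t l) - ∑ l, modeEntropy (lam l)) / t) (𝓝[>] 0)
      (𝓝 (1 / 4 * ∑ l, invTemp (lam l) * (modeBlock (S * Matrix.diagonal p * Sᵀ) l).trace)) := by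
  set x : ι → ℝ := fun l => (modeBlock (S * Matrix.diagonal p * Sᵀ) l).trace with hx
  have h1 : ∀ l, x l = 0 ∨ 1 < lam l := fun l =>
    (hlam l).eq_or_lt.imp (fun hl => h l hl.symm) id
  obtain ⟨hint, hval⟩ := integral_logDetRate zero_le_one h1
  have h2 := (tendsto_integral_logDet_quotient hS hSM hlam hp hT hTM hmu zero_le_one le_rfl
    hint).const_mul (1 / 2)
  rw [hval] at h2
  have h3 : 1 / 2 * ∑ l, 1 / 2 * (Real.log (lam l + 1) - Real.log (lam l - 1)) * x l =
      1 / 4 * ∑ l, invTemp (lam l) * x l := by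
    rw [Finset.mul_sum, Finset.mul_sum]
    refine Finset.sum_congr rfl fun l _ => ?_
    rcases h1 l with h0 | h1
    · rw [h0]; ring
    · rw [invTemp, Real.log_div (by linarith) (by linarith)]
      ring
  rw [h3] at h2
  refine h2.congr' ?_
  filter_upwards [self_mem_nhdsWithin] with t (ht : 0 < t)
  exact (sum_modeEntropy_quotient hlam (hmu t ht) t).symm

/-- If a mode with symplectic eigenvalue one is heated, then the rate of the logarithm of the
determinant has the non-integrable singularity `1 / (1 - s²)` at `s = 1`, and the difference
quotients of the entropy diverge. -/
theorem tendsto_entropy_quotient_atTop (hS : IsSymplectic S)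
    (hSM : S * M * Sᵀ = doubledDiagonal lam) (hlam : ∀ l, 1 ≤ lam l) (hp : ∀ i, 0 ≤ p i)
    (hT : ∀ t, 0 < t → IsSymplectic (T t))
    (hTM : ∀ t, 0 < t → T t * (M + t • Matrix.diagonal p) * (T t)ᵀ = doubledDiagonal (mu t))
    (hmu : ∀ t, 0 < t → ∀ l, 1 ≤ mu t l)
    (h : ∃ l, lam l = 1 ∧ (modeBlock (S * Matrix.diagonal p * Sᵀ) l).trace ≠ 0) :
    Tendsto (fun t => (∑ l, modeEntropy (mu t l) - ∑ l, modeEntropy (lam l)) / t) (𝓝[>] 0)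
      atTop := by
  set x : ι → ℝ := fun l => (modeBlock (S * Matrix.diagonal p * Sᵀ) l).trace with hx
  have hx0 : ∀ l, 0 ≤ x l := fun l => modeBlock_trace_nonneg hp l
  obtain ⟨l₀, hl₀, hne⟩ := h
  have hxl : 0 < x l₀ := lt_of_le_of_ne (hx0 l₀) (Ne.symm hne)
  rw [tendsto_atTop]
  intro C
  -- the cut-off `a` is so close to `1` that the limit of the truncated quotient exceeds `C`
  set K : ℝ := max 0 (4 * (C + 1) / x l₀) with hK
  have hK0 : 0 ≤ K := le_max_left _ _
  have hKC : 4 * (C + 1) ≤ K * x l₀ := by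
    rw [← div_le_iff₀ hxl]
    exact le_max_right _ _
  set a : ℝ := 1 - Real.exp (-K) with ha
  have ha0 : 0 ≤ a := by
    have : Real.exp (-K) ≤ 1 := Real.exp_le_one_iff.2 (by linarith)
    linarith
  have ha1 : a < 1 := by
    have := Real.exp_pos (-K)
    linarith
  obtain ⟨hint, hval⟩ := integral_logDetRate (lam := lam) (x := x) ha0
    fun l => Or.inr (ha1.trans_le (hlam l))
  have h2 := (tendsto_integral_logDet_quotient hS hSM hlam hp hT hTM hmu ha0 ha1.le
    hint).const_mul (1 / 2)
  rw [hval] at h2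
  have h3 : C < 1 / 2 * ∑ l, 1 / 2 * (Real.log (lam l + a) - Real.log (lam l - a)) * x l := by
    have h4 : 1 / 2 * (Real.log (lam l₀ + a) - Real.log (lam l₀ - a)) * x l₀ ≤
        ∑ l, 1 / 2 * (Real.log (lam l + a) - Real.log (lam l - a)) * x l := by
      refine Finset.single_le_sum
        (f := fun l => 1 / 2 * (Real.log (lam l + a) - Real.log (lam l - a)) * x l)
        (fun l _ => mul_nonneg (mul_nonneg (by norm_num) (sub_nonneg.2 ?_)) (hx0 l))
        (Finset.mem_univ l₀)
      exact Real.log_le_log (by linarith [hlam l]) (by linarith)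
    have h5 : K ≤ Real.log (lam l₀ + a) - Real.log (lam l₀ - a) := by
      rw [hl₀, show 1 - a = Real.exp (-K) by rw [ha]; ring, Real.log_exp]
      have := Real.log_nonneg (by linarith : 1 ≤ 1 + a)
      linarith
    have h6 := mul_le_mul_of_nonneg_right h5 hxl.le
    linarith
  filter_upwards [h2.eventually (lt_mem_nhds h3), self_mem_nhdsWithin] with t hC (ht : 0 < t)
  rw [sum_modeEntropy_quotient hlam (hmu t ht)]
  refine hC.le.trans (mul_le_mul_of_nonneg_left ?_ (by norm_num))
  have hI := ((intervalIntegrable_logDet (hmu t ht)).sub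
    (intervalIntegrable_logDet hlam)).div_const t
  refine intervalIntegral.integral_mono_interval le_rfl ha0 ha1.le ?_ hI
  have hae : ∀ᵐ s : ℝ, s ≠ 1 := compl_mem_ae_iff.2 (measure_singleton 1)
  rw [EventuallyLE, ae_restrict_iff' measurableSet_Ioc]
  filter_upwards [hae] with s hs1 hs
  obtain ⟨κ, hκ0, -, hκ⟩ := exists_logDet_sub_eq hS hSM hlam hp hs.1.le (lt_of_le_of_ne hs.2 hs1)
  rw [hκ t _ _ ht.le (hT t ht) (hTM t ht) (hmu t ht)]
  refine div_nonneg (Finset.sum_nonneg fun j _ => Real.log_nonneg ?_) ht.le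
  have := mul_nonneg ht.le (hκ0 j)
  linarith

theorem modeEntropy_nonneg {x : ℝ} (hx : 1 ≤ x) : 0 ≤ modeEntropy x := by
  refine (hasSum_negMulLog_geometric hx).nonneg fun k => ?_
  have h0 : 0 ≤ (x - 1) / (x + 1) := div_nonneg (by linarith) (by linarith)
  have h1 : 0 ≤ 2 / (x + 1) := div_nonneg two_pos.le (by linarith)
  refine Real.negMulLog_nonneg (mul_nonneg h1 (pow_nonneg h0 k)) (mul_le_one₀ ?_ (pow_nonneg h0 k)
    (pow_le_one₀ h0 ?_))
  · rw [div_le_one (by linarith)]; linarith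
  · rw [div_le_one (by linarith)]; linarith

end Rate

/-! ### The entropies of the diffused state -/

section Diffusion

theorem IsGaussianState.posDef {ι : Type} [Fintype ι] [DecidableEq ι] {ρ : ModeOp ι}
    {M S : Matrix (PhaseIdx ι) (PhaseIdx ι) ℝ} {d : PhaseIdx ι → ℝ} (hρ : IsGaussianState ρ M d)
    (hS : IsSymplectic S) {lam : ι → ℝ} (hSM : S * M * Sᵀ = doubledDiagonal lam) : M.PosDef := by
  have hlam := (hρ.entropy_eq hS hSM).1
  have hD : (doubledDiagonal lam).PosDef := by
    rw [doubledDiagonal, Matrix.posDef_diagonal_iff]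
    intro q
    linarith [hlam q.1]
  set R := -(sympForm ι * Sᵀ * sympForm ι) with hR
  have hRS : R * S = 1 := hS.inverse_mul
  have hSR : Sᵀ * Rᵀ = 1 := by rw [← Matrix.transpose_mul, hRS, Matrix.transpose_one]
  have hM : M = R * doubledDiagonal lam * Rᴴ := by
    rw [Matrix.conjTranspose_eq_transpose_of_trivial, ← hSM]
    calc M = (R * S) * M * (Sᵀ * Rᵀ) := by rw [hRS, hSR, one_mul, mul_one]
      _ = R * (S * M * Sᵀ) * Rᵀ := by simp only [mul_assoc]
  rw [hM]
  refine hD.mul_mul_conjTranspose_same (Matrix.vecMul_injective_of_isUnit ?_)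
  exact IsUnit.of_mul_eq_one _ hRS

/-- A Gaussian state with positive definite covariance matrix has finite entropy; the entropy
depends on the covariance matrix only. -/
theorem IsGaussianState.exists_entropy_eq {ι : Type} [Fintype ι] [DecidableEq ι]
    {M : Matrix (PhaseIdx ι) (PhaseIdx ι) ℝ} (hM : M.PosDef) :
    ∃ c : ℝ, ∀ (ρ : ModeOp ι) (d : PhaseIdx ι → ℝ), IsGaussianState ρ M d →
      entropy ρ = ENNReal.ofReal c := by
  obtain ⟨S, lam, hS, hSM⟩ := exists_symplectic_diagonalization hM
  exact ⟨_, fun ρ d hρ => (hρ.entropy_eq hS hSM).2⟩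

end Diffusion

end BosonicModes


theorem mainTheorem4 (m n : ℕ)
    (ρ : ModeOp (Fin m ⊕ Fin n))
    (M : Matrix (PhaseIdx (Fin m ⊕ Fin n)) (PhaseIdx (Fin m ⊕ Fin n)) ℝ)
    (d : PhaseIdx (Fin m ⊕ Fin n) → ℝ)
    (hρ : IsGaussianState ρ M d)
    (S : Matrix (PhaseIdx (Fin m ⊕ Fin n)) (PhaseIdx (Fin m ⊕ Fin n)) ℝ)
    (lam : Fin m ⊕ Fin n → ℝ)
    (hS : IsSymplectic S)
    (hSM : S * M * Sᵀ = doubledDiagonal lam) :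
    (∀ t : ℝ, 0 ≤ t →
      IsGaussianState (diffusionA t ρ) (M + t • projA (Fin m) (Fin n)) d ∧
      entropy (diffusionA t ρ) ≠ ⊤ ∧ entropy (partialTraceA (diffusionA t ρ)) ≠ ⊤) ∧
    ((∀ l, lam l = 1 → (modeBlock (S * projA (Fin m) (Fin n) * Sᵀ) l).trace = 0) →
      HasDerivWithinAt (fun t : ℝ => condEntropy (diffusionA t ρ))
        (1 / 4 * ∑ l, invTemp (lam l) * (modeBlock (S * projA (Fin m) (Fin n) * Sᵀ) l).trace)
        (Set.Ici 0) 0) ∧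
    ((∃ l, lam l = 1 ∧ (modeBlock (S * projA (Fin m) (Fin n) * Sᵀ) l).trace ≠ 0) →
      Tendsto
        (fun t : ℝ => (condEntropy (diffusionA t ρ) - condEntropy (diffusionA 0 ρ)) / t)
        (𝓝[>] 0) atTop) := by
  set p : PhaseIdx (Fin m ⊕ Fin n) → ℝ := fun q => Sum.elim (fun _ => 1) (fun _ => 0) q.1 with hpdef
  have hP : projA (Fin m) (Fin n) = Matrix.diagonal p := rfl
  have hp : ∀ q, 0 ≤ p q := by
    rintro ⟨l | l, a⟩ <;> simp [hpdef]
  have hM : M.PosDef := hρ.posDef hS hSM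
  have hG : ∀ t : ℝ, 0 ≤ t →
      IsGaussianState (diffusionA t ρ) (M + t • projA (Fin m) (Fin n)) d :=
    fun t ht => hρ.diffusionA ht
  have hMt : ∀ t : ℝ, 0 ≤ t → (M + t • projA (Fin m) (Fin n)).PosDef := by
    intro t ht
    refine hM.add_posSemidef (Matrix.PosSemidef.smul ?_ ht)
    rw [hP, Matrix.posSemidef_diagonal_iff]
    exact hp
  -- the reduced state keeps its covariance matrix and hence its entropy
  obtain ⟨c, hc⟩ := IsGaussianState.exists_entropy_eq
    (hM.submatrix (e := fun q : PhaseIdx (Fin n) => ((Sum.inr q.1, q.2) : PhaseIdx (Fin m ⊕ Fin n)))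
      fun q r h => by
        simp only [Prod.mk.injEq, Sum.inr.injEq] at h
        exact Prod.ext h.1 h.2)
  have hB : ∀ t : ℝ, 0 ≤ t → entropy (partialTraceA (diffusionA t ρ)) = ENNReal.ofReal c := by
    intro t ht
    refine hc _ (fun q => d (Sum.inr q.1, q.2)) ?_
    convert! (hG t ht).partialTraceA using 1
    ext q r
    simp [projA, Matrix.diagonal_apply]
  -- the matrices that diagonalize the covariance matrices at the times `t ≥ 0`
  have hdiag : ∀ t : ℝ, ∃ (T : Matrix (PhaseIdx (Fin m ⊕ Fin n)) (PhaseIdx (Fin m ⊕ Fin n)) ℝ)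
      (mu : Fin m ⊕ Fin n → ℝ), 0 ≤ t → IsSymplectic T ∧
        T * (M + t • Matrix.diagonal p) * Tᵀ = doubledDiagonal mu := by
    intro t
    by_cases ht : 0 ≤ t
    · obtain ⟨T, mu, hT, hTM⟩ := exists_symplectic_diagonalization (hMt t ht)
      exact ⟨T, mu, fun _ => ⟨hT, hTM⟩⟩
    · exact ⟨0, 0, fun h => absurd h ht⟩
  choose T mu hTmu using hdiag
  have hA : ∀ t : ℝ, 0 ≤ t → (∀ l, 1 ≤ mu t l) ∧
      entropy (diffusionA t ρ) = ENNReal.ofReal (∑ l, modeEntropy (mu t l)) :=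
    fun t ht => (hG t ht).entropy_eq (hTmu t ht).1 (hTmu t ht).2
  -- at `t = 0` the given matrix `S` is used instead of `T 0`
  have h0 : (∀ l, 1 ≤ lam l) ∧
      entropy (diffusionA 0 ρ) = ENNReal.ofReal (∑ l, modeEntropy (lam l)) :=
    (hG 0 le_rfl).entropy_eq hS (by rw [zero_smul, add_zero, hSM])
  have hcond : ∀ t : ℝ, 0 < t → condEntropy (diffusionA t ρ) - condEntropy (diffusionA 0 ρ) =
      ∑ l, modeEntropy (mu t l) - ∑ l, modeEntropy (lam l) := by
    intro t ht
    rw [condEntropy, condEntropy, hB t ht.le, hB 0 le_rfl, (hA t ht.le).2, h0.2,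
      ENNReal.toReal_ofReal (Finset.sum_nonneg fun l _ => modeEntropy_nonneg ((hA t ht.le).1 l)),
      ENNReal.toReal_ofReal (Finset.sum_nonneg fun l _ => modeEntropy_nonneg (h0.1 l))]
    ring
  refine ⟨fun t ht => ⟨hG t ht, ?_, ?_⟩, fun h => ?_, fun h => ?_⟩
  · rw [(hA t ht).2]
    exact ENNReal.ofReal_ne_top
  · rw [hB t ht]
    exact ENNReal.ofReal_ne_top
  · have h1 := tendsto_entropy_quotient hS hSM h0.1 hp (fun t ht => (hTmu t ht.le).1)
      (fun t ht => (hTmu t ht.le).2) (fun t ht => (hA t ht.le).1) h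
    rw [← hasDerivWithinAt_Ioi_iff_Ici, hasDerivWithinAt_iff_tendsto_slope' (by simp)]
    refine h1.congr' ?_
    filter_upwards [self_mem_nhdsWithin] with t (ht : 0 < t)
    rw [slope_def_field, hcond t ht, sub_zero]
  · have h1 := tendsto_entropy_quotient_atTop hS hSM h0.1 hp (fun t ht => (hTmu t ht.le).1)
      (fun t ht => (hTmu t ht.le).2) (fun t ht => (hA t ht.le).1) h
    refine h1.congr' ?_
    filter_upwards [self_mem_nhdsWithin] with t (ht : 0 < t)
    rw [hcond t ht]
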